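/- Let $b\in[0,1)$ and consider the neutral KPP--Fisher equation $$\partial_t\big(u(t,x)-b\,u(t-\tau,x)\big)=\partial_{xx}\big(u(t,x)-b\,u(t-\tau,x)\big)+u(t,x)\big(1-u(t-\tau,x)\big),\qquad t,x\in\mathbb R .$$ For $\tau,c\ge 0$ and real $z$ with $1-be^{-zc\tau}>0$ put $$\chi_0(z)=z^2-cz+\frac{1}{1-be^{-zc\tau}},\qquad \chi_1(z)=z^2-cz-\frac{e^{-zc\tau}}{1-be^{-zc\tau}},$$ and let $\mathfrak D$ be the set of all pairs $(\tau,c)$ with $\tau\ge 0$, $c\ge 0$ such that $\chi_0$ has a positive zero and $\chi_1$ has a negative zero. A monotone travelling front with speed $c$ is a solution of the form $u(t,x)=\phi(x+ct)$, where $\phi:\mathbb R\to\mathbb R$ is monotone, $\phi(-\infty)=0$, $\phi(+\infty)=1$, and $v(r):=\phi(r)-b\,\phi(r-c\tau)$ is $C^2$-smooth on $\mathbb R$; equivalently, $v''(r)-cv'(r)+\phi(r)(1-\phi(r-c\tau))=0$ for all $r\in\mathbb R$. Then for every $(\tau,c)\in\mathfrak D$ the equation has a monotone travelling front with speed $c$,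 and this front is unique up to translation: if $u$ and $w$ are two such fronts (with the same $\tau$ and $c$), then there is $s\in\mathbb R$ with $w(t,x)=u(t,x+s)$ for all $t,x\in\mathbb R$. This includes the critical case, in which the positive zero of $\chi_0$ is a double zero. -/

import Mathlib

open Filter Topology

noncomputable section

/-- The neutral combination `u(t,x) - b u(t-τ,x)`; the first argument of `u` is time,
the second one is space. -/
def neutralPart (b τ : ℝ) (u : ℝ → ℝ → ℝ) (t x : ℝ) : ℝ :=
  u t x - b * u (t - τ) x

/-- `u` is a classical solution on `ℝ × ℝ` of the neutral KPP-Fisher equation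
`∂ₜ (u(t,x) - b u(t-τ,x)) = ∂ₓₓ (u(t,x) - b u(t-τ,x)) + u(t,x) (1 - u(t-τ,x))`.
The derivatives fall on the neutral combination only, so only this one has to be smooth. -/
structure IsNeutralKPPFisherSolution (b τ : ℝ) (u : ℝ → ℝ → ℝ) : Prop where
  differentiable_time : ∀ x : ℝ, Differentiable ℝ (fun s : ℝ => neutralPart b τ u s x)
  contDiff_space : ∀ t : ℝ, ContDiff ℝ 2 (fun y : ℝ => neutralPart b τ u t y)
  equation : ∀ t x : ℝ,
    deriv (fun s : ℝ => neutralPart b τ u s x) t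
      = deriv (deriv (fun y : ℝ => neutralPart b τ u t y)) x + u t x * (1 - u (t - τ) x)

/-- `u` is a monotone traveling front with speed `c` of the neutral KPP-Fisher equation: it is a
solution of the form `u(t,x) = φ(x + ct)`, where the profile `φ` is monotone, connects `0` at `-∞`
with `1` at `+∞`, and is such that `v(r) = φ(r) - b φ(r - cτ)` is of class `C²`. -/
def IsMonotoneTravelingFront (b τ c : ℝ) (u : ℝ → ℝ → ℝ) : Prop :=
  IsNeutralKPPFisherSolution b τ u ∧
    ∃ φ : ℝ → ℝ,
      (∀ t x : ℝ, u t x = φ (x + c * t)) ∧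
      Monotone φ ∧
      ContDiff ℝ 2 (fun r : ℝ => φ r - b * φ (r - c * τ)) ∧
      Tendsto φ atBot (𝓝 0) ∧
      Tendsto φ atTop (𝓝 1)

/-- The characteristic function `χ₀(z) = z² - cz + 1 / (1 - b e^{-zcτ})` on the real line. -/
def chiZero (b τ c z : ℝ) : ℝ :=
  z ^ 2 - c * z + 1 / (1 - b * Real.exp (-(z * c * τ)))

/-- The characteristic function `χ₁(z) = z² - cz - e^{-zcτ} / (1 - b e^{-zcτ})` on the real
line. -/
def chiOne (b τ c z : ℝ) : ℝ :=
  z ^ 2 - c * z - Real.exp (-(z * c * τ)) / (1 - b * Real.exp (-(z * c * τ)))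

/-- The set of pairs `(τ, c)` of nonnegative numbers such that `χ₀` has a positive zero and `χ₁`
has a negative zero. The characteristic functions are considered where `1 - b e^{-zcτ} > 0`,
i.e. for `z > ln b / (cτ)` when `b, c, τ > 0`. -/
def frontDomain (b : ℝ) : Set (ℝ × ℝ) :=
  {p | 0 ≤ p.1 ∧ 0 ≤ p.2 ∧
    (∃ z : ℝ, 0 < z ∧ 0 < 1 - b * Real.exp (-(z * p.2 * p.1)) ∧ chiZero b p.1 p.2 z = 0) ∧
    (∃ z : ℝ, z < 0 ∧ 0 < 1 - b * Real.exp (-(z * p.2 * p.1)) ∧ chiOne b p.1 p.2 z = 0)}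

/-- In terms of the profile, being a solution is the neutral functional differential equation
`v''(r) - c v'(r) + φ(r) (1 - φ(r - cτ)) = 0`, where `v(r) = φ(r) - b φ(r - cτ)` is `C²`. -/
theorem isNeutralKPPFisherSolution_iff_profile (b τ c : ℝ) (φ : ℝ → ℝ)
    (hv : ContDiff ℝ 2 (fun r : ℝ => φ r - b * φ (r - c * τ))) :
    IsNeutralKPPFisherSolution b τ (fun t x => φ (x + c * t)) ↔
      ∀ r : ℝ, deriv (deriv (fun r : ℝ => φ r - b * φ (r - c * τ))) r
        - c * deriv (fun r : ℝ => φ r - b * φ (r - c * τ)) r + φ r * (1 - φ (r - c * τ)) = 0 := by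
  set v : ℝ → ℝ := fun r => φ r - b * φ (r - c * τ) with hvdef
  have hN : ∀ t x, neutralPart b τ (fun t x => φ (x + c * t)) t x = v (x + c * t) := by
    intro t x
    simp only [neutralPart, hvdef]
    congr 3
    ring
  have hd : Differentiable ℝ v := hv.differentiable (by norm_num)
  have ht : ∀ t x, HasDerivAt (fun s => v (x + c * s)) (c * deriv v (x + c * t)) t := by
    intro t x
    have h1 : HasDerivAt (fun s : ℝ => x + c * s) c t := by
      simpa using ((hasDerivAt_id t).const_mul c).const_add x
    have h2 := (hd (x + c * t)).hasDerivAt.comp t h1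
    simpa [mul_comm, Function.comp_def] using h2
  have hx : ∀ t x, deriv (deriv (fun y => v (y + c * t))) x = deriv (deriv v) (x + c * t) := by
    intro t x
    have h1 : deriv (fun y => v (y + c * t)) = fun y => deriv v (y + c * t) := by
      funext y
      exact deriv_comp_add_const v (c * t) y
    rw [h1]
    exact deriv_comp_add_const (deriv v) (c * t) x
  constructor
  · rintro ⟨-, -, h⟩ r
    have := h 0 r
    simp only [hN, hx, (ht _ _).deriv] at this
    have e : r + c * (0 - τ) = r - c * τ := by ring
    simp only [mul_zero, add_zero, e] at this
    linarith
  · intro h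
    refine ⟨fun x t => ?_, fun t => ?_, fun t x => ?_⟩
    · simp only [hN]
      exact (ht t x).differentiableAt
    · simp only [hN]
      exact hv.comp (contDiff_id.add contDiff_const)
    · simp only [hN, hx, (ht _ _).deriv]
      have := h (x + c * t)
      have e : x + c * (t - τ) = x + c * t - c * τ := by ring
      rw [e]
      linarith

end

noncomputable section
namespace NeutralKPP
open Set Real MeasureTheory

/-! ### Monotonicity from the sign of a derivative -/

/-! Put h = cτ and v = φ - b φ(· - h). On bounded functions φ ↦ v is inverted by a geometric series,
because b < 1, and the inverse is positive: one-sided bounds on v pass to φ (`nonneg_of_shift`).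

Existence. Let -θ be the negative zero of χ₁. After adding and subtracting θ(c + θ)v the linear part
factors as (D + θ)(D - (c + θ)), whose inverse is a pair of exponential averages. The delayed factor
enters the reaction with the wrong sign, but on the cone of x ≥ 0 with e^{θt} x nondecreasing one
has x(t - h) ≤ e^{θh} x(t), and χ₁(-θ) = 0 says exactly that the added linear term pays for it
(`source_sub_nonneg`). Hence the iteration preserves the cone order (`step_mono`) and descends from
an upper solution, staying above a lower one. The lower solution needs χ₀ < 0 just to the right of a
positive zero, which fails at a double zero. Therefore the reaction is first multiplied by κ < 1,
which makes the characteristic function negative at the given zero; the fronts, normalised by φ(0) =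
1/2, then converge along a subsequence as κ → 1 (`exists_integralFront`).

Uniqueness. Let r be the smallest positive zero of χ₀. With the weight e^{-rt} the linear part
becomes an exact derivative, and the resulting flux J satisfies J' = e^{-rt} φ(t) φ(t - h). The
sharp bound v' ≤ r v (`Front.v'_le_root`) yields φ = O(e^{3rt/4}) at -∞, so J has a finite negative
limit there (`Front.exists_flux_limit`). A translation by s multiplies this limit by e^{rs}, so two
fronts may be assumed to share it.

For such fronts w = e^{-rt}(v₁ - v₂) is bounded. Suppose S = sup |w| > 0. A strong maximum principle
(`FrontPair.wdiff_lt`) forbids attaining S, and w vanishes at +∞, so S or -S is approached at -∞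
only; by symmetry let it be S. The gap X, equal to S - w plus a nonnegative window integral, obeys
X' = -(J₁ - J₂) - m w with m = -χ₀'(r) ≥ 0, and a Harnack inequality makes X small wherever w is
near S far to the left. If m > 0, then X' is close to -mS there and X is driven below zero. If m =
0, the critical case, then X → 0 at -∞ and any bound X ≤ K on a fixed left half-line improves to
K/2, so X ≤ 0 there although X > 0. -/

lemma monotoneOn_of_hasDerivAt_nonneg {s : Set ℝ} (hs : Convex ℝ s) {f f' : ℝ → ℝ}
    (hf : ∀ t ∈ s, HasDerivAt f (f' t) t) (hf' : ∀ t ∈ s, 0 ≤ f' t) : MonotoneOn f s :=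
  monotoneOn_of_hasDerivWithinAt_nonneg hs
    (fun t ht => (hf t ht).continuousAt.continuousWithinAt)
    (fun t ht => (hf t (interior_subset ht)).hasDerivWithinAt)
    (fun t ht => hf' t (interior_subset ht))

lemma antitoneOn_of_hasDerivAt_nonpos {s : Set ℝ} (hs : Convex ℝ s) {f f' : ℝ → ℝ}
    (hf : ∀ t ∈ s, HasDerivAt f (f' t) t) (hf' : ∀ t ∈ s, f' t ≤ 0) : AntitoneOn f s :=
  antitoneOn_of_hasDerivWithinAt_nonpos hs
    (fun t ht => (hf t ht).continuousAt.continuousWithinAt)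
    (fun t ht => (hf t (interior_subset ht)).hasDerivWithinAt)
    (fun t ht => hf' t (interior_subset ht))

lemma monotone_of_hasDerivAt_nonneg' {f f' : ℝ → ℝ}
    (hf : ∀ t, HasDerivAt f (f' t) t) (hf' : ∀ t, 0 ≤ f' t) : Monotone f :=
  monotoneOn_univ.1 (monotoneOn_of_hasDerivAt_nonneg convex_univ (fun t _ => hf t)
    (fun t _ => hf' t))

lemma antitone_of_hasDerivAt_nonpos' {f f' : ℝ → ℝ}
    (hf : ∀ t, HasDerivAt f (f' t) t) (hf' : ∀ t, f' t ≤ 0) : Antitone f :=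
  antitoneOn_univ.1 (antitoneOn_of_hasDerivAt_nonpos convex_univ (fun t _ => hf t)
    (fun t _ => hf' t))

lemma hasDerivAt_exp_mul (r t : ℝ) : HasDerivAt (fun s => exp (r * s)) (r * exp (r * t)) t := by
  have h := ((hasDerivAt_id t).const_mul r).exp
  simpa [mul_comm] using h

lemma hasDerivAt_exp_mul_mul {f : ℝ → ℝ} {f' t : ℝ} (r : ℝ) (hf : HasDerivAt f f' t) :
    HasDerivAt (fun s => exp (r * s) * f s) (exp (r * t) * (f' + r * f t)) t := by
  have h := (hasDerivAt_exp_mul r t).mul hf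
  refine h.congr_deriv ?_
  ring

lemma hasDerivAt_shift {f : ℝ → ℝ} {f' t h : ℝ} (hf : HasDerivAt f f' (t - h)) :
    HasDerivAt (fun s => f (s - h)) f' t := hf.comp_sub_const t h

lemma tendsto_exp_mul_atBot {r : ℝ} (hr : 0 < r) :
    Tendsto (fun t => exp (r * t)) atBot (𝓝 0) :=
  tendsto_exp_atBot.comp (tendsto_id.const_mul_atBot hr)

lemma tendsto_exp_neg_mul_atTop {r : ℝ} (hr : 0 < r) :
    Tendsto (fun t => exp (-r * t)) atTop (𝓝 0) :=
  tendsto_exp_atBot.comp (tendsto_id.const_mul_atTop_of_neg (neg_neg_of_pos hr))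

/-! ### The difference operator `D ↦ D - b D(· - h)` -/

/-- Positivity of the inverse of `D ↦ D - b D(· - h)` on functions bounded from below. -/
lemma nonneg_of_shift_on {b h C : ℝ} (hb0 : 0 ≤ b) (hb1 : b < 1) {s : Set ℝ}
    (hs : ∀ t ∈ s, t - h ∈ s) {D : ℝ → ℝ} (hC : ∀ t ∈ s, -C ≤ D t)
    (hD : ∀ t ∈ s, b * D (t - h) ≤ D t) : ∀ t ∈ s, 0 ≤ D t := by
  have key : ∀ n : ℕ, ∀ t ∈ s, -(b ^ n * C) ≤ D t := by
    intro n
    induction n with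
    | zero => simpa using hC
    | succ n ih =>
      intro t ht
      have h1 := mul_le_mul_of_nonneg_left (ih _ (hs t ht)) hb0
      have h2 := hD t ht
      calc -(b ^ (n + 1) * C) = b * -(b ^ n * C) := by ring
        _ ≤ D t := h1.trans h2
  intro t ht
  have hlim : Tendsto (fun n : ℕ => -(b ^ n * C)) atTop (𝓝 0) := by
    simpa using ((tendsto_pow_atTop_nhds_zero_of_lt_one hb0 hb1).mul_const C).neg
  exact le_of_tendsto' hlim fun n => key n t ht

lemma nonneg_of_shift {b h C : ℝ} (hb0 : 0 ≤ b) (hb1 : b < 1) {D : ℝ → ℝ} (hC : ∀ t, -C ≤ D t)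
    (hD : ∀ t, b * D (t - h) ≤ D t) (t : ℝ) : 0 ≤ D t :=
  nonneg_of_shift_on hb0 hb1 (s := univ) (fun _ _ => trivial) (fun t _ => hC t)
    (fun t _ => hD t) t trivial

/-- Two bounded functions with the same image under `D ↦ D - b D(· - h)` coincide. -/
lemma eq_of_shift {b h C : ℝ} (hb0 : 0 ≤ b) (hb1 : b < 1) {x y : ℝ → ℝ} (hx : ∀ t, |x t| ≤ C)
    (hy : ∀ t, |y t| ≤ C) (hxy : ∀ t, x t - b * x (t - h) = y t - b * y (t - h)) : x = y := by
  funext t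
  have h1 := nonneg_of_shift hb0 hb1 (h := h) (C := 2 * C) (D := fun t => x t - y t)
    (fun t => by have := abs_le.1 (hx t); have := abs_le.1 (hy t); linarith)
    (fun t => by have := hxy t; linarith) t
  have h2 := nonneg_of_shift hb0 hb1 (h := h) (C := 2 * C) (D := fun t => y t - x t)
    (fun t => by have := abs_le.1 (hx t); have := abs_le.1 (hy t); linarith)
    (fun t => by have := hxy t; linarith) t
  linarith

/-- The Neumann series inverting `D ↦ D - b D(· - h)` on bounded functions. -/
def neumann (b h : ℝ) (v : ℝ → ℝ) (t : ℝ) : ℝ := ∑' k : ℕ, b ^ k * v (t - k * h)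

lemma norm_neumann_term {b h C : ℝ} (hb0 : 0 ≤ b) {v : ℝ → ℝ} (hv : ∀ t, |v t| ≤ C) (k : ℕ)
    (t : ℝ) : ‖b ^ k * v (t - k * h)‖ ≤ b ^ k * C := by
  rw [norm_mul, Real.norm_of_nonneg (pow_nonneg hb0 k)]
  exact mul_le_mul_of_nonneg_left (hv _) (pow_nonneg hb0 k)

lemma summable_neumann_bound {b : ℝ} (hb0 : 0 ≤ b) (hb1 : b < 1) (C : ℝ) :
    Summable (fun k : ℕ => b ^ k * C) :=
  (summable_geometric_of_lt_one hb0 hb1).mul_right C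

lemma summable_neumann {b h C : ℝ} (hb0 : 0 ≤ b) (hb1 : b < 1) {v : ℝ → ℝ} (hv : ∀ t, |v t| ≤ C)
    (t : ℝ) : Summable (fun k : ℕ => b ^ k * v (t - k * h)) :=
  (summable_neumann_bound hb0 hb1 C).of_norm_bounded (fun k => norm_neumann_term hb0 hv k t)

lemma neumann_eq {b h C : ℝ} (hb0 : 0 ≤ b) (hb1 : b < 1) {v : ℝ → ℝ} (hv : ∀ t, |v t| ≤ C)
    (t : ℝ) : neumann b h v t - b * neumann b h v (t - h) = v t := by
  have h1 := (summable_neumann (h := h) hb0 hb1 hv t).tsum_eq_zero_add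
  have h2 : ∑' k : ℕ, b ^ (k + 1) * v (t - ((k + 1 : ℕ) : ℝ) * h) = b * neumann b h v (t - h) := by
    rw [neumann, ← tsum_mul_left]
    congr 1
    funext k
    rw [show t - ((k + 1 : ℕ) : ℝ) * h = t - h - k * h by push_cast; ring]
    ring
  rw [h2] at h1
  rw [neumann, h1]
  simp

lemma abs_neumann_le {b h C : ℝ} (hb0 : 0 ≤ b) (hb1 : b < 1) {v : ℝ → ℝ} (hv : ∀ t, |v t| ≤ C)
    (t : ℝ) : |neumann b h v t| ≤ C / (1 - b) := by
  have hs : HasSum (fun k : ℕ => b ^ k * C) ((1 - b)⁻¹ * C) :=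
    (hasSum_geometric_of_lt_one hb0 hb1).mul_right C
  have := tsum_of_norm_bounded hs (fun k => norm_neumann_term (h := h) hb0 hv k t)
  rw [div_eq_inv_mul]
  exact this

lemma continuous_neumann {b h C : ℝ} (hb0 : 0 ≤ b) (hb1 : b < 1) {v : ℝ → ℝ}
    (hv : ∀ t, |v t| ≤ C) (hc : Continuous v) : Continuous (neumann b h v) :=
  continuous_tsum (fun k => by fun_prop) (summable_neumann_bound hb0 hb1 C)
    (fun k t => norm_neumann_term hb0 hv k t)

lemma hasDerivAt_neumann {b h C C' : ℝ} (hb0 : 0 ≤ b) (hb1 : b < 1) {v v' : ℝ → ℝ}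
    (hv : ∀ t, |v t| ≤ C) (hv' : ∀ t, |v' t| ≤ C') (hd : ∀ t, HasDerivAt v (v' t) t) (t : ℝ) :
    HasDerivAt (neumann b h v) (neumann b h v' t) t :=
  hasDerivAt_tsum (summable_neumann_bound hb0 hb1 C')
    (fun k y => (hasDerivAt_shift (hd (y - k * h))).const_mul (b ^ k))
    (fun k y => norm_neumann_term hb0 hv' k y) (summable_neumann hb0 hb1 hv 0) t

/-- The termwise differentiable series carries the regularity of v over to φ, for which no
smoothness is assumed. -/
lemma eq_neumann {b h C : ℝ} (hb0 : 0 ≤ b) (hb1 : b < 1) {x v : ℝ → ℝ} (hx : ∀ t, |x t| ≤ C)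
    (hv : ∀ t, x t - b * x (t - h) = v t) : x = neumann b h v := by
  have hvb : ∀ t, |v t| ≤ (1 + b) * C := by
    intro t
    rw [← hv t]
    have h1 := abs_le.1 (hx t)
    have h2 := abs_le.1 (hx (t - h))
    rw [abs_le]
    constructor <;> nlinarith
  refine eq_of_shift hb0 hb1 (h := h) (C := max C ((1 + b) * C / (1 - b)))
    (fun t => (hx t).trans (le_max_left _ _))
    (fun t => (abs_neumann_le hb0 hb1 hvb t).trans (le_max_right _ _)) (fun t => ?_)
  rw [hv, neumann_eq hb0 hb1 hvb]

/-! ### Exponential averages -/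

/-- The bounded solution `w` of `w' = ρ w - g`. -/
def fwd (ρ : ℝ) (g : ℝ → ℝ) (t : ℝ) : ℝ := ∫ σ in Ioi 0, exp (-ρ * σ) * g (t + σ)

/-- The bounded solution `x` of `x' = -θ x + w`. -/
def bwd (θ : ℝ) (w : ℝ → ℝ) (t : ℝ) : ℝ := ∫ σ in Ioi 0, exp (-θ * σ) * w (t - σ)

/-- Reflection in time: every property of the backward average is inherited from the forward one. -/
lemma bwd_eq_fwd (θ : ℝ) (w : ℝ → ℝ) (t : ℝ) : bwd θ w t = fwd θ (fun s => w (-s)) (-t) := by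
  simp only [bwd, fwd, neg_add, neg_neg, sub_eq_add_neg]

lemma integrableOn_exp_weight {ρ : ℝ} (hρ : 0 < ρ) (a : ℝ) :
    IntegrableOn (fun σ => exp (-ρ * σ)) (Ioi a) :=
  exp_neg_integrableOn_Ioi a hρ

lemma integral_exp_weight {ρ : ℝ} (hρ : 0 < ρ) : ∫ σ in Ioi (0 : ℝ), exp (-ρ * σ) = 1 / ρ := by
  rw [integral_exp_mul_Ioi (neg_neg_of_pos hρ)]
  simp [neg_div_neg_eq]

lemma integrableOn_fwd {ρ C : ℝ} (hρ : 0 < ρ) {g : ℝ → ℝ} (hg : Continuous g)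
    (hC : ∀ t, |g t| ≤ C) (a t : ℝ) :
    IntegrableOn (fun σ => exp (-ρ * σ) * g (t + σ)) (Ioi a) := by
  refine (integrableOn_exp_weight hρ a).mul_bdd (c := C) ?_ ?_
  · exact (by fun_prop : Continuous fun σ => g (t + σ)).aestronglyMeasurable
  · exact Eventually.of_forall fun σ => hC _

lemma fwd_mono {ρ C C' : ℝ} (hρ : 0 < ρ) {f g : ℝ → ℝ} (hf : Continuous f) (hg : Continuous g)
    (hfC : ∀ t, |f t| ≤ C) (hgC : ∀ t, |g t| ≤ C') {t : ℝ} (h : ∀ s, t ≤ s → f s ≤ g s) :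
    fwd ρ f t ≤ fwd ρ g t :=
  setIntegral_mono_on (integrableOn_fwd hρ hf hfC 0 t) (integrableOn_fwd hρ hg hgC 0 t)
    measurableSet_Ioi fun σ hσ =>
      mul_le_mul_of_nonneg_left (h _ (by have : (0:ℝ) < σ := hσ; linarith)) (exp_pos _).le

lemma fwd_const {ρ : ℝ} (hρ : 0 < ρ) (C t : ℝ) : fwd ρ (fun _ => C) t = C / ρ := by
  rw [fwd, integral_mul_const, integral_exp_weight hρ]
  ring

lemma fwd_nonneg {ρ : ℝ} {g : ℝ → ℝ} {t : ℝ} (h : ∀ s, t ≤ s → 0 ≤ g s) : 0 ≤ fwd ρ g t :=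
  setIntegral_nonneg measurableSet_Ioi fun σ hσ =>
    mul_nonneg (exp_pos _).le (h _ (by have : (0:ℝ) < σ := hσ; linarith))

lemma fwd_le {ρ C C' : ℝ} (hρ : 0 < ρ) {g : ℝ → ℝ} (hg : Continuous g)
    (hgC : ∀ t, |g t| ≤ C) {t : ℝ} (h : ∀ s, t ≤ s → g s ≤ C') : fwd ρ g t ≤ C' / ρ := by
  rw [← fwd_const hρ C' t]
  exact fwd_mono hρ hg continuous_const hgC (fun _ => le_refl |C'|) h

lemma abs_fwd_le {ρ C : ℝ} (hρ : 0 < ρ) {g : ℝ → ℝ} (hg : Continuous g)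
    (hgC : ∀ t, |g t| ≤ C) (t : ℝ) : |fwd ρ g t| ≤ C / ρ := by
  refine abs_le.2 ⟨?_, fwd_le hρ hg hgC fun s _ => (abs_le.1 (hgC s)).2⟩
  rw [← neg_div, ← fwd_const hρ (-C) t]
  exact fwd_mono hρ continuous_const hg (fun _ => le_refl |-C|) hgC
    (fun s _ => (abs_le.1 (hgC s)).1)

lemma fwd_sub {ρ C C' : ℝ} (hρ : 0 < ρ) {f g : ℝ → ℝ} (hf : Continuous f) (hg : Continuous g)
    (hfC : ∀ t, |f t| ≤ C) (hgC : ∀ t, |g t| ≤ C') (t : ℝ) :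
    fwd ρ (fun s => f s - g s) t = fwd ρ f t - fwd ρ g t := by
  rw [fwd, fwd, fwd, ← integral_sub (integrableOn_fwd hρ hf hfC 0 t)
    (integrableOn_fwd hρ hg hgC 0 t)]
  congr 1
  funext σ
  ring

lemma fwd_comp_add (ρ : ℝ) (g : ℝ → ℝ) (s t : ℝ) :
    fwd ρ (fun r => g (r + s)) t = fwd ρ g (t + s) := by
  simp only [fwd]
  congr 1
  funext σ
  rw [add_right_comm]

/-- With t moved from the integrand to an endpoint, the fundamental theorem of calculus applies even
though g is merely continuous. -/
lemma fwd_eq {ρ C : ℝ} (hρ : 0 < ρ) {g : ℝ → ℝ} (hg : Continuous g) (hgC : ∀ t, |g t| ≤ C)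
    (t : ℝ) : fwd ρ g t = exp (ρ * t) * (fwd ρ g 0 - ∫ s in (0:ℝ)..t, exp (-ρ * s) * g s) := by
  have hint : ∀ a, IntegrableOn (fun s => exp (-ρ * s) * g s) (Ioi a) := fun a => by
    simpa using integrableOn_fwd hρ hg hgC a 0
  have h1 : fwd ρ g t = exp (ρ * t) * ∫ s in Ioi t, exp (-ρ * s) * g s := by
    have := (measurePreserving_add_left volume t).setIntegral_preimage_emb
      (measurableEmbedding_addLeft t) (fun s => exp (-ρ * s) * g s) (Ioi t)
    rw [← this, ← integral_const_mul, fwd, show (fun x => t + x) ⁻¹' Ioi t = Ioi 0 by simp]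
    congr 1
    funext σ
    rw [← mul_assoc, ← exp_add]
    congr 2
    ring
  have h2 : fwd ρ g 0 = ∫ s in Ioi 0, exp (-ρ * s) * g s := by simp [fwd]
  rw [h1, h2, ← intervalIntegral.integral_Ioi_sub_Ioi' (hint 0) (hint t)]
  ring

lemma hasDerivAt_fwd {ρ C : ℝ} (hρ : 0 < ρ) {g : ℝ → ℝ} (hg : Continuous g)
    (hgC : ∀ t, |g t| ≤ C) (t : ℝ) : HasDerivAt (fwd ρ g) (ρ * fwd ρ g t - g t) t := by
  have hc : Continuous fun s => exp (-ρ * s) * g s := by fun_prop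
  have h1 := hasDerivAt_exp_mul_mul ρ
    ((hc.integral_hasStrictDerivAt 0 t).hasDerivAt.const_sub (fwd ρ g 0))
  have h2 : fwd ρ g
      = fun t => exp (ρ * t) * (fwd ρ g 0 - ∫ s in (0:ℝ)..t, exp (-ρ * s) * g s) :=
    funext fun t => fwd_eq hρ hg hgC t
  rw [← h2] at h1
  convert h1 using 1
  rw [fwd_eq hρ hg hgC t]
  have : exp (ρ * t) * exp (-ρ * t) = 1 := by rw [← exp_add]; simp
  linear_combination g t * this

lemma continuous_fwd {ρ C : ℝ} (hρ : 0 < ρ) {g : ℝ → ℝ} (hg : Continuous g)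
    (hgC : ∀ t, |g t| ≤ C) : Continuous (fwd ρ g) :=
  continuous_iff_continuousAt.2 fun t => (hasDerivAt_fwd hρ hg hgC t).continuousAt

/-- Function and base point both vary with the index, so that one statement serves pointwise limits
of sequences as well as limits of a single function at ±∞. -/
lemma tendsto_fwd {ι : Type*} {l : Filter ι} [l.IsCountablyGenerated] {ρ C : ℝ} (hρ : 0 < ρ)
    {G : ι → ℝ → ℝ} {T : ι → ℝ} {g : ℝ → ℝ} {r : ℝ} (hG : ∀ i, Continuous (G i))
    (hC : ∀ i t, |G i t| ≤ C) (h : ∀ σ, Tendsto (fun i => G i (T i + σ)) l (𝓝 (g (r + σ)))) :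
    Tendsto (fun i => fwd ρ (G i) (T i)) l (𝓝 (fwd ρ g r)) := by
  refine tendsto_integral_filter_of_dominated_convergence (fun σ => exp (-ρ * σ) * C) ?_ ?_ ?_ ?_
  · exact Eventually.of_forall fun i =>
      (integrableOn_fwd hρ (hG i) (hC i) 0 (T i)).aestronglyMeasurable
  · refine Eventually.of_forall fun i => Eventually.of_forall fun σ => ?_
    rw [norm_mul, Real.norm_of_nonneg (exp_pos _).le]
    exact mul_le_mul_of_nonneg_left (hC _ _) (exp_pos _).le
  · exact (integrableOn_exp_weight hρ 0).mul_const C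
  · exact Eventually.of_forall fun σ => (h σ).const_mul _

lemma bwd_nonneg {θ : ℝ} {w : ℝ → ℝ} (h : ∀ s, 0 ≤ w s) (t : ℝ) : 0 ≤ bwd θ w t := by
  rw [bwd_eq_fwd]
  exact fwd_nonneg fun s _ => h _

lemma abs_bwd_le {θ C : ℝ} (hθ : 0 < θ) {w : ℝ → ℝ} (hw : Continuous w)
    (hC : ∀ t, |w t| ≤ C) (t : ℝ) : |bwd θ w t| ≤ C / θ := by
  rw [bwd_eq_fwd]
  exact abs_fwd_le hθ (by fun_prop) (fun s => hC _) _

lemma bwd_sub {θ C C' : ℝ} (hθ : 0 < θ) {f g : ℝ → ℝ} (hf : Continuous f) (hg : Continuous g)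
    (hfC : ∀ t, |f t| ≤ C) (hgC : ∀ t, |g t| ≤ C') (t : ℝ) :
    bwd θ (fun s => f s - g s) t = bwd θ f t - bwd θ g t := by
  simp only [bwd_eq_fwd]
  exact fwd_sub hθ (by fun_prop) (by fun_prop) (fun _ => hfC _) (fun _ => hgC _) _

lemma bwd_comp_add (θ : ℝ) (w : ℝ → ℝ) (s t : ℝ) :
    bwd θ (fun r => w (r + s)) t = bwd θ w (t + s) := by
  simp only [bwd]
  congr 1
  funext σ
  rw [show t - σ + s = t + s - σ by ring]

lemma hasDerivAt_bwd {θ C : ℝ} (hθ : 0 < θ) {w : ℝ → ℝ} (hw : Continuous w)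
    (hC : ∀ t, |w t| ≤ C) (t : ℝ) : HasDerivAt (bwd θ w) (w t - θ * bwd θ w t) t := by
  have h1 := hasDerivAt_fwd hθ (g := fun s => w (-s)) (by fun_prop) (fun s => hC _) (-t)
  have h2 : HasDerivAt (fun s => fwd θ (fun s => w (-s)) (-s)) _ t := h1.comp t (hasDerivAt_neg t)
  rw [← funext (bwd_eq_fwd θ w)] at h2
  convert h2 using 1
  rw [bwd_eq_fwd]
  simp

lemma continuous_bwd {θ C : ℝ} (hθ : 0 < θ) {w : ℝ → ℝ} (hw : Continuous w)
    (hC : ∀ t, |w t| ≤ C) : Continuous (bwd θ w) :=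
  continuous_iff_continuousAt.2 fun t => (hasDerivAt_bwd hθ hw hC t).continuousAt

lemma tendsto_bwd {ι : Type*} {l : Filter ι} [l.IsCountablyGenerated] {θ C : ℝ} (hθ : 0 < θ)
    {W : ι → ℝ → ℝ} {T : ι → ℝ} {w : ℝ → ℝ} {r : ℝ} (hW : ∀ i, Continuous (W i))
    (hC : ∀ i t, |W i t| ≤ C) (h : ∀ σ, Tendsto (fun i => W i (T i - σ)) l (𝓝 (w (r - σ)))) :
    Tendsto (fun i => bwd θ (W i) (T i)) l (𝓝 (bwd θ w r)) := by
  simp only [bwd_eq_fwd]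
  refine tendsto_fwd (G := fun i s => W i (-s)) (T := fun i => -T i) hθ
    (fun i => by have := hW i; fun_prop) (fun i t => hC i _) (fun σ => ?_)
  simpa [sub_eq_add_neg, add_comm] using h σ

/-! ### The monotone iteration scheme -/

/-- The cone of nonnegative functions `x` such that `t ↦ e^{θ t} x t` is nondecreasing. -/
structure InCone (θ : ℝ) (x : ℝ → ℝ) : Prop where
  nonneg : ∀ t, 0 ≤ x t
  growth : ∀ t s, 0 ≤ s → x t ≤ exp (θ * s) * x (t + s)

lemma InCone.add {θ : ℝ} {x y : ℝ → ℝ} (hx : InCone θ x) (hy : InCone θ y) :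
    InCone θ (fun t => x t + y t) :=
  ⟨fun t => add_nonneg (hx.nonneg t) (hy.nonneg t), fun t s hs => by
    have := hx.growth t s hs
    have := hy.growth t s hs
    rw [mul_add]
    linarith⟩

lemma InCone.of_monotone {θ : ℝ} {x : ℝ → ℝ} (h0 : ∀ t, 0 ≤ x t)
    (hx : Monotone fun t => exp (θ * t) * x t) : InCone θ x := by
  refine ⟨h0, fun t s hs => ?_⟩
  have h : exp (θ * t) * x t ≤ exp (θ * (t + s)) * x (t + s) := hx (by linarith)
  rw [mul_add, exp_add, mul_assoc] at h
  exact le_of_mul_le_mul_left h (exp_pos _)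

/-- A bounded function `x` with `e^{θ t} x t` nondecreasing lies in the cone. -/
lemma InCone.of_monotone_of_bdd {θ C : ℝ} (hθ : 0 < θ) {x : ℝ → ℝ} (hC : ∀ t, -C ≤ x t)
    (hx : Monotone fun t => exp (θ * t) * x t) : InCone θ x := by
  refine InCone.of_monotone (fun t => ?_) hx
  have h1 : ∀ s, s ≤ t → exp (θ * s) * -C ≤ exp (θ * t) * x t := fun s hs =>
    (mul_le_mul_of_nonneg_left (hC s) (exp_pos _).le).trans (hx hs)
  have h2 : Tendsto (fun s => exp (θ * s) * -C) atBot (𝓝 0) := by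
    simpa using (tendsto_exp_mul_atBot hθ).mul_const (-C)
  have h3 : 0 ≤ exp (θ * t) * x t :=
    le_of_tendsto h2 ((eventually_le_atBot t).mono h1)
  exact nonneg_of_mul_nonneg_right h3 (exp_pos _)

/-- The shift resolvent preserves the cone. -/
lemma InCone.of_shift {b h θ C : ℝ} (hb0 : 0 ≤ b) (hb1 : b < 1) {x : ℝ → ℝ}
    (hx : ∀ t, |x t| ≤ C) (hv : InCone θ fun t => x t - b * x (t - h)) : InCone θ x := by
  refine ⟨nonneg_of_shift hb0 hb1 (h := h) (fun t => (abs_le.1 (hx t)).1)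
    fun t => by have := hv.nonneg t; linarith, fun t s hs => ?_⟩
  -- For fixed s the growth condition is itself a sign condition, on t ↦ e^{θs} x(t + s) - x(t), and
  -- this function commutes with the shift by h.
  have := nonneg_of_shift hb0 hb1 (h := h) (C := (exp (θ * s) + 1) * C)
    (D := fun t => exp (θ * s) * x (t + s) - x t) (fun t => ?_) (fun t => ?_) t
  · linarith
  · have h1 := abs_le.1 (hx t)
    have h2 := mul_le_mul_of_nonneg_left (abs_le.1 (hx (t + s))).1 (exp_pos (θ * s)).le
    linarith
  · have := hv.growth t s hs
    rw [show t - h + s = t + s - h by ring]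
    linarith

/-- The standing assumptions on the parameters of the iteration scheme. -/
structure StepParams (b c h θ κ : ℝ) : Prop where
  b_nonneg : 0 ≤ b
  b_lt_one : b < 1
  c_pos : 0 < c
  h_nonneg : 0 ≤ h
  θ_pos : 0 < θ
  κ_pos : 0 < κ
  κ_le_one : κ ≤ 1
  shift_pos : 0 < 1 - b * exp (θ * h)
  -- For κ = 1, equality here is the equation χ₁(-θ) = 0.
  key : κ * exp (θ * h) ≤ θ * (c + θ) * (1 - b * exp (θ * h))

lemma StepParams.ρ_pos {b c h θ κ : ℝ} (H : StepParams b c h θ κ) : 0 < c + θ :=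
  add_pos H.c_pos H.θ_pos

/-- Continuous functions with values in the unit interval. -/
structure UnitFun (φ : ℝ → ℝ) : Prop where
  cont : Continuous φ
  nonneg : ∀ t, 0 ≤ φ t
  le_one : ∀ t, φ t ≤ 1

lemma UnitFun.abs_le {φ : ℝ → ℝ} (hφ : UnitFun φ) (t : ℝ) : |φ t| ≤ 1 := by
  rw [abs_of_nonneg (hφ.nonneg t)]
  exact hφ.le_one t

/-- The right-hand side of the equation shifted by the linear term `θ (c + θ) v`. -/
def source (b c h θ κ : ℝ) (φ : ℝ → ℝ) (t : ℝ) : ℝ :=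
  θ * (c + θ) * (φ t - b * φ (t - h)) + κ * (φ t * (1 - φ (t - h)))

/-- The solution `v` of `v'' - c v' - θ (c + θ) v + source φ = 0`. -/
def green (b c h θ κ : ℝ) (φ : ℝ → ℝ) : ℝ → ℝ :=
  bwd θ (fwd (c + θ) (source b c h θ κ φ))

/-- One step of the iteration. -/
def step (b c h θ κ : ℝ) (φ : ℝ → ℝ) : ℝ → ℝ := neumann b h (green b c h θ κ φ)

/-- A uniform bound for `source`. -/
def sourceBound (c θ : ℝ) : ℝ := θ * (c + θ) + 1

section
variable {b c h θ κ : ℝ}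

lemma continuous_source {φ : ℝ → ℝ} (hφ : UnitFun φ) : Continuous (source b c h θ κ φ) := by
  have := hφ.cont
  unfold source
  fun_prop

lemma abs_source_le (H : StepParams b c h θ κ) {φ : ℝ → ℝ} (hφ : UnitFun φ) (t : ℝ) :
    |source b c h θ κ φ t| ≤ sourceBound c θ := by
  have hQ : 0 < θ * (c + θ) := mul_pos H.θ_pos H.ρ_pos
  have hb0 := H.b_nonneg
  have hb1 := H.b_lt_one
  have h0 := hφ.nonneg t
  have h1 := hφ.le_one t
  have h0' := hφ.nonneg (t - h)
  have h1' := hφ.le_one (t - h)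
  have h2 : 0 ≤ φ t * (1 - φ (t - h)) := mul_nonneg h0 (by linarith)
  have h3 : φ t * (1 - φ (t - h)) ≤ 1 := mul_le_one₀ h1 (by linarith) (by linarith)
  have h4 : κ * (φ t * (1 - φ (t - h))) ≤ 1 := mul_le_one₀ H.κ_le_one h2 h3
  have h5 : 0 ≤ κ * (φ t * (1 - φ (t - h))) := mul_nonneg H.κ_pos.le h2
  have h6 : |φ t - b * φ (t - h)| ≤ 1 := by
    rw [_root_.abs_le]
    constructor <;> nlinarith
  have h7 := _root_.abs_le.1 h6
  unfold source sourceBound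
  rw [_root_.abs_le]
  constructor <;> nlinarith

lemma continuous_fwd_source (H : StepParams b c h θ κ) {φ : ℝ → ℝ} (hφ : UnitFun φ) :
    Continuous (fwd (c + θ) (source b c h θ κ φ)) :=
  continuous_fwd H.ρ_pos (continuous_source hφ) (abs_source_le H hφ)

lemma abs_fwd_source_le (H : StepParams b c h θ κ) {φ : ℝ → ℝ} (hφ : UnitFun φ) (t : ℝ) :
    |fwd (c + θ) (source b c h θ κ φ) t| ≤ sourceBound c θ / (c + θ) :=
  abs_fwd_le H.ρ_pos (continuous_source hφ) (abs_source_le H hφ) t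

lemma abs_green_le (H : StepParams b c h θ κ) {φ : ℝ → ℝ} (hφ : UnitFun φ) (t : ℝ) :
    |green b c h θ κ φ t| ≤ sourceBound c θ / (c + θ) / θ :=
  abs_bwd_le H.θ_pos (continuous_fwd_source H hφ) (abs_fwd_source_le H hφ) t

lemma hasDerivAt_green (H : StepParams b c h θ κ) {φ : ℝ → ℝ} (hφ : UnitFun φ) (t : ℝ) :
    HasDerivAt (green b c h θ κ φ)
      (fwd (c + θ) (source b c h θ κ φ) t - θ * green b c h θ κ φ t) t :=
  hasDerivAt_bwd H.θ_pos (continuous_fwd_source H hφ) (abs_fwd_source_le H hφ) t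

lemma continuous_green (H : StepParams b c h θ κ) {φ : ℝ → ℝ} (hφ : UnitFun φ) :
    Continuous (green b c h θ κ φ) :=
  continuous_bwd H.θ_pos (continuous_fwd_source H hφ) (abs_fwd_source_le H hφ)

lemma hasDerivAt_fwd_source (H : StepParams b c h θ κ) {φ : ℝ → ℝ} (hφ : UnitFun φ) (t : ℝ) :
    HasDerivAt (fwd (c + θ) (source b c h θ κ φ))
      ((c + θ) * fwd (c + θ) (source b c h θ κ φ) t - source b c h θ κ φ t) t :=
  hasDerivAt_fwd H.ρ_pos (continuous_source hφ) (abs_source_le H hφ) t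

lemma step_sub_shift (H : StepParams b c h θ κ) {φ : ℝ → ℝ} (hφ : UnitFun φ) (t : ℝ) :
    step b c h θ κ φ t - b * step b c h θ κ φ (t - h) = green b c h θ κ φ t :=
  neumann_eq H.b_nonneg H.b_lt_one (abs_green_le H hφ) t

lemma abs_step_le (H : StepParams b c h θ κ) {φ : ℝ → ℝ} (hφ : UnitFun φ) (t : ℝ) :
    |step b c h θ κ φ t| ≤ sourceBound c θ / (c + θ) / θ / (1 - b) :=
  abs_neumann_le H.b_nonneg H.b_lt_one (abs_green_le H hφ) t

lemma continuous_step (H : StepParams b c h θ κ) {φ : ℝ → ℝ} (hφ : UnitFun φ) :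
    Continuous (step b c h θ κ φ) :=
  continuous_neumann H.b_nonneg H.b_lt_one (abs_green_le H hφ) (continuous_green H hφ)

lemma source_comp_add (φ : ℝ → ℝ) (s : ℝ) :
    source b c h θ κ (fun t => φ (t + s)) = fun t => source b c h θ κ φ (t + s) := by
  funext t
  simp only [source]
  rw [show t - h + s = t + s - h by ring]

lemma green_comp_add (φ : ℝ → ℝ) (s : ℝ) :
    green b c h θ κ (fun t => φ (t + s)) = fun t => green b c h θ κ φ (t + s) := by
  funext t
  simp only [green, source_comp_add]
  rw [← bwd_comp_add]
  congr 1
  funext r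
  exact fwd_comp_add _ _ _ _

lemma step_comp_add (φ : ℝ → ℝ) (s : ℝ) :
    step b c h θ κ (fun t => φ (t + s)) = fun t => step b c h θ κ φ (t + s) := by
  funext t
  simp only [step, green_comp_add, neumann]
  congr 1
  funext k
  rw [show t - k * h + s = t + s - k * h by ring]

lemma UnitFun.comp_add {φ : ℝ → ℝ} (hφ : UnitFun φ) (s : ℝ) : UnitFun fun t => φ (t + s) :=
  ⟨by have := hφ.cont; fun_prop, fun t => hφ.nonneg _, fun t => hφ.le_one _⟩

/-- The delayed differences have coefficients -Qb and -κφ(t), where Q = θ(c + θ). Membership in the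
cone bounds them by e^{θh} times the current difference, and `key` states that Q dominates the
resulting loss. -/
lemma source_sub_nonneg (H : StepParams b c h θ κ) {φ ψ : ℝ → ℝ} (hφ : UnitFun φ)
    (hψ : UnitFun ψ) (hc : InCone θ fun t => φ t - ψ t) (t : ℝ) :
    0 ≤ source b c h θ κ φ t - source b c h θ κ ψ t := by
  have hQ : 0 < θ * (c + θ) := mul_pos H.θ_pos H.ρ_pos
  set Q := θ * (c + θ) with hQdef
  have h1 := hc.nonneg t
  have h2 := hc.nonneg (t - h)
  have h3 := hc.growth (t - h) h H.h_nonneg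
  simp only [sub_add_cancel] at h3
  set x := φ t - ψ t with hx
  set y := φ (t - h) - ψ (t - h) with hy
  have h4 : source b c h θ κ φ t - source b c h θ κ ψ t
      = Q * (x - b * y) + κ * (x * (1 - ψ (t - h)) - φ t * y) := by
    simp only [source, hx, hy]
    ring
  have h5 : 0 ≤ κ * (x * (1 - ψ (t - h))) :=
    mul_nonneg H.κ_pos.le (mul_nonneg h1 (by linarith [hψ.le_one (t - h)]))
  have h6 : κ * (φ t * y) ≤ κ * y :=
    mul_le_mul_of_nonneg_left (mul_le_of_le_one_left h2 (hφ.le_one t)) H.κ_pos.le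
  have h7 : (Q * b + κ) * y ≤ (Q * b + κ) * (exp (θ * h) * x) :=
    mul_le_mul_of_nonneg_left h3 (by have := mul_nonneg hQ.le H.b_nonneg; linarith [H.κ_pos])
  have h8 : κ * exp (θ * h) * x ≤ Q * (1 - b * exp (θ * h)) * x :=
    mul_le_mul_of_nonneg_right H.key h1
  rw [h4]
  nlinarith

/-- The Green operator of a nonnegative source is in the cone. -/
lemma inCone_bwd {C : ℝ} (hθ : 0 < θ) {w : ℝ → ℝ} (hw : Continuous w) (hC : ∀ t, |w t| ≤ C)
    (h0 : ∀ t, 0 ≤ w t) : InCone θ (bwd θ w) := by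
  refine InCone.of_monotone (bwd_nonneg h0) (monotone_of_hasDerivAt_nonneg'
    (fun t => hasDerivAt_exp_mul_mul θ (hasDerivAt_bwd hθ hw hC t)) fun t => ?_)
  exact mul_nonneg (exp_pos _).le (by linarith [h0 t])

/-- The iteration step is monotone with respect to the cone. -/
lemma step_mono (H : StepParams b c h θ κ) {φ ψ : ℝ → ℝ} (hφ : UnitFun φ)
    (hψ : UnitFun ψ) (hc : InCone θ fun t => φ t - ψ t) :
    InCone θ fun t => step b c h θ κ φ t - step b c h θ κ ψ t := by
  set w := fun t => fwd (c + θ) (source b c h θ κ φ) t - fwd (c + θ) (source b c h θ κ ψ) t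
    with hw
  have hw0 : ∀ t, 0 ≤ w t := fun t => by
    have := fwd_mono H.ρ_pos (continuous_source hψ) (continuous_source hφ) (abs_source_le H hψ)
      (abs_source_le H hφ) (t := t)
      (fun s _ => by have := source_sub_nonneg H hφ hψ hc s; linarith)
    simp only [hw]
    linarith
  have hwc : Continuous w := (continuous_fwd_source H hφ).sub (continuous_fwd_source H hψ)
  have hwC : ∀ t, |w t| ≤ sourceBound c θ / (c + θ) + sourceBound c θ / (c + θ) := fun t =>
    (abs_sub _ _).trans (add_le_add (abs_fwd_source_le H hφ t) (abs_fwd_source_le H hψ t))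
  have hcone := inCone_bwd H.θ_pos hwc hwC hw0
  refine InCone.of_shift H.b_nonneg H.b_lt_one (h := h) (fun t => (abs_sub _ _).trans
    (add_le_add (abs_step_le H hφ t) (abs_step_le H hψ t))) ?_
  convert hcone using 1
  funext t
  rw [hw, bwd_sub H.θ_pos (continuous_fwd_source H hφ) (continuous_fwd_source H hψ)
    (abs_fwd_source_le H hφ) (abs_fwd_source_le H hψ)]
  have e1 := step_sub_shift H hφ t
  have e2 := step_sub_shift H hψ t
  simp only [green] at e1 e2
  linarith

lemma fwd_source_lt {φ : ℝ → ℝ} (H : StepParams b c h θ κ) (hφ : UnitFun φ) (t : ℝ) :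
    |fwd (c + θ) (source b c h θ κ φ) t - θ * green b c h θ κ φ t|
      ≤ 2 * (sourceBound c θ / (c + θ)) := by
  have h1 := abs_fwd_source_le H hφ t
  have h2 := abs_green_le H hφ t
  rw [le_div_iff₀ H.θ_pos] at h2
  calc _ ≤ |fwd (c + θ) (source b c h θ κ φ) t| + |θ * green b c h θ κ φ t| := abs_sub _ _
    _ ≤ _ := by rw [abs_mul, abs_of_pos H.θ_pos]; linarith

/-- The Lipschitz constant of all functions in the range of `step`. -/
def stepLip (b c θ : ℝ) : ℝ := 2 * (sourceBound c θ / (c + θ)) / (1 - b)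

/-- If `x - b x(· - h) = green φ` then `x` is Lipschitz with a universal constant. -/
lemma lipschitz_of_shift {φ x : ℝ → ℝ} {C : ℝ} (H : StepParams b c h θ κ) (hφ : UnitFun φ)
    (hx : ∀ t, |x t| ≤ C) (hs : ∀ t, x t - b * x (t - h) = green b c h θ κ φ t) (t s : ℝ) :
    |x t - x s| ≤ stepLip b c θ * |t - s| := by
  set L := 2 * (sourceBound c θ / (c + θ)) with hL
  have hv : ∀ t s, |green b c h θ κ φ t - green b c h θ κ φ s| ≤ L * |t - s| := fun t s => by
    have := convex_univ.norm_image_sub_le_of_norm_hasDerivWithin_le (f := green b c h θ κ φ)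
      (C := L) (fun r _ => (hasDerivAt_green H hφ r).hasDerivWithinAt)
      (fun r _ => fwd_source_lt H hφ r) (mem_univ s) (mem_univ t)
    simpa using this
  have hb : 0 < 1 - b := by linarith [H.b_lt_one]
  have hL' : stepLip b c θ * (1 - b) = L := by
    rw [stepLip, div_mul_cancel₀ _ hb.ne']
  -- Positivity of the shift resolvent, applied to a constant minus an increment: inverting the
  -- shift costs the factor 1/(1 - b) contained in `stepLip`.
  have main : ∀ d r, 0 ≤ stepLip b c θ * |d| - (x (r + d) - x r) := by
    intro d
    refine nonneg_of_shift H.b_nonneg H.b_lt_one (h := h) (C := -(stepLip b c θ * |d|) + 2 * C)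
      (fun r => ?_) (fun r => ?_)
    · have := abs_le.1 (hx (r + d))
      have := abs_le.1 (hx r)
      linarith
    · have e1 := hs (r + d)
      have e2 := hs r
      have e3 := (abs_le.1 (hv (r + d) r)).2
      rw [show r + d - r = d by ring, ← hL'] at e3
      rw [show r - h + d = r + d - h by ring]
      nlinarith
  have h1 := main (t - s) s
  have h2 := main (s - t) t
  rw [abs_sub_comm s t] at h2
  rw [abs_le]
  simp only [add_sub_cancel] at h1 h2
  constructor <;> linarith

end

/-! ### Upper and lower solutions -/

lemma nonneg_of_monotoneOn_exp_mul {θ C T : ℝ} (hθ : 0 < θ) {x : ℝ → ℝ}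
    (hC : ∀ t ≤ T, -C ≤ x t) (hx : MonotoneOn (fun t => exp (θ * t) * x t) (Iic T)) :
    ∀ t ≤ T, 0 ≤ x t := by
  intro t ht
  have h1 : ∀ s, s ≤ t → exp (θ * s) * -C ≤ exp (θ * t) * x t := fun s hs =>
    (mul_le_mul_of_nonneg_left (hC s (hs.trans ht)) (exp_pos _).le).trans
      (hx (hs.trans ht) ht hs)
  have h2 : Tendsto (fun s => exp (θ * s) * -C) atBot (𝓝 0) := by
    simpa using (tendsto_exp_mul_atBot hθ).mul_const (-C)
  have h3 : 0 ≤ exp (θ * t) * x t :=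
    le_of_tendsto h2 ((eventually_le_atBot t).mono h1)
  exact nonneg_of_mul_nonneg_right h3 (exp_pos _)

/-- The generator of the upper solution. -/
def upperSource (b θ r : ℝ) (t : ℝ) : ℝ := (1 - b) * θ * min (exp (r * t)) 1

/-- The neutral part of the upper solution. -/
def upperV (b θ r : ℝ) : ℝ → ℝ := bwd θ (upperSource b θ r)

/-- The upper solution. -/
def upperSol (b h θ r : ℝ) : ℝ → ℝ := neumann b h (upperV b θ r)

/-- The generator of the lower solution. -/
def lowerSource (b θ r m E : ℝ) (t : ℝ) : ℝ :=
  (1 - b) * θ * max (exp (r * t) - E * exp (m * t)) 0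

/-- The neutral part of the lower solution. -/
def lowerV (b θ r m E : ℝ) : ℝ → ℝ := bwd θ (lowerSource b θ r m E)

/-- The lower solution. -/
def lowerSol (b h θ r m E : ℝ) : ℝ → ℝ := neumann b h (lowerV b θ r m E)

/-! ### The upper solution -/

section
variable {b c h θ κ : ℝ}

/-- Applying D + θ reduces the cone order to the pointwise order of the generators. For this reason
the upper and lower solutions are defined through generators: comparing them with their iterates
becomes a first-order problem. -/
lemma inCone_neumann_sub {f g : ℝ → ℝ} {C : ℝ} (H : StepParams b c h θ κ) (hf : Continuous f)
    (hg : Continuous g) (hfC : ∀ t, |f t| ≤ C) (hgC : ∀ t, |g t| ≤ C) (hfg : ∀ t, g t ≤ f t) :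
    InCone θ fun t => neumann b h (bwd θ f) t - neumann b h (bwd θ g) t := by
  have hbf := abs_bwd_le H.θ_pos hf hfC
  have hbg := abs_bwd_le H.θ_pos hg hgC
  refine InCone.of_shift H.b_nonneg H.b_lt_one (h := h) (fun t => (abs_sub _ _).trans
    (add_le_add (abs_neumann_le H.b_nonneg H.b_lt_one hbf t)
      (abs_neumann_le H.b_nonneg H.b_lt_one hbg t))) ?_
  have hcone := inCone_bwd (w := fun t => f t - g t) H.θ_pos (hf.sub hg)
    (fun t => (abs_sub (f t) (g t)).trans (add_le_add (hfC t) (hgC t)))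
    (fun t => sub_nonneg.2 (hfg t))
  convert hcone using 1
  funext t
  have e1 := neumann_eq (h := h) H.b_nonneg H.b_lt_one hbf t
  have e2 := neumann_eq (h := h) H.b_nonneg H.b_lt_one hbg t
  rw [bwd_sub H.θ_pos hf hg hfC hgC]
  linarith

lemma continuous_upperSource (b θ r : ℝ) : Continuous (upperSource b θ r) := by
  unfold upperSource
  fun_prop

lemma continuous_lowerSource (b θ r m E : ℝ) : Continuous (lowerSource b θ r m E) := by
  unfold lowerSource
  fun_prop

lemma upperSource_nonneg (H : StepParams b c h θ κ) (r t : ℝ) : 0 ≤ upperSource b θ r t := by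
  have : 0 ≤ 1 - b := by linarith [H.b_lt_one]
  have := H.θ_pos
  unfold upperSource
  positivity

lemma upperSource_le (H : StepParams b c h θ κ) (r t : ℝ) :
    upperSource b θ r t ≤ (1 - b) * θ :=
  mul_le_of_le_one_right (mul_nonneg (by linarith [H.b_lt_one]) H.θ_pos.le) (min_le_right _ _)

lemma upperSource_le_exp (H : StepParams b c h θ κ) (r t : ℝ) :
    upperSource b θ r t ≤ (1 - b) * θ * exp (r * t) :=
  mul_le_mul_of_nonneg_left (min_le_left _ _)
    (mul_nonneg (by linarith [H.b_lt_one]) H.θ_pos.le)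

lemma abs_upperSource_le (H : StepParams b c h θ κ) (r t : ℝ) :
    |upperSource b θ r t| ≤ (1 - b) * θ := by
  rw [abs_of_nonneg (upperSource_nonneg H r t)]
  exact upperSource_le H r t

lemma lowerSource_nonneg (H : StepParams b c h θ κ) (r m E t : ℝ) :
    0 ≤ lowerSource b θ r m E t := by
  have : 0 ≤ 1 - b := by linarith [H.b_lt_one]
  have := H.θ_pos
  unfold lowerSource
  positivity

lemma lowerSource_le_upperSource (H : StepParams b c h θ κ) {r m E : ℝ} (hr : 0 < r)
    (hm : r ≤ m) (hE : 1 ≤ E) (t : ℝ) : lowerSource b θ r m E t ≤ upperSource b θ r t := by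
  refine mul_le_mul_of_nonneg_left ?_ (mul_nonneg (by linarith [H.b_lt_one]) H.θ_pos.le)
  have h1 : 0 < E * exp (m * t) := by positivity
  refine max_le (le_min (by linarith) ?_) (le_min (exp_pos _).le zero_le_one)
  rcases le_total t 0 with ht | ht
  · have : exp (r * t) ≤ 1 := exp_le_one_iff.2 (mul_nonpos_of_nonneg_of_nonpos hr.le ht)
    linarith
  · have h2 : exp (r * t) ≤ exp (m * t) := exp_le_exp.2 (mul_le_mul_of_nonneg_right hm ht)
    have h3 : exp (m * t) ≤ E * exp (m * t) := le_mul_of_one_le_left (exp_pos _).le hE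
    linarith

lemma abs_lowerSource_le (H : StepParams b c h θ κ) {r m E : ℝ} (hr : 0 < r)
    (hm : r ≤ m) (hE : 1 ≤ E) (t : ℝ) : |lowerSource b θ r m E t| ≤ (1 - b) * θ := by
  rw [abs_of_nonneg (lowerSource_nonneg H r m E t)]
  exact (lowerSource_le_upperSource H hr hm hE t).trans (upperSource_le H r t)

lemma hasDerivAt_upperV (H : StepParams b c h θ κ) (r t : ℝ) :
    HasDerivAt (upperV b θ r) (upperSource b θ r t - θ * upperV b θ r t) t :=
  hasDerivAt_bwd H.θ_pos (continuous_upperSource b θ r) (abs_upperSource_le H r) t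

lemma upperV_nonneg (H : StepParams b c h θ κ) (r t : ℝ) : 0 ≤ upperV b θ r t :=
  bwd_nonneg (upperSource_nonneg H r) t

lemma upperV_le (H : StepParams b c h θ κ) (r t : ℝ) : upperV b θ r t ≤ 1 - b := by
  have := abs_bwd_le H.θ_pos (continuous_upperSource b θ r) (abs_upperSource_le H r) t
  rw [mul_div_cancel_right₀ _ H.θ_pos.ne'] at this
  exact (abs_le.1 this).2

lemma abs_upperV_le (H : StepParams b c h θ κ) (r t : ℝ) : |upperV b θ r t| ≤ 1 - b := by
  rw [abs_of_nonneg (upperV_nonneg H r t)]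
  exact upperV_le H r t

/-- The right-hand side solves x' + θx = (1 - b)θ e^{rt}, whose source dominates `upperSource`. -/
lemma upperV_le_exp (H : StepParams b c h θ κ) {r : ℝ} (hr : 0 < r) (t : ℝ) :
    upperV b θ r t ≤ (1 - b) * θ / (r + θ) * exp (r * t) := by
  have hθ := H.θ_pos
  have hb : 0 < 1 - b := by linarith [H.b_lt_one]
  have hd : ∀ t, HasDerivAt (fun t => (1 - b) * θ / (r + θ) * exp (r * t) - upperV b θ r t)
      ((1 - b) * θ / (r + θ) * (r * exp (r * t)) -
        (upperSource b θ r t - θ * upperV b θ r t)) t := fun t =>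
    ((hasDerivAt_exp_mul r t).const_mul _).sub (hasDerivAt_upperV H r t)
  have := InCone.of_monotone_of_bdd (C := 1 - b) hθ (fun t => ?_)
    (monotone_of_hasDerivAt_nonneg' (fun t => hasDerivAt_exp_mul_mul θ (hd t)) (fun t => ?_))
  · have := this.nonneg t
    linarith
  · have h1 : 0 ≤ (1 - b) * θ / (r + θ) * exp (r * t) := by positivity
    have h2 := upperV_le H r t
    linarith
  · refine mul_nonneg (exp_pos _).le ?_
    have h1 := upperSource_le_exp H r t
    have h2 : (1 - b) * θ / (r + θ) * (r * exp (r * t)) +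
        θ * ((1 - b) * θ / (r + θ) * exp (r * t)) = (1 - b) * θ * exp (r * t) := by
      field_simp
    linarith

/-- Bounds relating `upperV` with the function `1 - b - M e^{-θ t}`. -/
lemma upperV_compare (H : StepParams b c h θ κ) {r : ℝ} (hr : 0 < r) (t : ℝ) :
    1 - b - (1 - b - upperV b θ r 0) * exp (-θ * t) ≤ upperV b θ r t ∧
      (0 ≤ t → upperV b θ r t = 1 - b - (1 - b - upperV b θ r 0) * exp (-θ * t)) := by
  have hd : ∀ t, HasDerivAt (fun t => exp (θ * t) * (1 - b - upperV b θ r t))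
      (exp (θ * t) * (-(upperSource b θ r t - θ * upperV b θ r t)
        + θ * (1 - b - upperV b θ r t))) t := fun t =>
    hasDerivAt_exp_mul_mul θ ((hasDerivAt_upperV H r t).const_sub _)
  have hmono : Monotone (fun t => exp (θ * t) * (1 - b - upperV b θ r t)) :=
    monotone_of_hasDerivAt_nonneg' hd fun t =>
      mul_nonneg (exp_pos _).le (by linarith [upperSource_le H r t])
  have hanti : AntitoneOn (fun t => exp (θ * t) * (1 - b - upperV b θ r t)) (Ici 0) :=
    antitoneOn_of_hasDerivAt_nonpos (convex_Ici 0) (fun t _ => hd t) fun t ht => by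
      have h1 : 1 ≤ exp (r * t) := one_le_exp (mul_nonneg hr.le ht)
      have h2 : upperSource b θ r t = (1 - b) * θ := by
        rw [upperSource, min_eq_right h1, mul_one]
      rw [h2]
      apply le_of_eq
      ring
  have e : exp (θ * t) * exp (-θ * t) = 1 := by rw [← exp_add]; simp
  have hp := exp_pos (-θ * t)
  have heq : 0 ≤ t → upperV b θ r t = 1 - b - (1 - b - upperV b θ r 0) * exp (-θ * t) := by
    intro ht
    have h1 := hmono ht
    have h2 := hanti (mem_Ici.2 le_rfl) (mem_Ici.2 ht) ht
    have h3 : exp (θ * t) * (1 - b - upperV b θ r t) = 1 - b - upperV b θ r 0 := by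
      simpa using le_antisymm h2 h1
    rw [← h3]
    linear_combination (1 - b - upperV b θ r t) * e
  refine ⟨?_, heq⟩
  rcases le_total 0 t with ht | ht
  · exact (heq ht).ge
  · have h1 : exp (θ * t) * (1 - b - upperV b θ r t) ≤ 1 - b - upperV b θ r 0 := by
      simpa using hmono ht
    have h2 := mul_le_mul_of_nonneg_right h1 hp.le
    have h3 : exp (θ * t) * (1 - b - upperV b θ r t) * exp (-θ * t) = 1 - b - upperV b θ r t := by
      linear_combination (1 - b - upperV b θ r t) * e
    linarith

lemma upperSol_sub_shift (H : StepParams b c h θ κ) (r t : ℝ) :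
    upperSol b h θ r t - b * upperSol b h θ r (t - h) = upperV b θ r t :=
  neumann_eq H.b_nonneg H.b_lt_one (abs_upperV_le H r) t

lemma abs_upperSol_le (H : StepParams b c h θ κ) (r t : ℝ) : |upperSol b h θ r t| ≤ 1 := by
  have := abs_neumann_le (h := h) H.b_nonneg H.b_lt_one (abs_upperV_le H r) t
  rwa [div_self (by linarith [H.b_lt_one])] at this

lemma unitFun_upperSol (H : StepParams b c h θ κ) (r : ℝ) : UnitFun (upperSol b h θ r) where
  cont := continuous_neumann H.b_nonneg H.b_lt_one (abs_upperV_le H r)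
    (continuous_iff_continuousAt.2 fun t => (hasDerivAt_upperV H r t).continuousAt)
  nonneg := nonneg_of_shift H.b_nonneg H.b_lt_one (h := h)
    (fun t => (abs_le.1 (abs_upperSol_le H r t)).1) fun t => by
      have := upperSol_sub_shift H r t
      have := upperV_nonneg H r t
      linarith
  le_one t := (abs_le.1 (abs_upperSol_le H r t)).2

/-- The characteristic function of the linearization at zero, with reaction rate `κ`. -/
def chi (b c h κ z : ℝ) : ℝ := z ^ 2 - c * z + κ / (1 - b * exp (-(z * h)))

lemma one_sub_pos (H : StepParams b c h θ κ) {r : ℝ} (hr : 0 ≤ r) :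
    0 < 1 - b * exp (-(r * h)) := by
  have h1 : exp (-(r * h)) ≤ 1 := exp_le_one_iff.2 (by have := mul_nonneg hr H.h_nonneg; linarith)
  have h2 : b * exp (-(r * h)) ≤ b := mul_le_of_le_one_right H.b_nonneg h1
  linarith [H.b_lt_one]

lemma exp_mul_sub (r t h : ℝ) : exp (r * (t - h)) = exp (-(r * h)) * exp (r * t) := by
  rw [← exp_add]
  congr 1
  ring

/-- Exponentials are eigenfunctions of D ↦ D - b D(· - h): e^{rt} has eigenvalue 1 - b e^{-rh},
which explains the extra denominator. -/
lemma upperSol_le_exp (H : StepParams b c h θ κ) {r : ℝ} (hr : 0 < r) (t : ℝ) :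
    upperSol b h θ r t ≤
      (1 - b) * θ / (r + θ) / (1 - b * exp (-(r * h))) * exp (r * t) := by
  have ha := one_sub_pos H hr.le
  have hθ := H.θ_pos
  have hb : 0 < 1 - b := by linarith [H.b_lt_one]
  set a := 1 - b * exp (-(r * h)) with hadef
  have := nonneg_of_shift H.b_nonneg H.b_lt_one (h := h) (C := 1)
    (D := fun t => (1 - b) * θ / (r + θ) / a * exp (r * t) - upperSol b h θ r t)
    (fun t => ?_) (fun t => ?_) t
  · linarith
  · have h1 : 0 ≤ (1 - b) * θ / (r + θ) / a * exp (r * t) := by positivity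
    have := (unitFun_upperSol H r).le_one t
    linarith
  · have h1 := upperV_le_exp H hr t
    have h2 := upperSol_sub_shift H r t
    have h3 : (1 - b) * θ / (r + θ) / a * exp (r * t) -
        b * ((1 - b) * θ / (r + θ) / a * exp (r * (t - h))) =
        (1 - b) * θ / (r + θ) * exp (r * t) := by
      rw [exp_mul_sub]
      calc _ = (1 - b) * θ / (r + θ) / a * exp (r * t) * (1 - b * exp (-(r * h))) := by ring
        _ = _ := by rw [← hadef]; field_simp
    linarith

lemma upperSol_ge (H : StepParams b c h θ κ) {r : ℝ} (hr : 0 < r) (t : ℝ) :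
    1 - (1 - b - upperV b θ r 0) / (1 - b * exp (θ * h)) * exp (-θ * t) ≤
      upperSol b h θ r t := by
  have ha := H.shift_pos
  set a := 1 - b * exp (θ * h) with hadef
  set M := 1 - b - upperV b θ r 0 with hM
  have hM0 : 0 ≤ M := by linarith [upperV_le H r 0]
  have := nonneg_of_shift H.b_nonneg H.b_lt_one (h := h) (C := 1)
    (D := fun t => upperSol b h θ r t - (1 - M / a * exp (-θ * t))) (fun t => ?_) (fun t => ?_) t
  · linarith
  · have h1 : 0 ≤ M / a * exp (-θ * t) := by positivity
    have := (unitFun_upperSol H r).nonneg t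
    linarith
  · have h1 := (upperV_compare H hr t).1
    have h2 := upperSol_sub_shift H r t
    have h3 : M / a * exp (-θ * t) - b * (M / a * exp (-θ * (t - h))) = M * exp (-θ * t) := by
      rw [exp_mul_sub, show -(-θ * h) = θ * h by ring]
      calc _ = M / a * exp (-θ * t) * (1 - b * exp (θ * h)) := by ring
        _ = _ := by rw [← hadef]; field_simp
    linarith

/-- The source of the upper solution lies above the first order part of its Green function. -/
lemma fwd_source_upperSol_le (H : StepParams b c h θ κ) {r : ℝ} (hr : 0 < r)
    (hχ : chi b c h κ r = 0) (t : ℝ) :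
    fwd (c + θ) (source b c h θ κ (upperSol b h θ r)) t ≤ upperSource b θ r t := by
  have hU := unitFun_upperSol H r
  have hθ := H.θ_pos
  have hρ := H.ρ_pos
  have hb : 0 < 1 - b := by linarith [H.b_lt_one]
  have hQ : 0 < θ * (c + θ) := mul_pos hθ hρ
  have hpos : ∀ t, 0 ≤ t → fwd (c + θ) (source b c h θ κ (upperSol b h θ r)) t ≤ (1 - b) * θ := by
    intro t ht
    -- To the right of 0 the neutral part is 1 - b minus a multiple of e^{-θs}. The reaction is at
    -- most κ(1 - φ(s - h)), of the same exponential order, and `key` makes the two deviations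
    -- cancel with the right sign.
    have h1 : ∀ s, t ≤ s → source b c h θ κ (upperSol b h θ r) s ≤ θ * (c + θ) * (1 - b) := by
      intro s hs
      have ha := H.shift_pos
      have e1 := (upperV_compare H hr s).2 (ht.trans hs)
      have e2 := upperSol_ge H hr (s - h)
      have e3 : upperSol b h θ r s * (1 - upperSol b h θ r (s - h)) ≤
          1 - upperSol b h θ r (s - h) :=
        mul_le_of_le_one_left (by linarith [hU.le_one (s - h)]) (hU.le_one s)
      rw [source, upperSol_sub_shift H, e1]
      set a := 1 - b * exp (θ * h) with hadef
      set M := 1 - b - upperV b θ r 0 with hM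
      have hM0 : 0 ≤ M := by linarith [upperV_le H r 0]
      rw [exp_mul_sub, show -(-θ * h) = θ * h by ring] at e2
      have e4 : κ * (upperSol b h θ r s * (1 - upperSol b h θ r (s - h))) ≤
          κ * (M / a * (exp (θ * h) * exp (-θ * s))) :=
        mul_le_mul_of_nonneg_left (by linarith) H.κ_pos.le
      have e5 : κ * (M / a * (exp (θ * h) * exp (-θ * s))) ≤ θ * (c + θ) * (M * exp (-θ * s)) := by
        have h0 : 0 ≤ M / a * exp (-θ * s) := by positivity
        calc _ = κ * exp (θ * h) * (M / a * exp (-θ * s)) := by ring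
          _ ≤ θ * (c + θ) * a * (M / a * exp (-θ * s)) := mul_le_mul_of_nonneg_right H.key h0
          _ = _ := by field_simp
      linarith
    have h2 := fwd_le hρ (continuous_source hU) (abs_source_le H hU) h1
    calc _ ≤ _ := h2
      _ = _ := by field_simp
  rcases le_total 0 t with ht | ht
  · have h1 : 1 ≤ exp (r * t) := one_le_exp (mul_nonneg hr.le ht)
    rw [upperSource, min_eq_right h1, mul_one]
    exact hpos t ht
  · have h1 : exp (r * t) ≤ 1 := exp_le_one_iff.2 (mul_nonpos_of_nonneg_of_nonpos hr.le ht)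
    rw [upperSource, min_eq_left h1]
    have ha := one_sub_pos H hr.le
    -- To the left of 0 the inequality is integrated backwards from 0, where it is already known.
    -- The differential inequality reduces to (θ(c + θ) + cr - r²)/(r + θ) = c + θ - r, a form of
    -- χ(r) = 0.
    have hanti : AntitoneOn (fun t => exp (-(c + θ) * t) * ((1 - b) * θ * exp (r * t) -
        fwd (c + θ) (source b c h θ κ (upperSol b h θ r)) t)) (Iic 0) := by
      refine antitoneOn_of_hasDerivAt_nonpos (convex_Iic 0) (fun s _ => hasDerivAt_exp_mul_mul _
        (((hasDerivAt_exp_mul r s).const_mul _).sub (hasDerivAt_fwd_source H hU s)))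
        fun s hs => ?_
      refine mul_nonpos_of_nonneg_of_nonpos (exp_pos _).le ?_
      have e1 := upperV_le_exp H hr s
      have e2 := upperSol_le_exp H hr s
      have e3 : source b c h θ κ (upperSol b h θ r) s ≤
          θ * (c + θ) * ((1 - b) * θ / (r + θ) * exp (r * s)) +
          κ * ((1 - b) * θ / (r + θ) / (1 - b * exp (-(r * h))) * exp (r * s)) := by
        rw [source, upperSol_sub_shift H]
        have : upperSol b h θ r s * (1 - upperSol b h θ r (s - h)) ≤ upperSol b h θ r s :=
          mul_le_of_le_one_right (hU.nonneg s) (by linarith [hU.nonneg (s - h)])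
        exact add_le_add (mul_le_mul_of_nonneg_left e1 hQ.le)
          (mul_le_mul_of_nonneg_left (this.trans e2) H.κ_pos.le)
      have e4 : θ * (c + θ) * ((1 - b) * θ / (r + θ) * exp (r * s)) +
          κ * ((1 - b) * θ / (r + θ) / (1 - b * exp (-(r * h))) * exp (r * s)) =
          (c + θ - r) * ((1 - b) * θ * exp (r * s)) := by
        have : κ / (1 - b * exp (-(r * h))) = c * r - r ^ 2 := by
          rw [chi] at hχ
          linarith
        calc _ = (θ * (c + θ) + κ / (1 - b * exp (-(r * h)))) *
              ((1 - b) * θ / (r + θ) * exp (r * s)) := by ring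
          _ = _ := by
            rw [this]
            field_simp
            ring
      linarith
    have h2 := hanti (mem_Iic.2 ht) (mem_Iic.2 le_rfl) ht
    have h3 := hpos 0 le_rfl
    simp only [mul_zero, exp_zero, mul_one, one_mul] at h2
    have h4 := nonneg_of_mul_nonneg_right (le_trans (by linarith) h2) (exp_pos _)
    linarith

lemma upperSol_sub_step (H : StepParams b c h θ κ) {r : ℝ} (hr : 0 < r)
    (hχ : chi b c h κ r = 0) :
    InCone θ fun t => upperSol b h θ r t - step b c h θ κ (upperSol b h θ r) t :=
  inCone_neumann_sub H (C := max ((1 - b) * θ) (sourceBound c θ / (c + θ)))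
    (continuous_upperSource b θ r) (continuous_fwd_source H (unitFun_upperSol H r))
    (fun t => (abs_upperSource_le H r t).trans (le_max_left _ _))
    (fun t => (abs_fwd_source_le H (unitFun_upperSol H r) t).trans (le_max_right _ _))
    (fwd_source_upperSol_le H hr hχ)

/-- Since `step` commutes with translations, this cone relation propagates to all iterates and makes
them nondecreasing in t. -/
lemma upperSol_comp_add_sub (H : StepParams b c h θ κ) {r s : ℝ} (hr : 0 < r) (hs : 0 ≤ s) :
    InCone θ fun t => upperSol b h θ r (t + s) - upperSol b h θ r t := by
  have := inCone_neumann_sub H (f := fun t => upperSource b θ r (t + s))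
    (g := upperSource b θ r) (by have := continuous_upperSource b θ r; fun_prop)
    (continuous_upperSource b θ r) (fun t => abs_upperSource_le H r _) (abs_upperSource_le H r)
    (fun t => ?_)
  · convert this using 3
    simp only [upperSol, neumann, upperV, bwd_comp_add]
    · congr 1
      funext k
      rw [sub_add_eq_add_sub]
    · rfl
  · refine mul_le_mul_of_nonneg_left (min_le_min_right _ (exp_le_exp.2 ?_))
      (mul_nonneg (by linarith [H.b_lt_one]) H.θ_pos.le)
    nlinarith

end

/-! ### The lower solution and the Green operator in the limit -/

section
variable {b c h θ κ : ℝ}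

lemma hasDerivAt_lowerV (H : StepParams b c h θ κ) {r m E : ℝ} (hr : 0 < r)
    (hm : r ≤ m) (hE : 1 ≤ E) (t : ℝ) :
    HasDerivAt (lowerV b θ r m E) (lowerSource b θ r m E t - θ * lowerV b θ r m E t) t :=
  hasDerivAt_bwd H.θ_pos (continuous_lowerSource b θ r m E) (abs_lowerSource_le H hr hm hE) t

lemma lowerV_nonneg (H : StepParams b c h θ κ) (r m E t : ℝ) : 0 ≤ lowerV b θ r m E t :=
  bwd_nonneg (lowerSource_nonneg H r m E) t

lemma abs_lowerV_le (H : StepParams b c h θ κ) {r m E : ℝ} (hr : 0 < r)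
    (hm : r ≤ m) (hE : 1 ≤ E) (t : ℝ) : |lowerV b θ r m E t| ≤ 1 - b := by
  have := abs_bwd_le H.θ_pos (continuous_lowerSource b θ r m E) (abs_lowerSource_le H hr hm hE) t
  rwa [mul_div_cancel_right₀ _ H.θ_pos.ne'] at this

lemma lowerSol_sub_shift (H : StepParams b c h θ κ) {r m E : ℝ} (hr : 0 < r)
    (hm : r ≤ m) (hE : 1 ≤ E) (t : ℝ) :
    lowerSol b h θ r m E t - b * lowerSol b h θ r m E (t - h) = lowerV b θ r m E t :=
  neumann_eq H.b_nonneg H.b_lt_one (abs_lowerV_le H hr hm hE) t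

lemma abs_lowerSol_le (H : StepParams b c h θ κ) {r m E : ℝ} (hr : 0 < r)
    (hm : r ≤ m) (hE : 1 ≤ E) (t : ℝ) : |lowerSol b h θ r m E t| ≤ 1 := by
  have := abs_neumann_le (h := h) H.b_nonneg H.b_lt_one (abs_lowerV_le H hr hm hE) t
  rwa [div_self (by linarith [H.b_lt_one])] at this

lemma unitFun_lowerSol (H : StepParams b c h θ κ) {r m E : ℝ} (hr : 0 < r)
    (hm : r ≤ m) (hE : 1 ≤ E) : UnitFun (lowerSol b h θ r m E) where
  cont := continuous_neumann H.b_nonneg H.b_lt_one (abs_lowerV_le H hr hm hE)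
    (continuous_iff_continuousAt.2 fun t => (hasDerivAt_lowerV H hr hm hE t).continuousAt)
  nonneg := nonneg_of_shift H.b_nonneg H.b_lt_one (h := h)
    (fun t => (abs_le.1 (abs_lowerSol_le H hr hm hE t)).1) fun t => by
      have := lowerSol_sub_shift H hr hm hE t
      have := lowerV_nonneg H r m E t
      linarith
  le_one t := (abs_le.1 (abs_lowerSol_le H hr hm hE t)).2

lemma upperSol_sub_lowerSol (H : StepParams b c h θ κ) {r m E : ℝ} (hr : 0 < r)
    (hm : r ≤ m) (hE : 1 ≤ E) :
    InCone θ fun t => upperSol b h θ r t - lowerSol b h θ r m E t :=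
  inCone_neumann_sub H (continuous_upperSource b θ r) (continuous_lowerSource b θ r m E)
    (abs_upperSource_le H r) (abs_lowerSource_le H hr hm hE)
    (lowerSource_le_upperSource H hr hm hE)

/-- Dropping the positive part in the generator leaves two exponentials, for which x' + θx = g is
solved explicitly. On t ≤ 0 the growing term e^{rt} is bounded, as the argument from -∞ requires. -/
lemma lowerV_ge (H : StepParams b c h θ κ) {r m E : ℝ} (hr : 0 < r)
    (hm : r ≤ m) (hE : 1 ≤ E) :
    ∀ t ≤ 0, (1 - b) * θ / (r + θ) * exp (r * t) - (1 - b) * θ * E / (m + θ) * exp (m * t) ≤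
      lowerV b θ r m E t := by
  have hθ := H.θ_pos
  have hb : 0 < 1 - b := by linarith [H.b_lt_one]
  have hm0 : 0 < m := hr.trans_le hm
  have hd : ∀ t, HasDerivAt (fun t => lowerV b θ r m E t -
      ((1 - b) * θ / (r + θ) * exp (r * t) - (1 - b) * θ * E / (m + θ) * exp (m * t)))
      ((lowerSource b θ r m E t - θ * lowerV b θ r m E t) -
        ((1 - b) * θ / (r + θ) * (r * exp (r * t)) -
          (1 - b) * θ * E / (m + θ) * (m * exp (m * t)))) t := fun t =>
    (hasDerivAt_lowerV H hr hm hE t).sub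
      (((hasDerivAt_exp_mul r t).const_mul _).sub ((hasDerivAt_exp_mul m t).const_mul _))
  have := nonneg_of_monotoneOn_exp_mul (C := (1 - b) * θ / (r + θ)) (T := 0) hθ (fun t ht => ?_)
    ((monotone_of_hasDerivAt_nonneg' (fun t => hasDerivAt_exp_mul_mul θ (hd t))
      (fun t => ?_)).monotoneOn _)
  · intro t ht
    have := this t ht
    linarith
  · have h1 : exp (r * t) ≤ 1 := exp_le_one_iff.2 (mul_nonpos_of_nonneg_of_nonpos hr.le ht)
    have h2 : (1 - b) * θ / (r + θ) * exp (r * t) ≤ (1 - b) * θ / (r + θ) :=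
      mul_le_of_le_one_right (by positivity) h1
    have h3 : 0 ≤ (1 - b) * θ * E / (m + θ) * exp (m * t) := by positivity
    have := lowerV_nonneg H r m E t
    linarith
  · refine mul_nonneg (exp_pos _).le ?_
    have h1 : (1 - b) * θ * (exp (r * t) - E * exp (m * t)) ≤ lowerSource b θ r m E t :=
      mul_le_mul_of_nonneg_left (le_max_left _ _) (by positivity)
    have h2 : (1 - b) * θ / (r + θ) * (r * exp (r * t)) +
        θ * ((1 - b) * θ / (r + θ) * exp (r * t)) = (1 - b) * θ * exp (r * t) := by
      field_simp
    have h3 : (1 - b) * θ * E / (m + θ) * (m * exp (m * t)) +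
        θ * ((1 - b) * θ * E / (m + θ) * exp (m * t)) = (1 - b) * θ * E * exp (m * t) := by
      field_simp
    linarith

lemma lowerSol_ge (H : StepParams b c h θ κ) {r m E : ℝ} (hr : 0 < r)
    (hm : r ≤ m) (hE : 1 ≤ E) :
    ∀ t ≤ 0, (1 - b) * θ / (r + θ) / (1 - b * exp (-(r * h))) * exp (r * t) -
      (1 - b) * θ * E / (m + θ) / (1 - b * exp (-(m * h))) * exp (m * t) ≤
      lowerSol b h θ r m E t := by
  have hθ := H.θ_pos
  have hb : 0 < 1 - b := by linarith [H.b_lt_one]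
  have hm0 : 0 < m := hr.trans_le hm
  have ha := one_sub_pos H hr.le
  have ha' := one_sub_pos H hm0.le
  have := nonneg_of_shift_on H.b_nonneg H.b_lt_one (h := h) (s := Iic 0)
    (C := (1 - b) * θ / (r + θ) / (1 - b * exp (-(r * h))))
    (D := fun t => lowerSol b h θ r m E t -
      ((1 - b) * θ / (r + θ) / (1 - b * exp (-(r * h))) * exp (r * t) -
      (1 - b) * θ * E / (m + θ) / (1 - b * exp (-(m * h))) * exp (m * t)))
    (fun t ht => mem_Iic.2 (by have := mem_Iic.1 ht; linarith [H.h_nonneg])) (fun t ht => ?_)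
    (fun t ht => ?_)
  · intro t ht
    have := this t ht
    linarith
  · have h1 : exp (r * t) ≤ 1 := exp_le_one_iff.2 (mul_nonpos_of_nonneg_of_nonpos hr.le ht)
    have h2 : (1 - b) * θ / (r + θ) / (1 - b * exp (-(r * h))) * exp (r * t) ≤ _ :=
      mul_le_of_le_one_right (by positivity) h1
    have h3 : 0 ≤ (1 - b) * θ * E / (m + θ) / (1 - b * exp (-(m * h))) * exp (m * t) := by
      positivity
    have := (unitFun_lowerSol H hr hm hE).nonneg t
    linarith
  · have h1 := lowerV_ge H hr hm hE t ht
    have h2 := lowerSol_sub_shift H hr hm hE t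
    have h3 : ∀ k z : ℝ, 0 < 1 - b * exp (-(z * h)) →
        k / (1 - b * exp (-(z * h))) * exp (z * t) -
        b * (k / (1 - b * exp (-(z * h))) * exp (z * (t - h))) = k * exp (z * t) := by
      intro k z hz
      rw [exp_mul_sub]
      calc _ = k / (1 - b * exp (-(z * h))) * (1 - b * exp (-(z * h))) * exp (z * t) := by ring
        _ = _ := by rw [div_mul_cancel₀ _ hz.ne']
    have h4 := h3 ((1 - b) * θ / (r + θ)) r ha
    have h5 := h3 ((1 - b) * θ * E / (m + θ)) m ha'
    linarith

/-- The source of the lower solution lies below the first order part of its Green function. -/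
lemma lowerSource_le_fwd (H : StepParams b c h θ κ) {r m E : ℝ} (hr : 0 < r)
    (hm : r < m) (hm2 : m ≤ 2 * r) (hE : 1 ≤ E) (hχr : chi b c h κ r = 0)
    (hEχ : κ * ((1 - b) * θ / (r + θ) / (1 - b * exp (-(r * h)))) ^ 2 ≤
      (1 - b) * θ * E / (m + θ) * -chi b c h κ m) (t : ℝ) :
    lowerSource b θ r m E t ≤ fwd (c + θ) (source b c h θ κ (lowerSol b h θ r m E)) t := by
  have hU := unitFun_lowerSol H hr hm.le hE
  have hθ := H.θ_pos
  have hρ := H.ρ_pos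
  have hb : 0 < 1 - b := by linarith [H.b_lt_one]
  have hQ : 0 < θ * (c + θ) := mul_pos hθ hρ
  have hm0 : 0 < m := hr.trans hm
  have ha := one_sub_pos H hr.le
  have ha' := one_sub_pos H hm0.le
  set φ := lowerSol b h θ r m E with hφ
  have hsrc : ∀ s, 0 ≤ source b c h θ κ φ s := fun s => by
    rw [source, lowerSol_sub_shift H hr hm.le hE]
    exact add_nonneg (mul_nonneg hQ.le (lowerV_nonneg H r m E s))
      (mul_nonneg H.κ_pos.le (mul_nonneg (hU.nonneg s) (by linarith [hU.le_one (s - h)])))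
  have hw : ∀ s, 0 ≤ fwd (c + θ) (source b c h θ κ φ) s := fun s => fwd_nonneg fun u _ => hsrc u
  rcases le_total (exp (r * t)) (E * exp (m * t)) with hcase | hcase
  · rw [lowerSource, max_eq_right (by linarith), mul_zero]
    exact hw t
  rw [lowerSource, max_eq_left (by linarith)]
  have hE0 : 0 < E := by linarith
  -- The point where e^{rt} = E e^{mt}; the generator is positive exactly to its left, and T ≤ 0
  -- because E ≥ 1.
  set T := -(log E / (m - r)) with hT
  have hmr : 0 < m - r := by linarith
  have hT0 : T ≤ 0 := neg_nonpos.2 (div_nonneg (log_nonneg hE) hmr.le)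
  have hTe : E * exp (m * T) = exp (r * T) := by
    nth_rewrite 1 [← exp_log hE0]
    rw [← exp_add]
    congr 1
    rw [hT]
    field_simp
    ring
  have htT : t ≤ T := by
    rw [← exp_log hE0, ← exp_add, exp_le_exp] at hcase
    have h1 : log E = -((m - r) * T) := by rw [hT]; field_simp
    have h2 : (m - r) * t ≤ (m - r) * T := by linarith
    exact le_of_mul_le_mul_left h2 hmr
  have hanti : AntitoneOn (fun t => exp (-(c + θ) * t) *
      (fwd (c + θ) (source b c h θ κ φ) t -
        ((1 - b) * θ * exp (r * t) - (1 - b) * θ * E * exp (m * t)))) (Iic T) := by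
    refine antitoneOn_of_hasDerivAt_nonpos (convex_Iic T) (fun s _ => hasDerivAt_exp_mul_mul _
      ((hasDerivAt_fwd_source H hU s).sub (((hasDerivAt_exp_mul r s).const_mul _).sub
        ((hasDerivAt_exp_mul m s).const_mul _)))) fun s hs => ?_
    refine mul_nonpos_of_nonneg_of_nonpos (exp_pos _).le ?_
    have hs0 : s ≤ 0 := (mem_Iic.1 hs).trans hT0
    have e1 := lowerV_ge H hr hm.le hE s hs0
    have e2 := lowerSol_ge H hr hm.le hE s hs0
    have e3 : ∀ u, φ u ≤ (1 - b) * θ / (r + θ) / (1 - b * exp (-(r * h))) * exp (r * u) :=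
      fun u => (sub_nonneg.1 ((upperSol_sub_lowerSol H hr hm.le hE).nonneg u)).trans
        (upperSol_le_exp H hr u)
    -- The quadratic loss is of order e^{2rs} ≤ e^{ms}, since m ≤ 2r and s ≤ 0. It is compensated by
    -- the term -χ(m) > 0 times E, with E large as in `hEχ`.
    have e4 : φ s * φ (s - h) ≤
        ((1 - b) * θ / (r + θ) / (1 - b * exp (-(r * h)))) ^ 2 * exp (m * s) := by
      have f1 := e3 s
      have f2 := e3 (s - h)
      set C := (1 - b) * θ / (r + θ) / (1 - b * exp (-(r * h))) with hC
      have hC0 : 0 ≤ C := by positivity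
      have f3 : exp (r * (s - h)) ≤ exp (r * s) :=
        exp_le_exp.2 (mul_le_mul_of_nonneg_left (by linarith [H.h_nonneg]) hr.le)
      have f4 : φ (s - h) ≤ C * exp (r * s) :=
        f2.trans (mul_le_mul_of_nonneg_left f3 hC0)
      have f5 : exp (r * s) * exp (r * s) ≤ exp (m * s) := by
        rw [← exp_add, exp_le_exp]
        nlinarith
      calc φ s * φ (s - h) ≤ (C * exp (r * s)) * (C * exp (r * s)) :=
            mul_le_mul f1 f4 (hU.nonneg _) (by positivity)
        _ = C ^ 2 * (exp (r * s) * exp (r * s)) := by ring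
        _ ≤ _ := mul_le_mul_of_nonneg_left f5 (by positivity)
    have e5 := mul_le_mul_of_nonneg_left e4 H.κ_pos.le
    have e6 := mul_le_mul_of_nonneg_right hEχ (exp_pos (m * s)).le
    have e7 := mul_le_mul_of_nonneg_left e1 hQ.le
    have e8 := mul_le_mul_of_nonneg_left e2 H.κ_pos.le
    have e9 : source b c h θ κ φ s = θ * (c + θ) * lowerV b θ r m E s +
        (κ * φ s - κ * (φ s * φ (s - h))) := by
      rw [source, lowerSol_sub_shift H hr hm.le hE]
      ring
    have g1 : θ * (c + θ) * ((1 - b) * θ / (r + θ) * exp (r * s)) +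
        κ * ((1 - b) * θ / (r + θ) / (1 - b * exp (-(r * h))) * exp (r * s)) =
        (c + θ - r) * ((1 - b) * θ * exp (r * s)) := by
      have : κ / (1 - b * exp (-(r * h))) = c * r - r ^ 2 := by
        rw [chi] at hχr
        linarith
      calc _ = (θ * (c + θ) + κ / (1 - b * exp (-(r * h)))) *
            ((1 - b) * θ / (r + θ) * exp (r * s)) := by ring
        _ = _ := by
          rw [this]
          field_simp
          ring
    have g2 : θ * (c + θ) * ((1 - b) * θ * E / (m + θ) * exp (m * s)) +
        κ * ((1 - b) * θ * E / (m + θ) / (1 - b * exp (-(m * h))) * exp (m * s)) =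
        (c + θ - m) * ((1 - b) * θ * E * exp (m * s)) +
        (1 - b) * θ * E / (m + θ) * chi b c h κ m * exp (m * s) := by
      have : κ / (1 - b * exp (-(m * h))) = chi b c h κ m + c * m - m ^ 2 := by
        rw [chi]
        ring
      calc _ = (θ * (c + θ) + κ / (1 - b * exp (-(m * h)))) *
            ((1 - b) * θ * E / (m + θ) * exp (m * s)) := by ring
        _ = _ := by
          rw [this]
          field_simp
          ring
    linarith
  have h2 := hanti (mem_Iic.2 htT) (mem_Iic.2 le_rfl) htT
  have h3 := hw T
  -- At T the two exponentials cancel and only the nonnegative average remains; the antitone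
  -- quantity is then nonnegative to the left of T.
  have h4 : 0 ≤ exp (-(c + θ) * T) * (fwd (c + θ) (source b c h θ κ φ) T -
        ((1 - b) * θ * exp (r * T) - (1 - b) * θ * E * exp (m * T))) := by
    refine mul_nonneg (exp_pos _).le ?_
    rw [mul_assoc ((1 - b) * θ) E, hTe]
    linarith
  have h5 := nonneg_of_mul_nonneg_right (h4.trans h2) (exp_pos _)
  linarith

lemma step_sub_lowerSol (H : StepParams b c h θ κ) {r m E : ℝ} (hr : 0 < r)
    (hm : r < m) (hm2 : m ≤ 2 * r) (hE : 1 ≤ E) (hχr : chi b c h κ r = 0)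
    (hEχ : κ * ((1 - b) * θ / (r + θ) / (1 - b * exp (-(r * h)))) ^ 2 ≤
      (1 - b) * θ * E / (m + θ) * -chi b c h κ m) :
    InCone θ fun t => step b c h θ κ (lowerSol b h θ r m E) t - lowerSol b h θ r m E t :=
  inCone_neumann_sub H (C := max (sourceBound c θ / (c + θ)) ((1 - b) * θ))
    (continuous_fwd_source H (unitFun_lowerSol H hr hm.le hE)) (continuous_lowerSource b θ r m E)
    (fun t => (abs_fwd_source_le H (unitFun_lowerSol H hr hm.le hE) t).trans (le_max_left _ _))
    (fun t => (abs_lowerSource_le H hr hm.le hE t).trans (le_max_right _ _))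
    (lowerSource_le_fwd H hr hm hm2 hE hχr hEχ)

/-! ### Passing to the limit -/

/-- The reaction rate may vary with the index, as needed for κ → 1. The index `i₀` only supplies the
signs of the parameters, since ι could be empty. -/
lemma tendsto_green {ι : Type*} {l : Filter ι} [l.IsCountablyGenerated] {K : ι → ℝ}
    {Φ : ι → ℝ → ℝ} {T : ι → ℝ} {φ : ℝ → ℝ} {κ r : ℝ} (hK : ∀ i, StepParams b c h θ (K i))
    (hΦ : ∀ i, UnitFun (Φ i)) (hκ : Tendsto K l (𝓝 κ))
    (hlim : ∀ σ, Tendsto (fun i => Φ i (T i + σ)) l (𝓝 (φ (r + σ)))) (i₀ : ι) :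
    Tendsto (fun i => green b c h θ (K i) (Φ i) (T i)) l (𝓝 (green b c h θ κ φ r)) := by
  have hθ := (hK i₀).θ_pos
  have hρ := (hK i₀).ρ_pos
  refine tendsto_bwd hθ (fun i => continuous_fwd_source (hK i) (hΦ i))
    (fun i t => abs_fwd_source_le (hK i) (hΦ i) t) fun σ => ?_
  refine tendsto_fwd hρ (fun i => continuous_source (hΦ i)) (fun i t => abs_source_le (hK i) (hΦ i) t)
    fun σ' => ?_
  have e1 : Tendsto (fun i => Φ i (T i - σ + σ')) l (𝓝 (φ (r - σ + σ'))) := by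
    convert hlim (-σ + σ') using 3 <;> ring_nf
  have e2 : Tendsto (fun i => Φ i (T i - σ + σ' - h)) l (𝓝 (φ (r - σ + σ' - h))) := by
    convert hlim (-σ + σ' - h) using 3 <;> ring_nf
  exact ((e1.sub (e2.const_mul b)).const_mul _).add (hκ.mul (e1.mul (e2.const_sub 1)))

/-- The limits at infinity of a bounded solution are equilibria. -/
lemma limit_eq_zero_or_one {l : Filter ℝ} [l.IsCountablyGenerated] [l.NeBot]
    (H : StepParams b c h θ κ) {φ : ℝ → ℝ} (hφ : UnitFun φ)
    (heq : ∀ t, φ t - b * φ (t - h) = green b c h θ κ φ t)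
    (hl : ∀ σ : ℝ, Tendsto (fun t => t + σ) l l) {L : ℝ} (hL : Tendsto φ l (𝓝 L)) :
    L = 0 ∨ L = 1 := by
  have hθ := H.θ_pos
  have hρ := H.ρ_pos
  have h1 : Tendsto (fun t => green b c h θ κ φ t) l (𝓝 (green b c h θ κ (fun _ => L) 0)) :=
    tendsto_green (Φ := fun _ => φ) (K := fun _ => κ) (T := id) (fun _ => H) (fun _ => hφ)
      tendsto_const_nhds (fun σ => hL.comp (hl σ)) 0
  have h2 : Tendsto (fun t => φ t - b * φ (t - h)) l (𝓝 (L - b * L)) :=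
    hL.sub ((hL.comp (hl (-h))).const_mul b)
  have h3 := tendsto_nhds_unique h2 (h1.congr fun t => (heq t).symm)
  have h4 : green b c h θ κ (fun _ => L) 0 =
      (θ * (c + θ) * (L - b * L) + κ * (L * (1 - L))) / (c + θ) / θ := by
    simp only [green, bwd_eq_fwd]
    rw [← fwd_const hθ _ (-0)]
    congr 1
    funext s
    exact fwd_const hρ _ _
  rw [h4] at h3
  have h5 : κ * (L * (1 - L)) = 0 := by
    field_simp at h3
    linarith
  rcases mul_eq_zero.1 ((mul_eq_zero.1 h5).resolve_left H.κ_pos.ne') with h | h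
  · exact Or.inl h
  · exact Or.inr (by linarith)

/-- Bounded monotone solutions of the integrated equation that connect zero to one. -/
structure IsIntegralFront (b c h θ κ : ℝ) (φ : ℝ → ℝ) : Prop where
  unit : UnitFun φ
  mono : Monotone φ
  eq : ∀ t, φ t - b * φ (t - h) = green b c h θ κ φ t
  bot : Tendsto φ atBot (𝓝 0)
  top : Tendsto φ atTop (𝓝 1)

/-- Existence in the noncritical case. -/
theorem exists_integralFront_of_lt (H : StepParams b c h θ κ) {r m : ℝ} (hr : 0 < r)
    (hm : r < m) (hm2 : m ≤ 2 * r) (hχr : chi b c h κ r = 0) (hχm : chi b c h κ m < 0) :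
    ∃ φ, IsIntegralFront b c h θ κ φ := by
  have hθ := H.θ_pos
  have hb : 0 < 1 - b := by linarith [H.b_lt_one]
  have hm0 : 0 < m := hr.trans hm
  obtain ⟨E, hE, hEχ⟩ : ∃ E : ℝ, 1 ≤ E ∧
      κ * ((1 - b) * θ / (r + θ) / (1 - b * exp (-(r * h)))) ^ 2 ≤
      (1 - b) * θ * E / (m + θ) * -chi b c h κ m := by
    have hpos : 0 < (1 - b) * θ / (m + θ) * -chi b c h κ m :=
      mul_pos (by positivity) (by linarith)
    set A := κ * ((1 - b) * θ / (r + θ) / (1 - b * exp (-(r * h)))) ^ 2 with hA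
    refine ⟨max 1 (A / ((1 - b) * θ / (m + θ) * -chi b c h κ m)), le_max_left _ _, ?_⟩
    have h1 := mul_le_mul_of_nonneg_left
      (le_max_right 1 (A / ((1 - b) * θ / (m + θ) * -chi b c h κ m))) hpos.le
    rw [mul_div_cancel₀ _ hpos.ne'] at h1
    refine h1.trans (le_of_eq ?_)
    ring
  set lo := lowerSol b h θ r m E with hlo
  have hloU : UnitFun lo := unitFun_lowerSol H hr hm.le hE
  let Φ : ℕ → ℝ → ℝ := fun n => (step b c h θ κ)^[n] (upperSol b h θ r)
  have hΦs : ∀ n, Φ (n + 1) = step b c h θ κ (Φ n) := fun n =>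
    Function.iterate_succ_apply' _ _ _
  -- The second component keeps the limit above the lower solution, the third makes the sequence
  -- decreasing, and the fourth makes each iterate nondecreasing in t.
  have hind : ∀ n, UnitFun (Φ n) ∧ InCone θ (fun t => Φ n t - lo t) ∧
      InCone θ (fun t => Φ n t - Φ (n + 1) t) ∧
      ∀ s, 0 ≤ s → InCone θ fun t => Φ n (t + s) - Φ n t := by
    intro n
    induction n with
    | zero =>
      exact ⟨unitFun_upperSol H r, upperSol_sub_lowerSol H hr hm.le hE,
        upperSol_sub_step H hr hχr, fun s hs => upperSol_comp_add_sub H hr hs⟩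
    | succ n ih =>
      obtain ⟨hU, hl, hdec, hsh⟩ := ih
      have hl' : InCone θ (fun t => Φ (n + 1) t - lo t) := by
        have := (step_mono H hU hloU hl).add (step_sub_lowerSol H hr hm hm2 hE hχr hEχ)
        rw [hΦs]
        rw [← hlo] at this
        simpa using this
      have hU' : UnitFun (Φ (n + 1)) := by
        refine ⟨?_, fun t => ?_, fun t => ?_⟩
        · rw [hΦs]
          exact continuous_step H hU
        · have := hl'.nonneg t
          have := hloU.nonneg t
          linarith
        · have := hdec.nonneg t
          have := hU.le_one t
          linarith
      refine ⟨hU', hl', ?_, fun s hs => ?_⟩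
      · have := step_mono H hU hU' hdec
        rwa [← hΦs, ← hΦs] at this
      · have := step_mono H (hU.comp_add s) hU (hsh s hs)
        rw [step_comp_add, ← hΦs] at this
        exact this
  have hU := fun n => (hind n).1
  have hanti : ∀ t, Antitone fun n => Φ n t := fun t =>
    antitone_nat_of_succ_le fun n => by linarith [(hind n).2.2.1.nonneg t]
  let φ : ℝ → ℝ := fun t => ⨅ n, Φ n t
  have hlim : ∀ t, Tendsto (fun n => Φ n t) atTop (𝓝 (φ t)) := fun t =>
    tendsto_atTop_ciInf (hanti t) ⟨0, by rintro _ ⟨n, rfl⟩; exact (hU n).nonneg t⟩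
  have hlow : ∀ t, lo t ≤ φ t := fun t =>
    ge_of_tendsto' (hlim t) fun n => by linarith [(hind n).2.1.nonneg t]
  have hupp : ∀ t, φ t ≤ upperSol b h θ r t := fun t =>
    le_of_tendsto' (hlim t) fun n => hanti t (Nat.zero_le n)
  have hmono : Monotone φ := fun s t hst =>
    le_of_tendsto_of_tendsto' (hlim s) (hlim t) fun n => by
      have := ((hind n).2.2.2 (t - s) (by linarith)).nonneg s
      simp only [add_sub_cancel] at this
      linarith
  have hlip : ∀ t s, |φ t - φ s| ≤ stepLip b c θ * |t - s| := fun t s => by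
    refine le_of_tendsto ((hlim t).sub (hlim s)).abs ?_
    -- The uniform Lipschitz bound holds on the range of `step`, hence from index 1 on.
    filter_upwards [eventually_ge_atTop 1] with n hn
    obtain ⟨k, rfl⟩ : ∃ k, n = k + 1 := ⟨n - 1, by omega⟩
    rw [hΦs]
    exact lipschitz_of_shift H (hU k) (abs_step_le H (hU k)) (step_sub_shift H (hU k)) t s
  have hcont : Continuous φ := by
    have hL : LipschitzWith (stepLip b c θ).toNNReal φ := LipschitzWith.of_dist_le_mul fun t s => by
      rw [Real.dist_eq, Real.dist_eq]
      exact (hlip t s).trans (mul_le_mul_of_nonneg_right (Real.le_coe_toNNReal _) (abs_nonneg _))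
    exact hL.continuous
  have hφU : UnitFun φ := ⟨hcont, fun t => (hloU.nonneg t).trans (hlow t), fun t =>
    (hupp t).trans ((unitFun_upperSol H r).le_one t)⟩
  have heq : ∀ t, φ t - b * φ (t - h) = green b c h θ κ φ t := fun t => by
    have h1 : Tendsto (fun n => green b c h θ κ (Φ n) t) atTop (𝓝 (green b c h θ κ φ t)) :=
      tendsto_green (K := fun _ => κ) (T := fun _ => t) (fun _ => H) hU tendsto_const_nhds
        (fun σ => hlim _) 0
    have h2 : Tendsto (fun n => Φ (n + 1) t - b * Φ (n + 1) (t - h)) atTop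
        (𝓝 (φ t - b * φ (t - h))) :=
      ((hlim t).comp (tendsto_add_atTop_nat 1)).sub
        (((hlim (t - h)).comp (tendsto_add_atTop_nat 1)).const_mul b)
    refine tendsto_nhds_unique h2 (h1.congr fun n => ?_)
    rw [hΦs, step_sub_shift H (hU n)]
  have hbot : Tendsto φ atBot (𝓝 0) := by
    refine tendsto_of_tendsto_of_tendsto_of_le_of_le tendsto_const_nhds ?_ hφU.nonneg
      (fun t => (hupp t).trans (upperSol_le_exp H hr t))
    simpa using (tendsto_exp_mul_atBot hr).const_mul
      ((1 - b) * θ / (r + θ) / (1 - b * exp (-(r * h))))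
  refine ⟨φ, hφU, hmono, heq, hbot, ?_⟩
  have hbdd : BddAbove (range φ) := ⟨1, by rintro _ ⟨t, rfl⟩; exact hφU.le_one t⟩
  have htop := tendsto_atTop_ciSup hmono hbdd
  rcases limit_eq_zero_or_one H hφU heq (fun σ => tendsto_atTop_add_const_right _ σ tendsto_id)
    htop with h0 | h1
  -- A zero limit at +∞ would force φ ≤ 0, but near -∞ the lower solution is positive: its e^{rt}
  -- term beats its e^{mt} term.
  · exfalso
    have ha := one_sub_pos H hr.le
    set k := (1 - b) * θ / (r + θ) / (1 - b * exp (-(r * h))) with hk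
    set k' := (1 - b) * θ * E / (m + θ) / (1 - b * exp (-(m * h))) with hk'
    have hkpos : 0 < k := by positivity
    have hle : ∀ t ≤ 0, k ≤ k' * exp ((m - r) * t) := fun t ht => by
      have e1 : k * exp (r * t) - k' * exp (m * t) ≤ lo t := lowerSol_ge H hr hm.le hE t ht
      have e2 : φ t ≤ 0 := h0 ▸ le_ciSup hbdd t
      have e3 : (k - k' * exp ((m - r) * t)) * exp (r * t) ≤ 0 := by
        have : exp ((m - r) * t) * exp (r * t) = exp (m * t) := by rw [← exp_add]; ring_nf
        rw [sub_mul, mul_assoc, this]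
        exact e1.trans ((hlow t).trans e2)
      nlinarith [exp_pos (r * t)]
    have h1 : Tendsto (fun t => k' * exp ((m - r) * t)) atBot (𝓝 0) := by
      simpa using (tendsto_exp_mul_atBot (sub_pos.2 hm)).const_mul k'
    have := ge_of_tendsto h1 ((eventually_le_atBot 0).mono hle)
    linarith
  · rwa [h1] at htop

end

/-! ### Existence up to the critical case: letting the reaction rate tend to 1 -/

section
variable {b c h θ κ : ℝ}

lemma continuousOn_chi (hb0 : 0 ≤ b) (hb1 : b < 1) (hh : 0 ≤ h) :
    ContinuousOn (chi b c h κ) (Ici 0) := by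
  unfold chi
  refine ContinuousOn.add (by fun_prop) (ContinuousOn.div (by fun_prop) (by fun_prop) ?_)
  intro z hz
  have h1 : exp (-(z * h)) ≤ 1 :=
    exp_le_one_iff.2 (by have := mul_nonneg (mem_Ici.1 hz) hh; linarith)
  have h2 : b * exp (-(z * h)) ≤ b := mul_le_of_le_one_right hb0 h1
  linarith

/-- If `χ` is negative somewhere on the positive half-line, it has a positive zero followed by an
interval where it is negative. -/
lemma exists_chi_zero_neg (hb0 : 0 ≤ b) (hb1 : b < 1) (hh : 0 ≤ h) (hκ : 0 < κ) {z : ℝ}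
    (hz : 0 < z) (hχ : chi b c h κ z < 0) :
    ∃ r m, 0 < r ∧ r < m ∧ m ≤ 2 * r ∧ chi b c h κ r = 0 ∧ chi b c h κ m < 0 := by
  have hcont : ContinuousOn (chi b c h κ) (Icc 0 z) :=
    (continuousOn_chi hb0 hb1 hh).mono Icc_subset_Ici_self
  have h0 : 0 < chi b c h κ 0 := by
    have : 0 < κ / (1 - b) := div_pos hκ (by linarith)
    simpa [chi] using this
  have hcomp : IsCompact (Icc 0 z ∩ chi b c h κ ⁻¹' Ici 0) :=
    isCompact_Icc.of_isClosed_subset (hcont.preimage_isClosed_of_isClosed isClosed_Icc isClosed_Ici)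
      inter_subset_left
  -- The last point of [0, z] with χ ≥ 0: it must be a zero, and χ is negative from there up to z.
  obtain ⟨r, ⟨hr, hr0⟩, hrmax⟩ := hcomp.exists_isGreatest ⟨0, ⟨le_rfl, hz.le⟩, h0.le⟩
  have hneg : ∀ x, r < x → x ≤ z → chi b c h κ x < 0 := fun x hx hxz => by
    by_contra hcon
    have := hrmax ⟨⟨hr.1.trans hx.le, hxz⟩, not_lt.1 hcon⟩
    linarith
  have hrz : r < z := lt_of_le_of_ne hr.2 fun heq => by
    have h1 : 0 ≤ chi b c h κ r := hr0
    rw [heq] at h1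
    linarith
  have hzero : chi b c h κ r = 0 := by
    obtain ⟨x, hx, hx0⟩ := intermediate_value_Icc' hrz.le
      (hcont.mono (Icc_subset_Icc_left hr.1)) ⟨hχ.le, hr0⟩
    have : x ≤ r := hrmax ⟨⟨hr.1.trans hx.1, hx.2⟩, hx0.ge⟩
    rw [← le_antisymm this hx.1, hx0]
  have hrpos : 0 < r := lt_of_le_of_ne hr.1 fun heq => by
    rw [← heq] at hzero
    linarith
  -- The cap 2r is what the quadratic term in the lower solution tolerates.
  exact ⟨r, min z (2 * r), hrpos, lt_min hrz (by linarith), min_le_right _ _, hzero,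
    hneg _ (lt_min hrz (by linarith)) (min_le_left _ _)⟩

lemma IsIntegralFront.comp_add {φ : ℝ → ℝ} (hφ : IsIntegralFront b c h θ κ φ) (s : ℝ) :
    IsIntegralFront b c h θ κ fun t => φ (t + s) where
  unit := hφ.unit.comp_add s
  mono := fun x y hxy => hφ.mono (by linarith)
  eq t := by
    rw [green_comp_add, sub_add_eq_add_sub]
    exact hφ.eq (t + s)
  bot := hφ.bot.comp (tendsto_atBot_add_const_right _ s tendsto_id)
  top := hφ.top.comp (tendsto_atTop_add_const_right _ s tendsto_id)

lemma IsIntegralFront.lipschitz {φ : ℝ → ℝ} (H : StepParams b c h θ κ)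
    (hφ : IsIntegralFront b c h θ κ φ) (t s : ℝ) : |φ t - φ s| ≤ stepLip b c θ * |t - s| :=
  lipschitz_of_shift H hφ.unit hφ.unit.abs_le hφ.eq t s

lemma IsIntegralFront.exists_half {φ : ℝ → ℝ} (hφ : IsIntegralFront b c h θ κ φ) :
    ∃ t, φ t = 1 / 2 := by
  obtain ⟨s, hs⟩ := (hφ.bot.eventually (gt_mem_nhds (by norm_num : (0 : ℝ) < 1 / 2))).exists
  obtain ⟨t, ht⟩ := (hφ.top.eventually (lt_mem_nhds (by norm_num : (1 / 2 : ℝ) < 1))).exists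
  exact mem_range_of_exists_le_of_exists_ge hφ.unit.cont ⟨s, hs.le⟩ ⟨t, ht.le⟩

/-- A sequence of equi-Lipschitz functions with values in the unit interval has a pointwise
convergent subsequence. -/
lemma exists_subseq_tendsto {Φ : ℕ → ℝ → ℝ} {L : ℝ} (h0 : ∀ n t, 0 ≤ Φ n t)
    (h1 : ∀ n t, Φ n t ≤ 1) (hL : ∀ n t s, |Φ n t - Φ n s| ≤ L * |t - s|) :
    ∃ (k : ℕ → ℕ) (φ : ℝ → ℝ), StrictMono k ∧
      ∀ t, Tendsto (fun n => Φ (k n) t) atTop (𝓝 (φ t)) := by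
  have hL0 : 0 ≤ L := by
    have := (abs_nonneg _).trans (hL 0 1 0)
    simpa using this
  -- The product over the countable set ℚ is sequentially compact, which replaces a diagonal
  -- argument; equicontinuity then extends convergence to ℝ.
  have hcomp : IsCompact (univ.pi fun _ : ℚ => Icc (0 : ℝ) 1) :=
    isCompact_univ_pi fun _ => isCompact_Icc
  obtain ⟨ψ, -, k, hk, hψ⟩ := hcomp.tendsto_subseq (x := fun n (q : ℚ) => Φ n q)
    (fun n q _ => ⟨h0 n q, h1 n q⟩)
  have hq : ∀ q : ℚ, Tendsto (fun n => Φ (k n) q) atTop (𝓝 (ψ q)) := fun q =>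
    (tendsto_pi_nhds.1 hψ) q
  have hcauchy : ∀ t, ∃ x, Tendsto (fun n => Φ (k n) t) atTop (𝓝 x) := fun t => by
    refine cauchySeq_tendsto_of_complete (Metric.cauchySeq_iff'.2 fun ε hε => ?_)
    -- The denominator contains L + 1 rather than L because L may vanish.
    obtain ⟨q, hq1, hq2⟩ := exists_rat_btwn (show t < t + ε / (4 * (L + 1)) by
      have : 0 < ε / (4 * (L + 1)) := by positivity
      linarith)
    have hqt : L * |t - q| ≤ ε / 4 := by
      rw [abs_of_nonpos (by linarith)]
      have h2 : -(t - q) ≤ ε / (4 * (L + 1)) := by linarith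
      calc L * -(t - q) ≤ (L + 1) * (ε / (4 * (L + 1))) :=
            mul_le_mul (by linarith) h2 (by linarith) (by linarith)
        _ = ε / 4 := by field_simp
    obtain ⟨N, hN⟩ := Metric.cauchySeq_iff'.1 (hq q).cauchySeq (ε / 4) (by positivity)
    refine ⟨N, fun n hn => ?_⟩
    have e1 := hN n hn
    have e2 := abs_le.1 ((hL (k n) t q).trans hqt)
    have e3 := abs_le.1 ((hL (k N) t q).trans hqt)
    rw [Real.dist_eq, abs_lt] at *
    constructor <;> linarith [e1.1, e1.2]
  choose φ hφ using hcauchy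
  exact ⟨k, φ, hk, hφ⟩

/-- Existence of integral fronts, the critical case included. -/
theorem exists_integralFront (H : StepParams b c h θ 1) {z : ℝ} (hz : 0 < z)
    (hχ : chi b c h 1 z = 0) : ∃ φ, IsIntegralFront b c h θ 1 φ := by
  -- The summand 2 makes every rate positive, beginning with 1/2.
  let K : ℕ → ℝ := fun n => 1 - 1 / ((n : ℝ) + 2)
  have hK : ∀ n, 0 < K n ∧ K n < 1 := fun n => by
    have h1 : (0 : ℝ) < 1 / ((n : ℝ) + 2) := by positivity
    have h2 : 1 / ((n : ℝ) + 2) < 1 := by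
      rw [div_lt_one (by positivity)]
      linarith [(Nat.cast_nonneg n : (0 : ℝ) ≤ n)]
    exact ⟨by simp only [K]; linarith, by simp only [K]; linarith⟩
  have hK1 : Tendsto K atTop (𝓝 1) := by
    have h1 : Tendsto (fun n : ℕ => 1 / ((n : ℝ) + 2)) atTop (𝓝 0) :=
      tendsto_const_nhds.div_atTop
        (tendsto_atTop_add_const_right _ _ tendsto_natCast_atTop_atTop)
    have h2 := h1.const_sub 1
    rwa [sub_zero] at h2
  have HK : ∀ n, StepParams b c h θ (K n) := fun n =>
    { H with
      κ_pos := (hK n).1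
      κ_le_one := (hK n).2.le
      key := (mul_le_mul_of_nonneg_right (hK n).2.le (exp_pos _).le).trans H.key }
  have hex : ∀ n, ∃ φ, IsIntegralFront b c h θ (K n) φ ∧ φ 0 = 1 / 2 := fun n => by
    -- Lowering the reaction rate strictly lowers the characteristic function at z, so a double zero
    -- splits and the noncritical theorem applies.
    have hneg : chi b c h (K n) z < 0 := by
      have ha := one_sub_pos H hz.le
      have h1 : K n / (1 - b * exp (-(z * h))) < 1 / (1 - b * exp (-(z * h))) :=
        div_lt_div_of_pos_right (hK n).2 ha
      unfold chi at hχ ⊢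
      linarith
    obtain ⟨r, m, hr, hm, hm2, hχr, hχm⟩ :=
      exists_chi_zero_neg H.b_nonneg H.b_lt_one H.h_nonneg (hK n).1 hz hneg
    obtain ⟨φ, hφ⟩ := exists_integralFront_of_lt (HK n) hr hm hm2 hχr hχm
    obtain ⟨t, ht⟩ := hφ.exists_half
    exact ⟨fun s => φ (s + t), hφ.comp_add t, by simpa using ht⟩
  choose Φ hΦ hΦ0 using hex
  obtain ⟨k, φ, hk, hlim⟩ := exists_subseq_tendsto (fun n => (hΦ n).unit.nonneg)
    (fun n => (hΦ n).unit.le_one) (fun n => (hΦ n).lipschitz (HK n))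
  have hlip : ∀ t s, |φ t - φ s| ≤ stepLip b c θ * |t - s| := fun t s =>
    le_of_tendsto' ((hlim t).sub (hlim s)).abs fun n => (hΦ (k n)).lipschitz (HK _) t s
  have hcont : Continuous φ := by
    have hL : LipschitzWith (stepLip b c θ).toNNReal φ := LipschitzWith.of_dist_le_mul fun t s => by
      rw [Real.dist_eq, Real.dist_eq]
      exact (hlip t s).trans (mul_le_mul_of_nonneg_right (Real.le_coe_toNNReal _) (abs_nonneg _))
    exact hL.continuous
  have hU : UnitFun φ := ⟨hcont,
    fun t => ge_of_tendsto' (hlim t) fun n => (hΦ (k n)).unit.nonneg t,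
    fun t => le_of_tendsto' (hlim t) fun n => (hΦ (k n)).unit.le_one t⟩
  have hmono : Monotone φ := fun s t hst =>
    le_of_tendsto_of_tendsto' (hlim s) (hlim t) fun n => (hΦ (k n)).mono hst
  have hhalf : φ 0 = 1 / 2 :=
    tendsto_nhds_unique (hlim 0) (by simp only [hΦ0]; exact tendsto_const_nhds)
  have heq : ∀ t, φ t - b * φ (t - h) = green b c h θ 1 φ t := fun t => by
    have h1 : Tendsto (fun n => green b c h θ (K (k n)) (Φ (k n)) t) atTop
        (𝓝 (green b c h θ 1 φ t)) :=
      tendsto_green (T := fun _ => t) (fun n => HK _) (fun n => (hΦ (k n)).unit)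
        (hK1.comp hk.tendsto_atTop) (fun σ => hlim _) 0
    refine tendsto_nhds_unique ((hlim t).sub ((hlim (t - h)).const_mul b))
      (h1.congr fun n => ((hΦ (k n)).eq t).symm)
  have hba : BddAbove (range φ) := ⟨1, by rintro _ ⟨t, rfl⟩; exact hU.le_one t⟩
  have hbb : BddBelow (range φ) := ⟨0, by rintro _ ⟨t, rfl⟩; exact hU.nonneg t⟩
  have htop := tendsto_atTop_ciSup hmono hba
  have hbot := tendsto_atBot_ciInf hmono hbb
  -- Both limits are equilibria; by monotonicity, the value 1/2 at the origin leaves only 0 on the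
  -- left and 1 on the right.
  refine ⟨φ, hU, hmono, heq, ?_, ?_⟩
  · rcases limit_eq_zero_or_one H hU heq (fun σ => tendsto_atBot_add_const_right _ σ tendsto_id)
      hbot with h0 | h1
    · rwa [h0] at hbot
    · have := ciInf_le hbb 0
      linarith
  · rcases limit_eq_zero_or_one H hU heq (fun σ => tendsto_atTop_add_const_right _ σ tendsto_id)
      htop with h0 | h1
    · have := le_ciSup hba 0
      linarith
    · rwa [h1] at htop

end

/-! ### Wave profiles -/

/-- Monotone wave profiles, with `h = c τ`. -/
structure IsProfile (b c h : ℝ) (φ : ℝ → ℝ) : Prop where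
  mono : Monotone φ
  bot : Tendsto φ atBot (𝓝 0)
  top : Tendsto φ atTop (𝓝 1)
  contDiff : ContDiff ℝ 2 fun r => φ r - b * φ (r - h)
  eq : ∀ r, deriv (deriv fun r => φ r - b * φ (r - h)) r
    - c * deriv (fun r => φ r - b * φ (r - h)) r + φ r * (1 - φ (r - h)) = 0

lemma isMonotoneTravelingFront_iff (b τ c : ℝ) (u : ℝ → ℝ → ℝ) :
    IsMonotoneTravelingFront b τ c u ↔
      ∃ φ, IsProfile b c (c * τ) φ ∧ ∀ t x, u t x = φ (x + c * t) := by
  constructor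
  · rintro ⟨hsol, φ, hu, hmono, hcd, hbot, htop⟩
    obtain rfl : u = fun t x => φ (x + c * t) := funext fun t => funext fun x => hu t x
    exact ⟨φ, ⟨hmono, hbot, htop, hcd,
      (isNeutralKPPFisherSolution_iff_profile b τ c φ hcd).1 hsol⟩, hu⟩
  · rintro ⟨φ, hφ, hu⟩
    obtain rfl : u = fun t x => φ (x + c * t) := funext fun t => funext fun x => hu t x
    exact ⟨(isNeutralKPPFisherSolution_iff_profile b τ c φ hφ.contDiff).2 hφ.eq, φ, hu,
      hφ.mono, hφ.contDiff, hφ.bot, hφ.top⟩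

/-- With w = v' + θv and w' = (c + θ)w - source, eliminating w restores the second-order equation,
and the added term θ(c + θ)v cancels. -/
lemma IsIntegralFront.isProfile {b c h θ : ℝ} {φ : ℝ → ℝ} (H : StepParams b c h θ 1)
    (hφ : IsIntegralFront b c h θ 1 φ) : IsProfile b c h φ := by
  set w := fwd (c + θ) (source b c h θ 1 φ) with hw
  have hv : (fun r => φ r - b * φ (r - h)) = green b c h θ 1 φ := funext hφ.eq
  have hd1 := hasDerivAt_green H hφ.unit
  have hdv : deriv (green b c h θ 1 φ) = fun t => w t - θ * green b c h θ 1 φ t :=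
    funext fun t => (hd1 t).deriv
  have hd2 : ∀ t, HasDerivAt (fun t => w t - θ * green b c h θ 1 φ t)
      (((c + θ) * w t - source b c h θ 1 φ t) - θ * (w t - θ * green b c h θ 1 φ t)) t := fun t =>
    (hasDerivAt_fwd_source H hφ.unit t).sub ((hd1 t).const_mul θ)
  have hddv : deriv (fun t => w t - θ * green b c h θ 1 φ t) = fun t =>
      ((c + θ) * w t - source b c h θ 1 φ t) - θ * (w t - θ * green b c h θ 1 φ t) :=
    funext fun t => (hd2 t).deriv
  refine ⟨hφ.mono, hφ.bot, hφ.top, ?_, fun r => ?_⟩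
  · rw [hv, show (2 : WithTop ℕ∞) = 1 + 1 by norm_num, contDiff_succ_iff_deriv]
    refine ⟨fun t => (hd1 t).differentiableAt, by simp, ?_⟩
    rw [hdv, contDiff_one_iff_deriv, hddv]
    refine ⟨fun t => (hd2 t).differentiableAt, ?_⟩
    have h1 : Continuous w := continuous_fwd_source H hφ.unit
    have h2 := continuous_source (b := b) (c := c) (h := h) (θ := θ) (κ := 1) hφ.unit
    have h3 := continuous_green H hφ.unit
    fun_prop
  · rw [hv, hdv, hddv]
    have := hφ.eq r
    dsimp only
    rw [← this, source]
    ring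

/-! ### Basic properties of monotone profiles -/

/-- A monotone profile `φ` together with its derivative `φ'`, its neutral part `v` and the
derivative `v'` of the latter, and elementary bounds. -/
structure Front (b c h : ℝ) (φ φ' v v' : ℝ → ℝ) : Prop where
  b_nonneg : 0 ≤ b
  b_lt_one : b < 1
  c_pos : 0 < c
  h_nonneg : 0 ≤ h
  mono : Monotone φ
  bot : Tendsto φ atBot (𝓝 0)
  top : Tendsto φ atTop (𝓝 1)
  v_eq : ∀ t, v t = φ t - b * φ (t - h)
  v'_eq : ∀ t, v' t = φ' t - b * φ' (t - h)
  hasDerivAt_φ : ∀ t, HasDerivAt φ (φ' t) t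
  hasDerivAt_v : ∀ t, HasDerivAt v (v' t) t
  hasDerivAt_v' : ∀ t, HasDerivAt v' (c * v' t - φ t * (1 - φ (t - h))) t
  le_one : ∀ t, φ t ≤ 1
  v_pos : ∀ t, 0 < v t
  v'_nonneg : ∀ t, 0 ≤ v' t
  v'_le : ∀ t, v' t ≤ c * v t

/-- The signs follow from boundedness of v. Since e^{-ct} v' is nonincreasing, a negative value of
v' would send v to -∞ at +∞. Since v' - cv is nonincreasing, a positive value of it would send v to
-∞ at -∞. Then e^{-ct} v is nonincreasing, and v > 0 spreads leftwards from large t. -/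
lemma IsProfile.exists_front {b c h : ℝ} (hb0 : 0 ≤ b) (hb1 : b < 1) (hc : 0 < c) (hh : 0 ≤ h)
    {φ : ℝ → ℝ} (hφ : IsProfile b c h φ) : ∃ φ' v v', Front b c h φ φ' v v' := by
  have h0 : ∀ t, 0 ≤ φ t := fun t => hφ.mono.le_of_tendsto hφ.bot t
  have h1 : ∀ t, φ t ≤ 1 := fun t => hφ.mono.ge_of_tendsto hφ.top t
  have habs : ∀ t, |φ t| ≤ 1 := fun t => by rw [abs_of_nonneg (h0 t)]; exact h1 t
  set v : ℝ → ℝ := fun r => φ r - b * φ (r - h) with hv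
  have hd1 : ∀ t, HasDerivAt v (deriv v t) t := fun t =>
    (hφ.contDiff.differentiable (by norm_num) t).hasDerivAt
  have hd2 : ∀ t, HasDerivAt (deriv v) (c * deriv v t - φ t * (1 - φ (t - h))) t := fun t => by
    have hcd : ContDiff ℝ 1 (deriv v) := by
      have := hφ.contDiff
      rw [show (2 : WithTop ℕ∞) = 1 + 1 by norm_num, contDiff_succ_iff_deriv] at this
      exact this.2.2
    have h2 := (hcd.differentiable (by norm_num) t).hasDerivAt
    refine h2.congr_deriv ?_
    linarith [hφ.eq t]
  have hf0 : ∀ t, 0 ≤ φ t * (1 - φ (t - h)) := fun t => mul_nonneg (h0 t) (by linarith [h1 (t - h)])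
  have hvge : ∀ t, (1 - b) * φ t ≤ v t := fun t => by
    have := mul_le_mul_of_nonneg_left (hφ.mono (show t - h ≤ t by linarith)) hb0
    simp only [hv]
    linarith
  have hvnn : ∀ t, 0 ≤ v t := fun t =>
    (mul_nonneg (by linarith) (h0 t)).trans (hvge t)
  have hvle : ∀ t, v t ≤ 1 := fun t => by
    have := mul_nonneg hb0 (h0 (t - h))
    have := h1 t
    simp only [hv]
    linarith
  have hv'nn : ∀ t, 0 ≤ deriv v t := by
    intro t
    by_contra hneg
    push Not at hneg
    have hanti : Antitone fun s => exp (-c * s) * deriv v s :=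
      antitone_of_hasDerivAt_nonpos' (fun s => hasDerivAt_exp_mul_mul (-c) (hd2 s)) fun s =>
        mul_nonpos_of_nonneg_of_nonpos (exp_pos _).le (by linarith [hf0 s])
    have hle : ∀ s, t ≤ s → deriv v s ≤ deriv v t := fun s hs => by
      have e1 : exp (-c * s) * deriv v s ≤ exp (-c * t) * deriv v t := hanti hs
      have e2 : exp (-c * s) ≤ exp (-c * t) := exp_le_exp.2 (by nlinarith)
      have e3 : exp (-c * t) * deriv v t ≤ exp (-c * s) * deriv v t :=
        mul_le_mul_of_nonpos_right e2 hneg.le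
      exact le_of_mul_le_mul_left (e1.trans e3) (exp_pos _)
    have hanti2 : AntitoneOn (fun s => v s - deriv v t * s) (Ici t) :=
      antitoneOn_of_hasDerivAt_nonpos (convex_Ici t)
        (fun s _ => (hd1 s).sub ((hasDerivAt_id s).const_mul (deriv v t)))
        fun s hs => by have := hle s hs; simp only [mul_one]; linarith
    have hs : t ≤ t + (v t + 1) / (-deriv v t) := by
      have : 0 ≤ (v t + 1) / (-deriv v t) := div_nonneg (by linarith [hvnn t]) (by linarith)
      linarith
    have e1 := hanti2 (mem_Ici.2 le_rfl) (mem_Ici.2 hs) hs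
    have e2 : deriv v t * ((v t + 1) / (-deriv v t)) = -(v t + 1) := by
      have := hneg.ne
      field_simp
    have e3 := hvnn (t + (v t + 1) / (-deriv v t))
    dsimp only at e1
    rw [mul_add, e2] at e1
    linarith
  have hv'le : ∀ t, deriv v t ≤ c * v t := by
    intro t
    by_contra hneg
    push Not at hneg
    set ε := deriv v t - c * v t with hε
    have hε0 : 0 < ε := by linarith
    have hanti : Antitone fun s => deriv v s - c * v s :=
      antitone_of_hasDerivAt_nonpos' (fun s => (hd2 s).sub ((hd1 s).const_mul c)) fun s => by
        linarith [hf0 s]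
    have hmono : MonotoneOn (fun s => v s - ε * s) (Iic t) :=
      monotoneOn_of_hasDerivAt_nonneg (convex_Iic t)
        (fun s _ => (hd1 s).sub ((hasDerivAt_id s).const_mul ε))
        fun s hs => by
          have e1 : ε ≤ deriv v s - c * v s := hanti hs
          have := mul_nonneg hc.le (hvnn s)
          simp only [mul_one]
          linarith
    have hs : t - 2 / ε ≤ t := by
      have : 0 ≤ 2 / ε := by positivity
      linarith
    have e1 := hmono (mem_Iic.2 hs) (mem_Iic.2 le_rfl) hs
    have e2 : ε * (2 / ε) = 2 := by field_simp
    have e3 := hvnn (t - 2 / ε)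
    have e4 := hvle t
    dsimp only at e1
    rw [mul_sub, e2] at e1
    linarith
  have hvpos : ∀ t, 0 < v t := by
    intro t
    obtain ⟨s, hs1, hs2⟩ := ((hφ.top.eventually (lt_mem_nhds zero_lt_one)).and
      (eventually_ge_atTop t)).exists
    have hs3 : 0 < v s := (mul_pos (by linarith) hs1).trans_le (hvge s)
    have hanti : Antitone fun s => exp (-c * s) * v s :=
      antitone_of_hasDerivAt_nonpos' (fun s => hasDerivAt_exp_mul_mul (-c) (hd1 s)) fun s =>
        mul_nonpos_of_nonneg_of_nonpos (exp_pos _).le (by linarith [hv'le s])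
    have e1 : exp (-c * s) * v s ≤ exp (-c * t) * v t := hanti hs2
    exact pos_of_mul_pos_right ((mul_pos (exp_pos _) hs3).trans_le e1) (exp_pos _).le
  have hvb : ∀ t, |v t| ≤ 1 := fun t => by rw [abs_of_nonneg (hvnn t)]; exact hvle t
  have hv'b : ∀ t, |deriv v t| ≤ c := fun t => by
    rw [abs_of_nonneg (hv'nn t)]
    exact (hv'le t).trans (mul_le_of_le_one_right hc.le (hvle t))
  have hφn : φ = neumann b h v := eq_neumann hb0 hb1 habs fun t => rfl
  exact ⟨neumann b h (deriv v), v, deriv v, hb0, hb1, hc, hh, hφ.mono, hφ.bot, hφ.top, fun _ => rfl,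
    fun t => (neumann_eq hb0 hb1 hv'b t).symm,
    fun t => by
      have := hasDerivAt_neumann (h := h) hb0 hb1 hvb hv'b hd1 t
      rwa [← hφn] at this,
    hd1, hd2, h1, hvpos, hv'nn, hv'le⟩

namespace Front
variable {b c h : ℝ} {φ φ' v v' : ℝ → ℝ}

lemma one_sub_b_pos (F : Front b c h φ φ' v v') : 0 < 1 - b := by linarith [F.b_lt_one]

lemma nonneg (F : Front b c h φ φ' v v') (t : ℝ) : 0 ≤ φ t := F.mono.le_of_tendsto F.bot t

lemma shift_le (F : Front b c h φ φ' v v') (t : ℝ) : φ (t - h) ≤ φ t :=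
  F.mono (by linarith [F.h_nonneg])

lemma mul_le_v (F : Front b c h φ φ' v v') (t : ℝ) : (1 - b) * φ t ≤ v t := by
  have := mul_le_mul_of_nonneg_left (F.shift_le t) F.b_nonneg
  rw [F.v_eq]
  linarith

lemma v_le (F : Front b c h φ φ' v v') (t : ℝ) : v t ≤ φ t := by
  have := mul_nonneg F.b_nonneg (F.nonneg (t - h))
  rw [F.v_eq]
  linarith

lemma pos (F : Front b c h φ φ' v v') (t : ℝ) : 0 < φ t := (F.v_pos t).trans_le (F.v_le t)

lemma φ_le (F : Front b c h φ φ' v v') (t : ℝ) : φ t ≤ v t / (1 - b) := by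
  rw [le_div_iff₀ F.one_sub_b_pos]
  linarith [F.mul_le_v t]

lemma v_le_one (F : Front b c h φ φ' v v') (t : ℝ) : v t ≤ 1 := (F.v_le t).trans (F.le_one t)

lemma v'_le_const (F : Front b c h φ φ' v v') (t : ℝ) : v' t ≤ c :=
  (F.v'_le t).trans (mul_le_of_le_one_right F.c_pos.le (F.v_le_one t))

lemma φ'_nonneg (F : Front b c h φ φ' v v') (t : ℝ) : 0 ≤ φ' t := by
  have := (F.hasDerivAt_φ t).deriv
  rw [← this]
  exact F.mono.deriv_nonneg

lemma continuous (F : Front b c h φ φ' v v') : Continuous φ :=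
  continuous_iff_continuousAt.2 fun t => (F.hasDerivAt_φ t).continuousAt

lemma continuous_v (F : Front b c h φ φ' v v') : Continuous v :=
  continuous_iff_continuousAt.2 fun t => (F.hasDerivAt_v t).continuousAt

lemma v_bot (F : Front b c h φ φ' v v') : Tendsto v atBot (𝓝 0) :=
  tendsto_of_tendsto_of_tendsto_of_le_of_le tendsto_const_nhds F.bot (fun t => (F.v_pos t).le) F.v_le

/-- If `v' ≤ Λ v` then `φ' ≤ Λ φ`. -/
lemma φ'_le (F : Front b c h φ φ' v v') {Λ : ℝ} (hΛ : ∀ t, v' t ≤ Λ * v t) (hΛ0 : 0 ≤ Λ)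
    {C : ℝ} (hC : ∀ t, φ' t ≤ C) (t : ℝ) : φ' t ≤ Λ * φ t := by
  have := nonneg_of_shift F.b_nonneg F.b_lt_one (h := h) (C := C)
    (D := fun t => Λ * φ t - φ' t) (fun t => ?_) (fun t => ?_) t
  · linarith
  · have := hC t
    have := mul_nonneg hΛ0 (F.nonneg t)
    linarith
  · have := hΛ t
    rw [F.v_eq, F.v'_eq] at this
    linarith

lemma φ'_le_const (F : Front b c h φ φ' v v') : ∃ C, ∀ t, φ' t ≤ C := by
  have hv'b : ∀ t, |v' t| ≤ c := fun t => by
    rw [abs_of_nonneg (F.v'_nonneg t)]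
    exact F.v'_le_const t
  have hvb : ∀ t, |v t| ≤ 1 := fun t => by
    rw [abs_of_nonneg (F.v_pos t).le]
    exact F.v_le_one t
  have hφn : φ = neumann b h v := eq_neumann F.b_nonneg F.b_lt_one (C := 1)
    (fun t => by rw [abs_of_nonneg (F.nonneg t)]; exact F.le_one t) fun t => (F.v_eq t).symm
  refine ⟨c / (1 - b), fun t => ?_⟩
  have h1 := hasDerivAt_neumann (h := h) F.b_nonneg F.b_lt_one hvb hv'b F.hasDerivAt_v t
  rw [← hφn] at h1
  rw [(F.hasDerivAt_φ t).unique h1]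
  exact (abs_le.1 (abs_neumann_le F.b_nonneg F.b_lt_one hv'b t)).2

end Front

/-- The integral over a moving window. -/
lemma hasDerivAt_window {k : ℝ → ℝ} (hk : Continuous k) (h t : ℝ) :
    HasDerivAt (fun t => ∫ s in (t - h)..t, k s) (k t - k (t - h)) t := by
  have h1 : (fun t => ∫ s in (t - h)..t, k s) =
      fun t => (∫ s in (0 : ℝ)..t, k s) - ∫ s in (0 : ℝ)..(t - h), k s := funext fun t =>
    (intervalIntegral.integral_interval_sub_left (hk.intervalIntegrable _ _)
      (hk.intervalIntegrable _ _)).symm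
  rw [h1]
  exact (hk.integral_hasStrictDerivAt 0 t).hasDerivAt.sub
    (hasDerivAt_shift (hk.integral_hasStrictDerivAt 0 (t - h)).hasDerivAt)

lemma window_le {k : ℝ → ℝ} {h t M : ℝ} (hk : Continuous k) (hh : 0 ≤ h)
    (hM : ∀ s, t - h ≤ s → s ≤ t → k s ≤ M) : ∫ s in (t - h)..t, k s ≤ h * M := by
  have := intervalIntegral.integral_mono_on (μ := volume) (f := k) (g := fun _ => M)
    (show t - h ≤ t by linarith) (hk.intervalIntegrable _ _) (by simp)
    fun s hs => hM s hs.1 hs.2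
  simpa using this

lemma le_window {k : ℝ → ℝ} {h t M : ℝ} (hk : Continuous k) (hh : 0 ≤ h)
    (hM : ∀ s, t - h ≤ s → s ≤ t → M ≤ k s) : h * M ≤ ∫ s in (t - h)..t, k s := by
  have := intervalIntegral.integral_mono_on (μ := volume) (g := k) (f := fun _ => M)
    (show t - h ≤ t by linarith) (by simp) (hk.intervalIntegrable _ _)
    fun s hs => hM s hs.1 hs.2
  simpa using this

/-- The fractional term is convex, by the arithmetic-geometric mean inequality for the exponential
and the convexity of 1/x; the strictness comes from z². -/
lemma chi_midpoint_lt {b c h x y : ℝ} (hb0 : 0 ≤ b) (hx : 0 < 1 - b * exp (-(x * h)))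
    (hy : 0 < 1 - b * exp (-(y * h))) (hxy : x ≠ y) :
    chi b c h 1 ((x + y) / 2) < (chi b c h 1 x + chi b c h 1 y) / 2 := by
  set X := exp (-(x * h) / 2) with hX
  set Y := exp (-(y * h) / 2) with hY
  have e1 : exp (-(x * h)) = X * X := by rw [hX, ← exp_add]; ring_nf
  have e2 : exp (-(y * h)) = Y * Y := by rw [hY, ← exp_add]; ring_nf
  have e3 : exp (-((x + y) / 2 * h)) = X * Y := by rw [hX, hY, ← exp_add]; ring_nf
  unfold chi
  rw [e1] at hx ⊢
  rw [e2] at hy ⊢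
  rw [e3]
  have hbXY : b * (X * Y) ≤ b * ((X * X + Y * Y) / 2) :=
    mul_le_mul_of_nonneg_left (by nlinarith [sq_nonneg (X - Y)]) hb0
  have hm : 0 < ((1 - b * (X * X)) + (1 - b * (Y * Y))) / 2 := by linarith
  have h1 : 1 / (1 - b * (X * Y)) ≤ 1 / (((1 - b * (X * X)) + (1 - b * (Y * Y))) / 2) :=
    one_div_le_one_div_of_le hm (by linarith)
  have h2 : 1 / (((1 - b * (X * X)) + (1 - b * (Y * Y))) / 2) ≤
      (1 / (1 - b * (X * X)) + 1 / (1 - b * (Y * Y))) / 2 := by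
    set A := 1 - b * (X * X)
    set B := 1 - b * (Y * Y)
    rw [div_add_div _ _ hx.ne' hy.ne', div_div, div_le_div_iff₀ hm (by positivity)]
    nlinarith [sq_nonneg (A - B)]
  have h3 : 0 < (x - y) ^ 2 := by
    have := sub_ne_zero.2 hxy
    positivity
  nlinarith

/-! ### The flux and the sharp bound for the logarithmic derivative -/

namespace Front
variable {b c h : ℝ} {φ φ' v v' : ℝ → ℝ}

lemma one_sub_pos (F : Front b c h φ φ' v v') {r : ℝ} (hr : 0 ≤ r) :
    0 < 1 - b * exp (-(r * h)) := by
  have h1 : exp (-(r * h)) ≤ 1 := exp_le_one_iff.2 (by have := mul_nonneg hr F.h_nonneg; linarith)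
  have h2 : b * exp (-(r * h)) ≤ b := mul_le_of_le_one_right F.b_nonneg h1
  linarith [F.b_lt_one]

/-- The flux associated with the exponent `r`. -/
def flux (b c h : ℝ) (φ v v' : ℝ → ℝ) (r t : ℝ) : ℝ :=
  exp (-r * t) * (v' t - (c - r) * v t) -
    b * exp (-(r * h)) / (1 - b * exp (-(r * h))) * ∫ s in (t - h)..t, exp (-r * s) * φ s

/-- Let β = b e^{-rh}. Differentiating the window integral, with prefactor β/(1 - β), turns the
linear term -φ into -v/(1 - β), which completes -χ(r)v; only the quadratic part of the reaction
survives. -/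
lemma hasDerivAt_flux (F : Front b c h φ φ' v v') {r : ℝ} (hr : 0 ≤ r) (t : ℝ) :
    HasDerivAt (flux b c h φ v v' r)
      (exp (-r * t) * (φ t * φ (t - h) - chi b c h 1 r * v t)) t := by
  have ha := F.one_sub_pos hr
  have hc := F.continuous
  have h1 := (hasDerivAt_exp_mul_mul (-r) ((F.hasDerivAt_v' t).sub
    ((F.hasDerivAt_v t).const_mul (c - r)))).sub
    ((hasDerivAt_window (k := fun s => exp (-r * s) * φ s) (by fun_prop) h t).const_mul
      (b * exp (-(r * h)) / (1 - b * exp (-(r * h)))))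
  refine h1.congr_deriv ?_
  have e1 : exp (-(r * h)) * exp (-r * (t - h)) = exp (-r * t) := by rw [← exp_add]; ring_nf
  have e2 : b * φ (t - h) = φ t - v t := by rw [F.v_eq]; ring
  set β := exp (-(r * h)) with hβ
  unfold chi
  rw [← hβ]
  have e3 : b * β / (1 - b * β) * (exp (-r * t) * φ t - exp (-r * (t - h)) * φ (t - h)) =
      exp (-r * t) * ((b * β * φ t - (φ t - v t)) / (1 - b * β)) := by
    rw [div_mul_eq_mul_div, ← mul_div_assoc]
    congr 1
    linear_combination (-b * φ (t - h)) * e1 - exp (-r * t) * e2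
  rw [e3]
  simp only [Pi.sub_apply]
  field_simp
  ring

lemma tendsto_flux (F : Front b c h φ φ' v v') {r : ℝ} (hr : 0 < r) :
    Tendsto (flux b c h φ v v' r) atTop (𝓝 0) := by
  have ha := F.one_sub_pos hr.le
  have hc := F.continuous
  set α := b * exp (-(r * h)) / (1 - b * exp (-(r * h))) with hα
  have hα0 : 0 ≤ α := div_nonneg (mul_nonneg F.b_nonneg (exp_pos _).le) ha.le
  set K := c + |c - r| + α * (h * exp (r * h)) with hK
  refine squeeze_zero_norm (a := fun t => exp (-r * t) * K) (fun t => ?_) ?_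
  · have e1 : |v' t - (c - r) * v t| ≤ c + |c - r| := by
      refine (abs_sub _ _).trans (add_le_add ?_ ?_)
      · rw [abs_of_nonneg (F.v'_nonneg t)]
        exact F.v'_le_const t
      · rw [abs_mul, abs_of_pos (F.v_pos t)]
        exact mul_le_of_le_one_right (abs_nonneg _) (F.v_le_one t)
    have e2 : 0 ≤ ∫ s in (t - h)..t, exp (-r * s) * φ s :=
      intervalIntegral.integral_nonneg (by linarith [F.h_nonneg])
        fun s _ => mul_nonneg (exp_pos _).le (F.nonneg s)
    have e3 : ∫ s in (t - h)..t, exp (-r * s) * φ s ≤ h * (exp (r * h) * exp (-r * t)) := by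
      refine window_le (by fun_prop) F.h_nonneg fun s hs _ => ?_
      have : exp (-r * s) ≤ exp (r * h) * exp (-r * t) := by
        rw [← exp_add, exp_le_exp]
        nlinarith
      exact (mul_le_of_le_one_right (exp_pos _).le (F.le_one s)).trans this
    rw [Real.norm_eq_abs]
    calc |flux b c h φ v v' r t| ≤ |exp (-r * t) * (v' t - (c - r) * v t)| +
          |α * ∫ s in (t - h)..t, exp (-r * s) * φ s| := abs_sub _ _
      _ ≤ exp (-r * t) * (c + |c - r|) + α * (h * (exp (r * h) * exp (-r * t))) := by
        rw [abs_mul, abs_of_pos (exp_pos _), abs_mul, abs_of_nonneg hα0, abs_of_nonneg e2]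
        exact add_le_add (mul_le_mul_of_nonneg_left e1 (exp_pos _).le)
          (mul_le_mul_of_nonneg_left e3 hα0)
      _ = exp (-r * t) * K := by rw [hK]; ring
  · simpa using (tendsto_exp_neg_mul_atTop hr).mul_const K

/-- For χ(r) ≤ 0 the flux is nondecreasing, and it vanishes at +∞. -/
lemma flux_nonpos (F : Front b c h φ φ' v v') {r : ℝ} (hr : 0 < r) (hχ : chi b c h 1 r ≤ 0)
    (t : ℝ) : flux b c h φ v v' r t ≤ 0 := by
  refine Monotone.ge_of_tendsto ?_ (F.tendsto_flux hr) t
  refine monotone_of_hasDerivAt_nonneg' (F.hasDerivAt_flux hr.le) fun t => ?_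
  refine mul_nonneg (exp_pos _).le ?_
  have := mul_nonneg (F.nonneg t) (F.nonneg (t - h))
  have := mul_nonneg (neg_nonneg.2 hχ) (F.v_pos t).le
  linarith

section growth
variable {Λ : ℝ}

/-- If `v' ≤ Λ v` then `Λ v - v'` is nondecreasing. -/
lemma monotone_defect (F : Front b c h φ φ' v v') (hΛ : ∀ t, v' t ≤ Λ * v t) (hΛ0 : 0 ≤ Λ) :
    Monotone fun t => Λ * v t - v' t := by
  obtain ⟨C, hC⟩ := F.φ'_le_const
  have hg := F.φ'_le hΛ hΛ0 hC
  have hz : ∀ t, HasDerivAt (fun t => (Λ - c) * v' t + φ t * (1 - φ (t - h)))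
      ((Λ - c) * (c * v' t - φ t * (1 - φ (t - h))) +
        (φ' t * (1 - φ (t - h)) + φ t * (-φ' (t - h)))) t := fun t =>
    ((F.hasDerivAt_v' t).const_mul _).add ((F.hasDerivAt_φ t).mul
      ((hasDerivAt_shift (F.hasDerivAt_φ (t - h))).const_sub 1))
  -- The bracket is the derivative of the defect Λv - v'. With f = φ(1 - φ(· - h)), the weighted
  -- bracket has derivative e^{-ct}(f' - Λf) ≤ 0 and limit 0 at +∞, so it is nonnegative.
  have hanti : Antitone fun t => exp (-c * t) * ((Λ - c) * v' t + φ t * (1 - φ (t - h))) := by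
    refine antitone_of_hasDerivAt_nonpos' (fun t => hasDerivAt_exp_mul_mul (-c) (hz t))
      fun t => mul_nonpos_of_nonneg_of_nonpos (exp_pos _).le ?_
    have h1 : 0 ≤ (Λ * φ t - φ' t) * (1 - φ (t - h)) :=
      mul_nonneg (by linarith [hg t]) (by linarith [F.le_one (t - h)])
    have h2 : 0 ≤ φ t * φ' (t - h) := mul_nonneg (F.nonneg t) (F.φ'_nonneg _)
    nlinarith
  have hlim : Tendsto (fun t => exp (-c * t) * ((Λ - c) * v' t + φ t * (1 - φ (t - h)))) atTop
      (𝓝 0) := by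
    refine squeeze_zero_norm (a := fun t => exp (-c * t) * (|Λ - c| * c + 1)) (fun t => ?_) ?_
    · rw [norm_mul, Real.norm_of_nonneg (exp_pos _).le]
      refine mul_le_mul_of_nonneg_left ((norm_add_le _ _).trans (add_le_add ?_ ?_)) (exp_pos _).le
      · rw [norm_mul, Real.norm_of_nonneg (F.v'_nonneg t)]
        exact mul_le_mul_of_nonneg_left (F.v'_le_const t) (abs_nonneg _)
      · have h1 : 0 ≤ 1 - φ (t - h) := by linarith [F.le_one (t - h)]
        rw [Real.norm_of_nonneg (mul_nonneg (F.nonneg t) h1)]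
        exact mul_le_one₀ (F.le_one t) h1 (by linarith [F.nonneg (t - h)])
    · simpa using (tendsto_exp_neg_mul_atTop F.c_pos).mul_const (|Λ - c| * c + 1)
  refine monotone_of_hasDerivAt_nonneg' (fun t => ((F.hasDerivAt_v t).const_mul Λ).sub
    (F.hasDerivAt_v' t)) fun t => ?_
  have := nonneg_of_mul_nonneg_right (hanti.le_of_tendsto hlim t) (exp_pos _)
  linarith

lemma monotone_defect_φ (F : Front b c h φ φ' v v') (hΛ : ∀ t, v' t ≤ Λ * v t) (hΛ0 : 0 ≤ Λ) :
    Monotone fun t => Λ * φ t - φ' t := by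
  obtain ⟨C, hC⟩ := F.φ'_le_const
  have hg := F.φ'_le hΛ hΛ0 hC
  have hm := F.monotone_defect hΛ hΛ0
  intro t₀ t₁ h01
  have := nonneg_of_shift F.b_nonneg F.b_lt_one (h := h) (C := Λ)
    (D := fun t => (Λ * φ (t + (t₁ - t₀)) - φ' (t + (t₁ - t₀))) - (Λ * φ t - φ' t))
    (fun t => ?_) (fun t => ?_) t₀
  · simp only [add_sub_cancel] at this
    dsimp only
    linarith
  · have := hg (t + (t₁ - t₀))
    have := F.φ'_nonneg t
    have := mul_le_of_le_one_right hΛ0 (F.le_one t)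
    linarith
  · have h1 : Λ * v t - v' t ≤ Λ * v (t + (t₁ - t₀)) - v' (t + (t₁ - t₀)) :=
      hm (by linarith)
    rw [F.v_eq, F.v_eq, F.v'_eq, F.v'_eq] at h1
    rw [show t - h + (t₁ - t₀) = t + (t₁ - t₀) - h by ring]
    linarith

/-- Monotonicity of the defect g of φ gives (1 - b) g(t) ≤ g(t) - b g(t - h). -/
lemma defect_φ_le (F : Front b c h φ φ' v v') (hΛ : ∀ t, v' t ≤ Λ * v t) (hΛ0 : 0 ≤ Λ) (t : ℝ) :
    Λ * φ t - φ' t ≤ (Λ * v t - v' t) / (1 - b) := by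
  have h1 : Λ * φ (t - h) - φ' (t - h) ≤ Λ * φ t - φ' t :=
    F.monotone_defect_φ hΛ hΛ0 (by linarith [F.h_nonneg])
  have h2 := mul_le_mul_of_nonneg_left h1 F.b_nonneg
  rw [le_div_iff₀ F.one_sub_b_pos, F.v_eq, F.v'_eq]
  linarith

/-- Variation of constants for φ' = Λφ - g, where the nondecreasing g is bounded by its value at the
right end t. Thus φ is a pure exponential backwards in time, up to a multiple of the defect. -/
lemma φ_le_exp (F : Front b c h φ φ' v v') (hΛ : ∀ t, v' t ≤ Λ * v t) (hΛ0 : 0 ≤ Λ) {s t : ℝ}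
    (hst : s ≤ t) : φ s ≤ exp (-(Λ * (t - s))) * φ t + (t - s) * (Λ * φ t - φ' t) := by
  obtain ⟨C, hC⟩ := F.φ'_le_const
  have hg := F.φ'_le hΛ hΛ0 hC
  have hmono : MonotoneOn (fun r => exp (-Λ * r) * φ r +
      exp (-Λ * s) * (Λ * φ t - φ' t) * r) (Icc s t) := by
    refine monotoneOn_of_hasDerivAt_nonneg (convex_Icc s t) (fun r _ =>
      (hasDerivAt_exp_mul_mul (-Λ) (F.hasDerivAt_φ r)).add ((hasDerivAt_id r).const_mul _))
      fun r hr => ?_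
    have h1 : Λ * φ r - φ' r ≤ Λ * φ t - φ' t := F.monotone_defect_φ hΛ hΛ0 hr.2
    have h2 : exp (-Λ * r) ≤ exp (-Λ * s) := exp_le_exp.2 (by nlinarith [hr.1])
    have h3 := mul_le_mul h2 h1 (by linarith [hg r]) (exp_pos _).le
    linarith
  have h1 := hmono (left_mem_Icc.2 hst) (right_mem_Icc.2 hst) hst
  dsimp only at h1
  have h2 : exp (-(Λ * (t - s))) * exp (-Λ * s) = exp (-Λ * t) := by rw [← exp_add]; ring_nf
  refine le_of_mul_le_mul_left ?_ (exp_pos (-Λ * s))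
  calc exp (-Λ * s) * φ s ≤ exp (-Λ * t) * φ t + exp (-Λ * s) * (Λ * φ t - φ' t) * (t - s) := by
        linarith
    _ = _ := by rw [← h2]; ring

lemma φ_le_defect (F : Front b c h φ φ' v v') (hΛ : ∀ t, v' t ≤ Λ * v t) (hΛ0 : 0 ≤ Λ) (t : ℝ) :
    φ t ≤ (v t + b * (h * (Λ * φ t - φ' t))) / (1 - b * exp (-(Λ * h))) := by
  have h1 := F.φ_le_exp hΛ hΛ0 (show t - h ≤ t by linarith [F.h_nonneg])
  rw [sub_sub_cancel] at h1
  have h2 := mul_le_mul_of_nonneg_left h1 F.b_nonneg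
  rw [le_div_iff₀ (F.one_sub_pos hΛ0), F.v_eq]
  linarith

/-- Lower bound for the derivative of the defect. -/
lemma chi_growth (F : Front b c h φ φ' v v') (hΛ : ∀ t, v' t ≤ Λ * v t) (hΛ0 : 0 ≤ Λ) :
    ∃ C, 0 < C ∧ ∀ t, 0 ≤ chi b c h 1 Λ * v t + C * (Λ * v t - v' t) := by
  have ha := F.one_sub_pos hΛ0
  have hb := F.one_sub_b_pos
  have hbh := mul_nonneg F.b_nonneg F.h_nonneg
  set a := 1 - b * exp (-(Λ * h)) with had
  -- The derivative of the nondecreasing defect, with v'' eliminated. Once φ and v' are replaced by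
  -- multiples of v, up to multiples of the defect, it becomes χ(Λ)v.
  have hz : ∀ t, 0 ≤ (Λ - c) * v' t + φ t * (1 - φ (t - h)) := fun t => by
    have h1 := ((F.hasDerivAt_v t).const_mul Λ).sub (F.hasDerivAt_v' t)
    have h2 := (F.monotone_defect hΛ hΛ0).deriv_nonneg (x := t)
    rw [show deriv (fun t => Λ * v t - v' t) t = _ from h1.deriv] at h2
    linarith
  refine ⟨c + b * h / ((1 - b) * a) , add_pos_of_pos_of_nonneg F.c_pos (by positivity),
    fun t => ?_⟩
  have e1 := hz t
  have e2 := F.φ_le_defect hΛ hΛ0 t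
  have e3 := F.defect_φ_le hΛ hΛ0 t
  have e4 : 0 ≤ φ t * φ (t - h) := mul_nonneg (F.nonneg _) (F.nonneg _)
  rw [← had] at e2
  set u := Λ * v t - v' t with hu
  have hu0 : 0 ≤ u := by linarith [hΛ t]
  have e5 : b * (h * (Λ * φ t - φ' t)) ≤ b * h * (u / (1 - b)) := by
    rw [← mul_assoc]
    exact mul_le_mul_of_nonneg_left e3 hbh
  have e6 : φ t ≤ v t / a + b * h / ((1 - b) * a) * u := by
    calc φ t ≤ (v t + b * h * (u / (1 - b))) / a :=
          e2.trans (div_le_div_of_nonneg_right (by linarith) ha.le)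
      _ = _ := by field_simp
  have e7 : (Λ - c) * v' t = (Λ ^ 2 - c * Λ) * v t + (c - Λ) * u := by rw [hu]; ring
  have e8 : chi b c h 1 Λ * v t = (Λ ^ 2 - c * Λ) * v t + v t / a := by
    rw [chi, ← had]
    ring
  have e9 : 0 ≤ Λ * u := mul_nonneg hΛ0 hu0
  rw [e8]
  linarith

/-- Comparison of exponents based on the sign of the flux. -/
lemma chi_growth_flux (F : Front b c h φ φ' v v') (hΛ : ∀ t, v' t ≤ Λ * v t) {r : ℝ} (hr : 0 < r)
    (hrΛ : r < Λ) (hχ : chi b c h 1 r ≤ 0) :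
    ∃ C, 0 < C ∧ ∀ t, (chi b c h 1 Λ - chi b c h 1 r) * v t ≤ C * (Λ * v t - v' t) := by
  have hΛ0 : 0 ≤ Λ := by linarith
  have ha := F.one_sub_pos hΛ0
  have har := F.one_sub_pos hr.le
  have hb := F.one_sub_b_pos
  have hh := F.h_nonneg
  have hb0 := F.b_nonneg
  have hc := F.continuous
  have hd : 0 < Λ - r := by linarith
  set a := 1 - b * exp (-(Λ * h)) with had
  set a' := 1 - b * exp (-(r * h)) with har'
  set α := b * exp (-(r * h)) / a' with hα
  have hα0 : 0 ≤ α := by positivity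
  -- The integral of e^{-(Λ - r)σ} over 0 ≤ σ ≤ h, produced when φ is replaced by an exponential of
  -- rate Λ in the window integral.
  set D := (1 - exp (-((Λ - r) * h))) / (Λ - r) with hD
  have hD0 : 0 ≤ D := by
    have : exp (-((Λ - r) * h)) ≤ 1 :=
      exp_le_one_iff.2 (by have := mul_nonneg hd.le hh; linarith)
    exact div_nonneg (by linarith) hd.le
  set C₁ := α * (h * h * exp (r * h)) / (1 - b) + α * D * (b * h / ((1 - b) * a)) + 1 with hC₁
  have hC₁0 : 0 < C₁ := by positivity
  refine ⟨(Λ - r) * C₁, by positivity, fun t => ?_⟩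
  have e1 := F.flux_nonpos hr hχ t
  set u := Λ * v t - v' t with hu
  have hu0 : 0 ≤ u := by linarith [hΛ t]
  have e2 := F.φ_le_defect hΛ hΛ0 t
  have e3 := F.defect_φ_le hΛ hΛ0 t
  set g := Λ * φ t - φ' t with hg
  have hg0 : 0 ≤ g := by
    obtain ⟨C, hC⟩ := F.φ'_le_const
    have := F.φ'_le hΛ hΛ0 hC t
    linarith
  have e6 : φ t ≤ v t / a + b * h / ((1 - b) * a) * u := by
    have : b * (h * g) ≤ b * h * (u / (1 - b)) := by
      rw [← mul_assoc]
      exact mul_le_mul_of_nonneg_left e3 (by positivity)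
    calc φ t ≤ (v t + b * h * (u / (1 - b))) / a :=
          e2.trans (div_le_div_of_nonneg_right (by linarith) ha.le)
      _ = _ := by field_simp
  -- estimate of the window integral
  have e7 : ∫ s in (t - h)..t, exp (-r * s) * φ s ≤
      exp (-r * t) * (D * φ t + h * h * exp (r * h) * g) := by
    have hle : ∀ s ∈ Icc (t - h) t, exp (-r * s) * φ s ≤
        exp (-(Λ * t)) * φ t * exp ((Λ - r) * s) + exp (-r * t) * (h * exp (r * h) * g) := by
      intro s hs
      have f1 := F.φ_le_exp hΛ hΛ0 hs.2
      have f2 : (t - s) * g ≤ h * g := mul_le_mul_of_nonneg_right (by linarith [hs.1]) hg0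
      have f3 : exp (-r * s) ≤ exp (-r * t) * exp (r * h) := by
        rw [← exp_add, exp_le_exp]
        nlinarith [hs.1]
      calc exp (-r * s) * φ s ≤ exp (-r * s) * (exp (-(Λ * (t - s))) * φ t + h * g) :=
            mul_le_mul_of_nonneg_left (by linarith) (exp_pos _).le
        _ = exp (-r * s) * exp (-(Λ * (t - s))) * φ t + exp (-r * s) * (h * g) := by ring
        _ ≤ exp (-(Λ * t)) * exp ((Λ - r) * s) * φ t + exp (-r * t) * exp (r * h) * (h * g) := by
          refine add_le_add (le_of_eq ?_) (mul_le_mul_of_nonneg_right f3 (by positivity))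
          rw [← exp_add, ← exp_add]
          ring_nf
        _ = _ := by ring
    have hint := intervalIntegral.integral_mono_on (μ := volume) (show t - h ≤ t by linarith)
      ((by fun_prop : Continuous fun s => exp (-r * s) * φ s).intervalIntegrable _ _)
      ((by fun_prop : Continuous fun s => exp (-(Λ * t)) * φ t * exp ((Λ - r) * s) +
        exp (-r * t) * (h * exp (r * h) * g)).intervalIntegrable _ _) hle
    refine hint.trans (le_of_eq ?_)
    have hprim : ∫ s in (t - h)..t, exp ((Λ - r) * s) =
        exp ((Λ - r) * t) / (Λ - r) - exp ((Λ - r) * (t - h)) / (Λ - r) := by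
      refine intervalIntegral.integral_eq_sub_of_hasDerivAt
        (f := fun s => exp ((Λ - r) * s) / (Λ - r)) (fun s _ => ?_)
        ((by fun_prop : Continuous fun s => exp ((Λ - r) * s)).intervalIntegrable _ _)
      refine ((hasDerivAt_exp_mul (Λ - r) s).div_const _).congr_deriv ?_
      field_simp
    rw [intervalIntegral.integral_add
      ((by fun_prop : Continuous fun s =>
        exp (-(Λ * t)) * φ t * exp ((Λ - r) * s)).intervalIntegrable _ _) (by simp),
      intervalIntegral.integral_const_mul, hprim]
    have g1 : exp ((Λ - r) * (t - h)) = exp (-((Λ - r) * h)) * exp ((Λ - r) * t) := by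
      rw [← exp_add]; ring_nf
    have g2 : exp (-(Λ * t)) * exp ((Λ - r) * t) = exp (-r * t) := by
      rw [← exp_add]; ring_nf
    simp only [intervalIntegral.integral_const, sub_sub_cancel, smul_eq_mul]
    rw [g1, ← g2, hD]
    field_simp
  have e8 : v' t - (c - r) * v t ≤ α * (D * φ t + h * h * exp (r * h) * g) := by
    have h1 : exp (-r * t) * (v' t - (c - r) * v t) ≤
        α * (exp (-r * t) * (D * φ t + h * h * exp (r * h) * g)) := by
      have := mul_le_mul_of_nonneg_left e7 hα0
      unfold flux at e1
      linarith
    refine le_of_mul_le_mul_left (h1.trans (le_of_eq ?_)) (exp_pos (-r * t))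
    ring
  have e9 : α * (h * h * exp (r * h) * g) ≤ α * (h * h * exp (r * h)) / (1 - b) * u := by
    calc _ = α * (h * h * exp (r * h)) * g := by ring
      _ ≤ α * (h * h * exp (r * h)) * (u / (1 - b)) :=
        mul_le_mul_of_nonneg_left e3 (by positivity)
      _ = _ := by ring
  have e10 : α * D * φ t ≤ α * D * (v t / a + b * h / ((1 - b) * a) * u) :=
    mul_le_mul_of_nonneg_left e6 (by positivity)
  have e11 : (Λ - (c - r) - α * D / a) * v t ≤ C₁ * u := by
    have : v' t = Λ * v t - u := by rw [hu]; ring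
    rw [this] at e8
    rw [hC₁]
    have h5 : α * D * (v t / a) = α * D / a * v t := by ring
    linarith
  -- The coefficient obtained from the flux inequality is exactly the difference quotient of χ
  -- between r and Λ.
  have e12 : chi b c h 1 Λ - chi b c h 1 r = (Λ - r) * (Λ - (c - r) - α * D / a) := by
    have g1 : exp (-(Λ * h)) = exp (-(r * h)) * exp (-((Λ - r) * h)) := by
      rw [← exp_add]; ring_nf
    have g3 : (Λ - r) * (α * D / a) = 1 / a' - 1 / a := by
      have g4 : (Λ - r) * D = 1 - exp (-((Λ - r) * h)) := by rw [hD]; field_simp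
      have g5 : α * ((Λ - r) * D) = (a - a') / a' := by
        rw [g4, hα, had, har', g1]
        ring
      calc (Λ - r) * (α * D / a) = α * ((Λ - r) * D) / a := by ring
        _ = (a - a') / a' / a := by rw [g5]
        _ = _ := by field_simp
    rw [mul_sub, g3, chi, chi, ← had, ← har']
    ring
  rw [e12]
  have := mul_le_mul_of_nonneg_left e11 hd.le
  linarith

end growth

/-- The logarithmic derivative of `v` is bounded by any positive zero of the characteristic
function. -/
theorem v'_le_root (F : Front b c h φ φ' v v') {r : ℝ} (hr : 0 < r) (hχ : chi b c h 1 r = 0)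
    (t : ℝ) : v' t ≤ r * v t := by
  -- The infimum of this set is the optimal growth rate, attained as a bound; for the optimal rate
  -- no positive multiple of v lies below the defect.
  set S := {Λ : ℝ | ∀ t, v' t ≤ Λ * v t} with hS
  have hSne : S.Nonempty := ⟨c, F.v'_le⟩
  have hSb : ∀ Λ ∈ S, 0 ≤ Λ := fun Λ hΛ => by
    have h1 := (F.v'_nonneg 0).trans (hΛ 0)
    exact nonneg_of_mul_nonneg_left h1 (F.v_pos 0)
  have hSbd : BddBelow S := ⟨0, hSb⟩
  set Λ := sInf S with hΛdef
  have hΛ : ∀ t, v' t ≤ Λ * v t := fun t => by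
    have : v' t / v t ≤ Λ := le_csInf hSne fun x hx => by
      rw [div_le_iff₀ (F.v_pos t)]
      exact hx t
    rwa [div_le_iff₀ (F.v_pos t)] at this
  have hΛ0 : 0 ≤ Λ := hSb Λ hΛ
  -- the defect is not bounded below by a multiple of `v`
  have hopt : ∀ ε C : ℝ, 0 < ε → 0 < C → ¬ ∀ t, ε * v t ≤ C * (Λ * v t - v' t) := by
    intro ε C hε hC hcon
    have : Λ - ε / C ∈ S := fun t => by
      have h1 := hcon t
      have h2 : ε / C * v t ≤ Λ * v t - v' t := by
        rw [div_mul_eq_mul_div, div_le_iff₀ hC]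
        linarith
      linarith
    have h3 := csInf_le hSbd this
    have h4 : 0 < ε / C := by positivity
    linarith
  -- If Λ > r, optimality gives χ(Λ) ≥ 0, and χ(Λ) ≤ χ(s) whenever 0 < s < Λ and χ(s) ≤ 0. Taking s
  -- = r yields χ(Λ) = 0; by strict convexity χ is negative at the midpoint, and taking s there is a
  -- contradiction.
  have hle : Λ ≤ r := by
    by_contra hlt
    push Not at hlt
    have hχΛ : 0 ≤ chi b c h 1 Λ := by
      by_contra hneg
      obtain ⟨C, hC, hCt⟩ := F.chi_growth hΛ hΛ0
      exact hopt (-chi b c h 1 Λ) C (by linarith) hC fun t => by linarith [hCt t]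
    have hflux : ∀ s, 0 < s → s < Λ → chi b c h 1 s ≤ 0 → chi b c h 1 Λ ≤ chi b c h 1 s := by
      intro s hs hsΛ hχs
      by_contra hneg
      obtain ⟨C, hC, hCt⟩ := F.chi_growth_flux hΛ hs hsΛ hχs
      exact hopt (chi b c h 1 Λ - chi b c h 1 s) C (by linarith) hC hCt
    have h1 := hflux r hr hlt hχ.le
    have h2 : chi b c h 1 ((r + Λ) / 2) < (chi b c h 1 r + chi b c h 1 Λ) / 2 :=
      chi_midpoint_lt F.b_nonneg (F.one_sub_pos hr.le) (F.one_sub_pos hΛ0) hlt.ne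
    have h3 := hflux ((r + Λ) / 2) (by linarith) (by linarith) (by linarith)
    linarith
  exact (hΛ t).trans (mul_le_mul_of_nonneg_right hle (F.v_pos t).le)

end Front

/-! ### Asymptotics at minus infinity -/

/-- Minus the derivative of the characteristic function `chi b c h 1`. -/
def chiSlope (b c h r : ℝ) : ℝ :=
  c - 2 * r + h * (b * exp (-(r * h))) / (1 - b * exp (-(r * h))) ^ 2

lemma hasDerivAt_chi {b c h r : ℝ} (ha : 0 < 1 - b * exp (-(r * h))) :
    HasDerivAt (chi b c h 1) (-chiSlope b c h r) r := by
  have h1 : HasDerivAt (fun z => 1 - b * exp (-(z * h))) (-(b * (exp (-(r * h)) * -h))) r := by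
    have h2 : HasDerivAt (fun z => exp (-(z * h))) (exp (-(r * h)) * -h) r := by
      have := ((hasDerivAt_id r).mul_const h).neg.exp
      simpa using this
    exact (h2.const_mul b).const_sub 1
  have h3 := (((hasDerivAt_id r).pow 2).sub ((hasDerivAt_id r).const_mul c)).add
    ((hasDerivAt_const r (1 : ℝ)).div h1 ha.ne')
  refine h3.congr_deriv ?_
  simp only [chiSlope, id]
  field_simp
  push_cast
  ring

/-- The smallest positive zero of the characteristic function. -/
lemma exists_min_root {b c h z : ℝ} (hb0 : 0 ≤ b) (hb1 : b < 1) (hh : 0 ≤ h) (hz : 0 < z)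
    (hχ : chi b c h 1 z = 0) : ∃ r, 0 < r ∧ chi b c h 1 r = 0 ∧ 0 ≤ chiSlope b c h r := by
  have hcont : ContinuousOn (chi b c h 1) (Icc 0 z) :=
    (continuousOn_chi hb0 hb1 hh).mono Icc_subset_Ici_self
  have h0 : 0 < chi b c h 1 0 := by
    have : 0 < 1 / (1 - b) := div_pos one_pos (by linarith)
    simpa [chi] using this
  have hcomp : IsCompact (Icc 0 z ∩ chi b c h 1 ⁻¹' Iic 0) :=
    isCompact_Icc.of_isClosed_subset (hcont.preimage_isClosed_of_isClosed isClosed_Icc isClosed_Iic)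
      inter_subset_left
  obtain ⟨r, ⟨hr, hr0⟩, hrmin⟩ := hcomp.exists_isLeast ⟨z, ⟨hz.le, le_rfl⟩, hχ.le⟩
  have hpos : ∀ x, 0 ≤ x → x < r → 0 < chi b c h 1 x := fun x hx hxr => by
    by_contra hcon
    have := hrmin ⟨⟨hx, hxr.le.trans hr.2⟩, not_lt.1 hcon⟩
    linarith
  have hrpos : 0 < r := lt_of_le_of_ne hr.1 fun heq => by
    have h1 : chi b c h 1 r ≤ 0 := hr0
    rw [← heq] at h1
    linarith
  have hzero : chi b c h 1 r = 0 := by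
    obtain ⟨x, hx, hx0⟩ := intermediate_value_Icc' hr.1
      (hcont.mono (Icc_subset_Icc_right hr.2)) ⟨hr0, h0.le⟩
    have : r ≤ x := hrmin ⟨⟨hx.1, hx.2.trans hr.2⟩, hx0.le⟩
    rw [← le_antisymm hx.2 this, hx0]
  refine ⟨r, hrpos, hzero, ?_⟩
  have ha : 0 < 1 - b * exp (-(r * h)) := by
    have h1 : exp (-(r * h)) ≤ 1 := exp_le_one_iff.2 (by have := mul_nonneg hr.1 hh; linarith)
    have h2 : b * exp (-(r * h)) ≤ b := mul_le_of_le_one_right hb0 h1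
    linarith
  have hslope := (hasDerivWithinAt_iff_tendsto_slope' (s := Iio r) (by simp)).1
    (hasDerivAt_chi (c := c) ha).hasDerivWithinAt
  -- Left difference quotients at the first zero are nonpositive, since χ > 0 before it.
  have hle : -chiSlope b c h r ≤ 0 := by
    refine le_of_tendsto hslope ?_
    filter_upwards [Ioo_mem_nhdsLT hrpos] with x hx
    rw [slope_def_field, hzero]
    exact div_nonpos_of_nonneg_of_nonpos (by linarith [hpos x hx.1.le hx.2]) (by linarith [hx.2])
  linarith

namespace Front
variable {b c h r : ℝ} {φ φ' v v' : ℝ → ℝ}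

lemma φ'_le_root (F : Front b c h φ φ' v v') (hr : 0 < r) (hχ : chi b c h 1 r = 0) (t : ℝ) :
    φ' t ≤ r * φ t := by
  obtain ⟨C, hC⟩ := F.φ'_le_const
  exact F.φ'_le (F.v'_le_root hr hχ) hr.le hC t

lemma antitone_exp_mul (F : Front b c h φ φ' v v') (hr : 0 < r) (hχ : chi b c h 1 r = 0) :
    Antitone fun t => exp (-r * t) * φ t :=
  antitone_of_hasDerivAt_nonpos' (fun t => hasDerivAt_exp_mul_mul (-r) (F.hasDerivAt_φ t))
    fun t => mul_nonpos_of_nonneg_of_nonpos (exp_pos _).le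
      (by linarith [F.φ'_le_root hr hχ t])

/-- The key one-step inequality `φ (t - h) ≥ e^{-r h} φ t`. -/
lemma le_shift (F : Front b c h φ φ' v v') (hr : 0 < r) (hχ : chi b c h 1 r = 0) (t : ℝ) :
    exp (-(r * h)) * φ t ≤ φ (t - h) := by
  have h1 : exp (-r * t) * φ t ≤ exp (-r * (t - h)) * φ (t - h) :=
    F.antitone_exp_mul hr hχ (by linarith [F.h_nonneg])
  have e : exp (-(r * h)) * exp (-r * (t - h)) = exp (-r * t) := by rw [← exp_add]; ring_nf
  rw [← e] at h1
  refine le_of_mul_le_mul_left ?_ (exp_pos (-r * (t - h)))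
  linarith

lemma hasDerivAt_flux_root (F : Front b c h φ φ' v v') (hr : 0 < r) (hχ : chi b c h 1 r = 0)
    (t : ℝ) : HasDerivAt (flux b c h φ v v' r) (exp (-r * t) * (φ t * φ (t - h))) t := by
  have := F.hasDerivAt_flux hr.le t
  rwa [hχ, zero_mul, sub_zero] at this

lemma monotone_flux (F : Front b c h φ φ' v v') (hr : 0 < r) (hχ : chi b c h 1 r = 0) :
    Monotone (flux b c h φ v v' r) :=
  monotone_of_hasDerivAt_nonneg' (F.hasDerivAt_flux_root hr hχ) fun _ =>
    mul_nonneg (exp_pos _).le (mul_nonneg (F.nonneg _) (F.nonneg _))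

/-- The flux dominates the defect and the weighted profile. -/
lemma flux_le (F : Front b c h φ φ' v v') (hr : 0 < r) (hχ : chi b c h 1 r = 0) (t : ℝ) :
    exp (-r * t) * (r * v t - v' t) + chiSlope b c h r * (exp (-r * t) * v t) ≤
      -flux b c h φ v v' r t := by
  have ha := F.one_sub_pos hr.le
  have hc := F.continuous
  have hh := F.h_nonneg
  have hβ0 : 0 ≤ b * exp (-(r * h)) := mul_nonneg F.b_nonneg (exp_pos _).le
  -- The weighted profile is nonincreasing, so the window integral is at least h times its value at
  -- the right end.
  have h1 : h * (exp (-r * t) * φ t) ≤ ∫ s in (t - h)..t, exp (-r * s) * φ s :=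
    le_window (by fun_prop) F.h_nonneg fun _ _ hs => F.antitone_exp_mul hr hχ hs
  have h2 : v t ≤ φ t * (1 - b * exp (-(r * h))) := by
    have := mul_le_mul_of_nonneg_left (F.le_shift hr hχ t) F.b_nonneg
    rw [F.v_eq]
    linarith
  set β := b * exp (-(r * h)) with hβ
  have h3 : v t / (1 - β) ≤ φ t := by rwa [div_le_iff₀ ha]
  have h4 : h * β / (1 - β) ^ 2 * (exp (-r * t) * v t) ≤
      β / (1 - β) * ∫ s in (t - h)..t, exp (-r * s) * φ s := by
    calc _ = β / (1 - β) * (h * (exp (-r * t) * (v t / (1 - β)))) := by field_simp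
      _ ≤ β / (1 - β) * (h * (exp (-r * t) * φ t)) := by gcongr
      _ ≤ _ := mul_le_mul_of_nonneg_left h1 (by positivity)
  unfold flux chiSlope
  rw [← hβ]
  linarith

/-- Exponential upper bound for the profile. -/
lemma exists_exp_bound (F : Front b c h φ φ' v v') (hr : 0 < r) (hχ : chi b c h 1 r = 0)
    (hm : 0 ≤ chiSlope b c h r) : ∃ C, 0 < C ∧ ∀ t, φ t ≤ C * exp (3 / 4 * r * t) := by
  have hb := F.one_sub_b_pos
  -- This yields the decay rate r - a = 3r/4. Any rate above r/2 would make e^{-rt} φ² integrable at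
  -- -∞.
  set a := r / 4 with ha
  have ha0 : 0 < a := by positivity
  have hlim : Tendsto (fun t => v t / (1 - b) ^ 2) atBot (𝓝 0) := by
    simpa using F.v_bot.div_const ((1 - b) ^ 2)
  obtain ⟨T, hT⟩ := eventually_atBot.1
    (hlim.eventually (gt_mem_nhds (show (0 : ℝ) < a ^ 2 by positivity)))
  set J := flux b c h φ v v' r with hJ
  have hJ0 : ∀ t, J t ≤ 0 := F.flux_nonpos hr hχ.le
  -- For y = e^{-rt} v, the flux gives y' ≥ J, and the smallness of v left of T gives J' ≤ a² y.
  -- Together they make e^{at}(y - J/a) nondecreasing.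
  have hmono : MonotoneOn (fun t => exp (a * t) * (exp (-r * t) * v t + -J t / a)) (Iic T) := by
    refine monotoneOn_of_hasDerivAt_nonneg (convex_Iic T) (fun t _ => hasDerivAt_exp_mul_mul a
      ((hasDerivAt_exp_mul_mul (-r) (F.hasDerivAt_v t)).add
        ((F.hasDerivAt_flux_root hr hχ t).neg.div_const a))) fun t ht => ?_
    refine mul_nonneg (exp_pos _).le ?_
    have h1 := F.flux_le hr hχ t
    have h2 := mul_nonneg hm (mul_nonneg (exp_pos (-r * t)).le (F.v_pos t).le)
    have h3 : φ t * φ (t - h) ≤ a ^ 2 * v t := by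
      have e1 := F.φ_le t
      have e2 := (F.shift_le t).trans e1
      calc φ t * φ (t - h) ≤ (v t / (1 - b)) * (v t / (1 - b)) :=
            mul_le_mul e1 e2 (F.nonneg _) (div_nonneg (F.v_pos t).le hb.le)
        _ = v t / (1 - b) ^ 2 * v t := by field_simp
        _ ≤ a ^ 2 * v t := mul_le_mul_of_nonneg_right (hT t ht).le (F.v_pos t).le
    have h4 : exp (-r * t) * (φ t * φ (t - h)) / a ≤ a * (exp (-r * t) * v t) := by
      rw [div_le_iff₀ ha0]
      have := mul_le_mul_of_nonneg_left h3 (exp_pos (-r * t)).le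
      linarith
    have h5 : a * (-J t / a) = -J t := by field_simp
    have h6 : a * (exp (-r * t) * v t + -J t / a) = a * (exp (-r * t) * v t) + -J t := by
      rw [mul_add, h5]
    rw [← hJ] at h1
    rw [h6, neg_div]
    linarith
  set W := exp (a * T) * (exp (-r * T) * v T + -J T / a) with hW
  have hW0 : 0 < W := by
    have h1 : 0 ≤ -J T / a := div_nonneg (by linarith [hJ0 T]) ha0.le
    have h2 := mul_pos (exp_pos (-r * T)) (F.v_pos T)
    exact mul_pos (exp_pos _) (by linarith)
  refine ⟨W / (1 - b) + exp (-(3 / 4 * r * T)), by positivity, fun t => ?_⟩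
  rcases le_total t T with ht | ht
  · have h1 : exp (a * t) * (exp (-r * t) * v t + -J t / a) ≤ W :=
      hmono (mem_Iic.2 ht) (mem_Iic.2 le_rfl) ht
    have h2 : 0 ≤ -J t / a := div_nonneg (by linarith [hJ0 t]) ha0.le
    have h3 : exp (a * t) * (exp (-r * t) * v t) ≤ W :=
      (mul_le_mul_of_nonneg_left (by linarith) (exp_pos _).le).trans h1
    have h4 : exp (3 / 4 * r * t) * (exp (a * t) * exp (-r * t)) = 1 := by
      rw [← exp_add, ← exp_add, ha]
      ring_nf
      exact exp_zero
    have h5 : v t ≤ W * exp (3 / 4 * r * t) := by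
      have := mul_le_mul_of_nonneg_left h3 (exp_pos (3 / 4 * r * t)).le
      calc v t = exp (3 / 4 * r * t) * (exp (a * t) * (exp (-r * t) * v t)) := by
            rw [← mul_assoc (exp (a * t)), ← mul_assoc, h4, one_mul]
        _ ≤ _ := by linarith
    calc φ t ≤ v t / (1 - b) := F.φ_le t
      _ ≤ W * exp (3 / 4 * r * t) / (1 - b) := div_le_div_of_nonneg_right h5 hb.le
      _ = W / (1 - b) * exp (3 / 4 * r * t) := by ring
      _ ≤ _ := mul_le_mul_of_nonneg_right (by linarith [exp_pos (-(3 / 4 * r * T))]) (exp_pos _).le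
  · have h1 : 1 ≤ exp (-(3 / 4 * r * T)) * exp (3 / 4 * r * t) := by
      rw [← exp_add]
      exact one_le_exp (by nlinarith)
    have h2 : 0 ≤ W / (1 - b) * exp (3 / 4 * r * t) := by positivity
    have := F.le_one t
    linarith

/-- The flux has a negative limit at minus infinity, which is reached exponentially fast. -/
lemma exists_flux_limit (F : Front b c h φ φ' v v') (hr : 0 < r) (hχ : chi b c h 1 r = 0)
    (hm : 0 ≤ chiSlope b c h r) : ∃ L C, L < 0 ∧ 0 < C ∧
      (∀ t, φ t ≤ C * exp (3 / 4 * r * t)) ∧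
      (∀ t, L ≤ flux b c h φ v v' r t) ∧
      (∀ t, flux b c h φ v v' r t ≤ L + C * exp (r / 2 * t)) := by
  obtain ⟨C, hC, hφC⟩ := F.exists_exp_bound hr hχ hm
  set J := flux b c h φ v v' r with hJ
  have hmono : Monotone J := F.monotone_flux hr hχ
  have hprod : ∀ t, φ t * φ (t - h) ≤ C ^ 2 * exp (3 / 2 * r * t) := fun t => by
    have h2 : exp (3 / 4 * r * t) * exp (3 / 4 * r * t) = exp (3 / 2 * r * t) := by
      rw [← exp_add]; ring_nf
    calc φ t * φ (t - h) ≤ (C * exp (3 / 4 * r * t)) * (C * exp (3 / 4 * r * t)) :=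
          mul_le_mul (hφC t) ((F.shift_le t).trans (hφC t)) (F.nonneg _) (by positivity)
      _ = C ^ 2 * (exp (3 / 4 * r * t) * exp (3 / 4 * r * t)) := by ring
      _ = _ := by rw [h2]
  -- The derivative of J is O(e^{-rt} e^{3rt/2}) = O(e^{rt/2}), integrable at -∞; this gives both
  -- the finite limit and the rate.
  have hanti : Antitone fun t => J t - 2 * C ^ 2 / r * exp (r / 2 * t) := by
    refine antitone_of_hasDerivAt_nonpos' (fun t => (F.hasDerivAt_flux_root hr hχ t).sub
      ((hasDerivAt_exp_mul (r / 2) t).const_mul _)) fun t => ?_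
    have h2 : exp (-r * t) * exp (3 / 2 * r * t) = exp (r / 2 * t) := by
      rw [← exp_add]; ring_nf
    have h3 := mul_le_mul_of_nonneg_left (hprod t) (exp_pos (-r * t)).le
    have h4 : 2 * C ^ 2 / r * (r / 2 * exp (r / 2 * t)) = C ^ 2 * exp (r / 2 * t) := by
      field_simp
    rw [h4, ← h2]
    linarith
  have hbdd : BddBelow (range J) := by
    refine ⟨J 0 - 2 * C ^ 2 / r, ?_⟩
    rintro _ ⟨t, rfl⟩
    have h1 := hanti (min_le_right t 0)
    have h2 := hmono (min_le_left t 0)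
    simp only [mul_zero, exp_zero, mul_one] at h1
    have h3 : 0 ≤ 2 * C ^ 2 / r * exp (r / 2 * min t 0) := by positivity
    linarith
  have hlim := tendsto_atBot_ciInf hmono hbdd
  set L := ⨅ t, J t with hL
  have hLJ : ∀ t, L ≤ J t := fun t => ciInf_le hbdd t
  have hL0 : L < 0 := by
    have hstrict : J (-1) < J 0 := by
      have : StrictMono J := strictMono_of_deriv_pos fun t => by
        rw [(F.hasDerivAt_flux_root hr hχ t).deriv]
        exact mul_pos (exp_pos _) (mul_pos (F.pos _) (F.pos _))
      exact this (by norm_num)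
    linarith [hLJ (-1), F.flux_nonpos hr hχ.le 0]
  have hJL : ∀ t, J t ≤ L + 2 * C ^ 2 / r * exp (r / 2 * t) := fun t => by
    have h1 : Tendsto (fun t => J t - 2 * C ^ 2 / r * exp (r / 2 * t)) atBot
        (𝓝 (L - 2 * C ^ 2 / r * 0)) :=
      hlim.sub ((tendsto_exp_mul_atBot (by positivity)).const_mul _)
    have h3 : J t - 2 * C ^ 2 / r * exp (r / 2 * t) ≤ L - 2 * C ^ 2 / r * 0 :=
      ge_of_tendsto h1 ((eventually_le_atBot t).mono fun s hs => hanti hs)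
    linarith
  have hC2 : 0 < 2 * C ^ 2 / r := by positivity
  refine ⟨L, C + 2 * C ^ 2 / r, hL0, by positivity, fun t => ?_, hLJ, fun t => ?_⟩
  · exact (hφC t).trans (mul_le_mul_of_nonneg_right (by linarith) (exp_pos _).le)
  · exact (hJL t).trans (add_le_add_right
      (mul_le_mul_of_nonneg_right (by linarith) (exp_pos _).le) _)

lemma comp_add (F : Front b c h φ φ' v v') (s : ℝ) :
    Front b c h (fun t => φ (t + s)) (fun t => φ' (t + s)) (fun t => v (t + s))
      (fun t => v' (t + s)) where
  b_nonneg := F.b_nonneg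
  b_lt_one := F.b_lt_one
  c_pos := F.c_pos
  h_nonneg := F.h_nonneg
  mono := fun x y hxy => F.mono (by linarith)
  bot := F.bot.comp (tendsto_atBot_add_const_right _ s tendsto_id)
  top := F.top.comp (tendsto_atTop_add_const_right _ s tendsto_id)
  v_eq t := by rw [F.v_eq, sub_add_eq_add_sub]
  v'_eq t := by rw [F.v'_eq, sub_add_eq_add_sub]
  hasDerivAt_φ t := (F.hasDerivAt_φ (t + s)).comp_add_const t s
  hasDerivAt_v t := (F.hasDerivAt_v (t + s)).comp_add_const t s
  hasDerivAt_v' t := by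
    rw [sub_add_eq_add_sub]
    exact (F.hasDerivAt_v' (t + s)).comp_add_const t s
  le_one t := F.le_one _
  v_pos t := F.v_pos _
  v'_nonneg t := F.v'_nonneg _
  v'_le t := F.v'_le _

/-- The factor e^{rs} allows a translation to give the flux any prescribed negative limit at -∞. -/
lemma flux_comp_add (s t : ℝ) :
    flux b c h (fun t => φ (t + s)) (fun t => v (t + s)) (fun t => v' (t + s)) r t =
      exp (r * s) * flux b c h φ v v' r (t + s) := by
  unfold flux
  have h1 : ∀ x, exp (-r * x) = exp (r * s) * exp (-r * (x + s)) := fun x => by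
    rw [← exp_add]; ring_nf
  have h2 : ∫ x in (t - h)..t, exp (-r * x) * φ (x + s) =
      exp (r * s) * ∫ x in (t + s - h)..(t + s), exp (-r * x) * φ x := by
    rw [← sub_add_eq_add_sub,
      ← intervalIntegral.integral_comp_add_right (fun x => exp (-r * x) * φ x),
      ← intervalIntegral.integral_const_mul]
    congr 1
    funext x
    rw [h1 x]
    ring
  rw [h2, h1 t]
  ring

end Front

/-! ### Comparison of two fronts -/

/-- First and second order conditions at a zero of a nonnegative function. -/
lemma second_derivative_test {D D' : ℝ → ℝ} {d t₀ : ℝ} (hD : ∀ t, 0 ≤ D t) (h0 : D t₀ = 0)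
    (h1 : ∀ t, HasDerivAt D (D' t) t) (h2 : HasDerivAt D' d t₀) : D' t₀ = 0 ∧ 0 ≤ d := by
  have hmin : IsLocalMin D t₀ := Eventually.of_forall fun t => by rw [h0]; exact hD t
  have hz : D' t₀ = 0 := hmin.hasDerivAt_eq_zero (h1 t₀)
  refine ⟨hz, ?_⟩
  by_contra hneg
  push Not at hneg
  have hslope := (hasDerivWithinAt_iff_tendsto_slope' (s := Ioi t₀) (by simp)).1
    h2.hasDerivWithinAt
  have hev := hslope.eventually (gt_mem_nhds hneg)
  obtain ⟨u, hu, hus⟩ := mem_nhdsGT_iff_exists_Ioo_subset.1 hev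
  have hu' : t₀ < u := hu
  have hlt : ∀ t ∈ Ioo t₀ u, D' t < 0 := fun t ht => by
    have h3 : slope D' t₀ t < 0 := hus ht
    rw [slope_def_field, hz, sub_zero, div_lt_iff₀ (by linarith [ht.1]), zero_mul] at h3
    exact h3
  have hanti : StrictAntiOn D (Ico t₀ u) :=
    strictAntiOn_of_hasDerivWithinAt_neg (convex_Ico _ _)
      (fun t _ => (h1 t).continuousAt.continuousWithinAt)
      (fun t _ => (h1 t).hasDerivWithinAt) (fun t ht => hlt t (by rwa [interior_Ico] at ht))
  have h3 := hanti (left_mem_Ico.2 hu') (show (t₀ + u) / 2 ∈ Ico t₀ u by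
    constructor <;> linarith) (by linarith)
  linarith [hD ((t₀ + u) / 2)]

/-- The exponentially weighted difference of two functions. -/
def wdiff (r : ℝ) (f g : ℝ → ℝ) (t : ℝ) : ℝ := exp (-r * t) * (f t - g t)

lemma exp_mul_wdiff (r : ℝ) (f g : ℝ → ℝ) (t : ℝ) : exp (r * t) * wdiff r f g t = f t - g t := by
  rw [wdiff, ← mul_assoc, ← exp_add]
  simp

lemma wdiff_le_iff {r S t : ℝ} {f g : ℝ → ℝ} : wdiff r f g t ≤ S ↔ f t - g t ≤ S * exp (r * t) := by
  rw [← exp_mul_wdiff r f g t, mul_comm S]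
  exact (mul_le_mul_iff_right₀ (exp_pos _)).symm

lemma wdiff_swap (r : ℝ) (f g : ℝ → ℝ) (t : ℝ) : wdiff r g f t = -wdiff r f g t := by
  unfold wdiff
  ring

lemma hasDerivAt_wdiff {r t f' g' : ℝ} {f g : ℝ → ℝ} (hf : HasDerivAt f f' t)
    (hg : HasDerivAt g g' t) :
    HasDerivAt (wdiff r f g) (exp (-r * t) * (f' - g' + -r * (f t - g t))) t :=
  hasDerivAt_exp_mul_mul (-r) (hf.sub hg)

/-- A weighted integral over a moving window, with affine weight. -/
def momentWindow (α γ h : ℝ) (k : ℝ → ℝ) (t : ℝ) : ℝ :=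
  α * ((∫ s in (t - h)..t, s * k s) - (t - h) * ∫ s in (t - h)..t, k s) +
    γ * ∫ s in (t - h)..t, k s

lemma hasDerivAt_momentWindow {α γ h : ℝ} {k : ℝ → ℝ} (hk : Continuous k) (t : ℝ) :
    HasDerivAt (momentWindow α γ h k)
      (α * (h * k t - ∫ s in (t - h)..t, k s) + γ * (k t - k (t - h))) t := by
  have h1 := hasDerivAt_window (k := fun s => s * k s) (by fun_prop) h t
  have h2 := hasDerivAt_window hk h t
  refine (((h1.sub (((hasDerivAt_id t).sub_const h).mul h2)).const_mul α).add
    (h2.const_mul γ)).congr_deriv ?_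
  simp only [id]
  ring

lemma momentWindow_eq {α γ h : ℝ} {k : ℝ → ℝ} (hk : Continuous k) (t : ℝ) :
    momentWindow α γ h k t = ∫ s in (t - h)..t, (α * (s - (t - h)) + γ) * k s := by
  have h1 : ∀ f : ℝ → ℝ, Continuous f → IntervalIntegrable f volume (t - h) t := fun f hf =>
    hf.intervalIntegrable _ _
  rw [momentWindow, ← intervalIntegral.integral_const_mul (t - h),
    ← intervalIntegral.integral_sub (h1 _ (by fun_prop)) (h1 _ (by fun_prop)),
    ← intervalIntegral.integral_const_mul, ← intervalIntegral.integral_const_mul,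
    ← intervalIntegral.integral_add (h1 _ (by fun_prop)) (h1 _ (by fun_prop))]
  congr 1
  funext s
  ring

lemma momentWindow_nonneg {α γ h t : ℝ} {k : ℝ → ℝ} (hk : Continuous k) (hα : 0 ≤ α) (hγ : 0 ≤ γ)
    (hh : 0 ≤ h) (h0 : ∀ s, t - h ≤ s → s ≤ t → 0 ≤ k s) : 0 ≤ momentWindow α γ h k t := by
  rw [momentWindow_eq hk]
  refine intervalIntegral.integral_nonneg (by linarith) fun s hs => mul_nonneg ?_ (h0 s hs.1 hs.2)
  have := mul_nonneg hα (sub_nonneg.2 hs.1)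
  linarith

lemma momentWindow_le {α γ h t K : ℝ} {k : ℝ → ℝ} (hk : Continuous k) (hα : 0 ≤ α) (hγ : 0 ≤ γ)
    (hh : 0 ≤ h) (h0 : ∀ s, t - h ≤ s → s ≤ t → 0 ≤ k s) (hK : ∀ s, t - h ≤ s → s ≤ t → k s ≤ K) :
    momentWindow α γ h k t ≤ h * ((α * h + γ) * K) := by
  rw [momentWindow_eq hk]
  refine window_le (by fun_prop) hh fun s hs hst => ?_
  have h1 : α * (s - (t - h)) ≤ α * h := mul_le_mul_of_nonneg_left (by linarith) hα
  have h2 : 0 ≤ α * h := mul_nonneg hα hh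
  exact mul_le_mul (by linarith) (hK s hs hst) (h0 s hs hst) (by linarith)

/-- Two fronts with the same asymptotic flux. -/
structure FrontPair (b c h r L C : ℝ) (φ₁ φ₁' v₁ v₁' φ₂ φ₂' v₂ v₂' : ℝ → ℝ) : Prop where
  fst : Front b c h φ₁ φ₁' v₁ v₁'
  snd : Front b c h φ₂ φ₂' v₂ v₂'
  r_pos : 0 < r
  chi_eq : chi b c h 1 r = 0
  slope_nonneg : 0 ≤ chiSlope b c h r
  C_pos : 0 < C
  exp_fst : ∀ t, φ₁ t ≤ C * exp (3 / 4 * r * t)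
  exp_snd : ∀ t, φ₂ t ≤ C * exp (3 / 4 * r * t)
  le_flux_fst : ∀ t, L ≤ Front.flux b c h φ₁ v₁ v₁' r t
  le_flux_snd : ∀ t, L ≤ Front.flux b c h φ₂ v₂ v₂' r t
  flux_fst_le : ∀ t, Front.flux b c h φ₁ v₁ v₁' r t ≤ L + C * exp (r / 2 * t)
  flux_snd_le : ∀ t, Front.flux b c h φ₂ v₂ v₂' r t ≤ L + C * exp (r / 2 * t)

/-! ### Maximum principle and boundedness for the weighted difference -/

namespace FrontPair
variable {b c h r L C : ℝ} {φ₁ φ₁' v₁ v₁' φ₂ φ₂' v₂ v₂' : ℝ → ℝ}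

lemma symm (P : FrontPair b c h r L C φ₁ φ₁' v₁ v₁' φ₂ φ₂' v₂ v₂') :
    FrontPair b c h r L C φ₂ φ₂' v₂ v₂' φ₁ φ₁' v₁ v₁' :=
  ⟨P.snd, P.fst, P.r_pos, P.chi_eq, P.slope_nonneg, P.C_pos, P.exp_snd, P.exp_fst,
    P.le_flux_snd, P.le_flux_fst, P.flux_snd_le, P.flux_fst_le⟩

lemma one_sub_pos (P : FrontPair b c h r L C φ₁ φ₁' v₁ v₁' φ₂ φ₂' v₂ v₂') :
    0 < 1 - b * exp (-(r * h)) := P.fst.one_sub_pos P.r_pos.le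

lemma shift_nonneg (P : FrontPair b c h r L C φ₁ φ₁' v₁ v₁' φ₂ φ₂' v₂ v₂') :
    0 ≤ b * exp (-(r * h)) := mul_nonneg P.fst.b_nonneg (exp_pos _).le

/-- The characteristic equation. -/
lemma root_eq (P : FrontPair b c h r L C φ₁ φ₁' v₁ v₁' φ₂ φ₂' v₂ v₂') :
    r ^ 2 - c * r = -(1 / (1 - b * exp (-(r * h)))) := by
  have := P.chi_eq
  unfold chi at this
  linarith

lemma root_lt (P : FrontPair b c h r L C φ₁ φ₁' v₁ v₁' φ₂ φ₂' v₂ v₂') : r < c := by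
  have h1 := P.root_eq
  have h2 := one_div_pos.2 P.one_sub_pos
  nlinarith [P.r_pos]

lemma wdiff_v (P : FrontPair b c h r L C φ₁ φ₁' v₁ v₁' φ₂ φ₂' v₂ v₂') (t : ℝ) :
    wdiff r v₁ v₂ t = wdiff r φ₁ φ₂ t - b * exp (-(r * h)) * wdiff r φ₁ φ₂ (t - h) := by
  have e : exp (-(r * h)) * exp (-r * (t - h)) = exp (-r * t) := by rw [← exp_add]; ring_nf
  unfold wdiff
  rw [P.fst.v_eq, P.snd.v_eq]
  linear_combination b * (φ₁ (t - h) - φ₂ (t - h)) * e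

lemma continuous_wdiff_v (P : FrontPair b c h r L C φ₁ φ₁' v₁ v₁' φ₂ φ₂' v₂ v₂') :
    Continuous (wdiff r v₁ v₂) := by
  have := P.fst.continuous_v
  have := P.snd.continuous_v
  unfold wdiff
  fun_prop

lemma continuous_wdiff (P : FrontPair b c h r L C φ₁ φ₁' v₁ v₁' φ₂ φ₂' v₂ v₂') :
    Continuous (wdiff r φ₁ φ₂) := by
  have := P.fst.continuous
  have := P.snd.continuous
  unfold wdiff
  fun_prop

/-- One-sided comparison of the profiles from one-sided comparison of their neutral parts. -/
lemma sub_le (P : FrontPair b c h r L C φ₁ φ₁' v₁ v₁' φ₂ φ₂' v₂ v₂') {S : ℝ} (hS : 0 ≤ S)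
    (hv : ∀ t, v₁ t - v₂ t ≤ S * exp (r * t)) (t : ℝ) :
    φ₁ t - φ₂ t ≤ S * (exp (r * t) / (1 - b * exp (-(r * h)))) := by
  have ha := P.one_sub_pos
  have := nonneg_of_shift P.fst.b_nonneg P.fst.b_lt_one (h := h) (C := 1)
    (D := fun t => S * (exp (r * t) / (1 - b * exp (-(r * h)))) - (φ₁ t - φ₂ t))
    (fun t => ?_) (fun t => ?_) t
  · linarith
  · have h1 : 0 ≤ S * (exp (r * t) / (1 - b * exp (-(r * h)))) := by positivity
    linarith [P.fst.le_one t, P.snd.nonneg t]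
  · have h1 := hv t
    rw [P.fst.v_eq, P.snd.v_eq] at h1
    have h2 : S * exp (r * t) = S * (exp (r * t) / (1 - b * exp (-(r * h)))) -
        b * (S * (exp (r * (t - h)) / (1 - b * exp (-(r * h))))) := by
      rw [exp_mul_sub]
      field_simp
    linarith

lemma wdiff_le (P : FrontPair b c h r L C φ₁ φ₁' v₁ v₁' φ₂ φ₂' v₂ v₂') {S : ℝ} (hS : 0 ≤ S)
    (hv : ∀ t, wdiff r v₁ v₂ t ≤ S) (t : ℝ) :
    wdiff r φ₁ φ₂ t ≤ S / (1 - b * exp (-(r * h))) := by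
  rw [wdiff_le_iff]
  refine (P.sub_le hS (fun t => wdiff_le_iff.1 (hv t)) t).trans_eq ?_
  ring

/-- Strong maximum principle. -/
lemma wdiff_lt (P : FrontPair b c h r L C φ₁ φ₁' v₁ v₁' φ₂ φ₂' v₂ v₂') {S : ℝ} (hS : 0 < S)
    (hv : ∀ t, |wdiff r v₁ v₂ t| ≤ S) (t : ℝ) : wdiff r v₁ v₂ t < S := by
  have hle : ∀ t, v₁ t - v₂ t ≤ S * exp (r * t) := fun t =>
    wdiff_le_iff.1 ((le_abs_self _).trans (hv t))
  have hge : ∀ t, v₂ t - v₁ t ≤ S * exp (r * t) := fun t => wdiff_le_iff.1 (by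
    rw [wdiff_swap]
    exact (neg_le_abs _).trans (hv t))
  refine lt_of_le_of_ne ((le_abs_self _).trans (hv t)) fun heq => ?_
  have ha := P.one_sub_pos
  have h1 : ∀ t, HasDerivAt (fun t => S * exp (r * t) - (v₁ t - v₂ t))
      (S * (r * exp (r * t)) - (v₁' t - v₂' t)) t := fun t =>
    ((hasDerivAt_exp_mul r t).const_mul S).sub ((P.fst.hasDerivAt_v t).sub (P.snd.hasDerivAt_v t))
  have h2 := (((hasDerivAt_exp_mul r t).const_mul r).const_mul S).sub
    ((P.fst.hasDerivAt_v' t).sub (P.snd.hasDerivAt_v' t))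
  have h0 : v₁ t - v₂ t = S * exp (r * t) := by rw [← exp_mul_wdiff r, heq, mul_comm]
  obtain ⟨e1, e2⟩ := second_derivative_test (fun t => sub_nonneg.2 (hle t))
    (by rw [h0, sub_self]) h1 h2
  have f1 := P.sub_le hS.le hle t
  have f2 := P.sub_le hS.le hle (t - h)
  have f3 := P.symm.sub_le hS.le hge (t - h)
  have f4 := P.fst.le_shift P.r_pos P.chi_eq t
  have hpos : 0 < exp (r * t) / (1 - b * exp (-(r * h))) := by positivity
  rw [P.fst.v_eq, P.snd.v_eq] at h0
  have hsh : exp (r * (t - h)) / (1 - b * exp (-(r * h))) =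
      exp (-(r * h)) * (exp (r * t) / (1 - b * exp (-(r * h)))) := by
    rw [exp_mul_sub]; ring
  have hexp : exp (r * t) =
      exp (r * t) / (1 - b * exp (-(r * h))) * (1 - b * exp (-(r * h))) := by field_simp
  rw [hsh] at f2 f3
  have e3 : S * (r * (r * exp (r * t))) - c * (v₁' t - v₂' t) =
      -(S * (exp (r * t) / (1 - b * exp (-(r * h))))) := by
    linear_combination S * exp (r * t) * P.root_eq + c * e1
  set Φ := exp (r * t) / (1 - b * exp (-(r * h))) with hΦ
  set ε := exp (-(r * h)) with hε
  have hb0 := P.fst.b_nonneg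
  have hSΦ : 0 < S * Φ := mul_pos hS hpos
  have hp1 := P.fst.pos (t - h)
  have hp2 := P.snd.pos (t - h)
  have hp3 := P.fst.pos t
  have hp4 := P.snd.pos t
  have hq := P.snd.le_one (t - h)
  rw [hexp] at h0
  -- The condition D'' ≥ 0 for D = S e^{rt} - (v₁ - v₂) at its zero t, with v'' eliminated by the
  -- equation and e^{rt} by χ(r) = 0.
  have e4 : S * Φ - (φ₁ t - φ₂ t) + (φ₁ t * φ₁ (t - h) - φ₂ t * φ₂ (t - h)) ≤ 0 := by linarith
  -- If the delayed difference is nonnegative, then φ₁ > φ₂ at t and the quadratic terms are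
  -- strictly ordered. Otherwise `e4` splits into the three products below; the last is positive
  -- because φ₂(t - h) > φ₁(t - h) ≥ e^{-rh} φ₁(t). The lower bound -S on the weighted difference is
  -- used for the middle one.
  rcases le_or_gt 0 (φ₁ (t - h) - φ₂ (t - h)) with hd | hd
  · have g1 : 0 < φ₁ t - φ₂ t := by
      have g2 : 0 ≤ b * (φ₁ (t - h) - φ₂ (t - h)) := mul_nonneg hb0 hd
      have g3 : 0 < S * (Φ * (1 - b * ε)) := by positivity
      linarith
    have g4 := mul_pos g1 hp1
    have g5 := mul_nonneg hp4.le hd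
    linarith
  · have g1 : 0 ≤ (S * Φ - (φ₁ t - φ₂ t)) * (1 - φ₂ (t - h)) :=
      mul_nonneg (by linarith) (by linarith)
    have g2 : 0 ≤ φ₁ t * (S * (ε * Φ) - (φ₂ (t - h) - φ₁ (t - h))) :=
      mul_nonneg hp3.le (by linarith)
    have g3 : 0 < S * Φ * (φ₂ (t - h) - ε * φ₁ t) := mul_pos hSΦ (by linarith)
    linarith

end FrontPair

/-- The increments of the weighted profile are controlled by the flux. -/
lemma Front.exp_mul_le_of_le_flux {b c h r L : ℝ} {φ φ' v v' : ℝ → ℝ} (F : Front b c h φ φ' v v')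
    (hr : 0 < r) (hχ : chi b c h 1 r = 0) (hm : 0 ≤ chiSlope b c h r)
    (hL : ∀ t, L ≤ flux b c h φ v v' r t) {s t : ℝ} (hst : s ≤ t) :
    exp (-r * s) * φ s ≤ exp (-r * t) * φ t + -L / (1 - b) * (t - s) := by
  have hmono : Monotone fun t => exp (-r * t) * φ t + -L / (1 - b) * t := by
    refine monotone_of_hasDerivAt_nonneg' (fun t => (hasDerivAt_exp_mul_mul (-r)
      (F.hasDerivAt_φ t)).add ((hasDerivAt_id t).const_mul _)) fun t => ?_
    have h1 := F.flux_le hr hχ t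
    have h2 := mul_nonneg hm (mul_nonneg (exp_pos (-r * t)).le (F.v_pos t).le)
    have h3 := mul_le_mul_of_nonneg_left (F.defect_φ_le (F.v'_le_root hr hχ) hr.le t)
      (exp_pos (-r * t)).le
    have h4 : exp (-r * t) * ((r * v t - v' t) / (1 - b)) ≤ -L / (1 - b) := by
      rw [← mul_div_assoc]
      exact div_le_div_of_nonneg_right (by linarith [hL t]) F.one_sub_b_pos.le
    linarith
  have := hmono hst
  dsimp only at this
  linarith

/-- The ratio `b e^{-rh} / (1 - b e^{-rh})`. -/
def shiftRatio (b h r : ℝ) : ℝ := b * exp (-(r * h)) / (1 - b * exp (-(r * h)))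

namespace FrontPair
variable {b c h r L C : ℝ} {φ₁ φ₁' v₁ v₁' φ₂ φ₂' v₂ v₂' : ℝ → ℝ}

lemma ratio_nonneg (P : FrontPair b c h r L C φ₁ φ₁' v₁ v₁' φ₂ φ₂' v₂ v₂') :
    0 ≤ shiftRatio b h r := div_nonneg P.shift_nonneg P.one_sub_pos.le

/-- The windowed functional which turns the neutral terms into a full derivative. -/
def gap (b h r S K : ℝ) (φ₁ v₁ φ₂ v₂ : ℝ → ℝ) (t : ℝ) : ℝ :=
  S - wdiff r v₁ v₂ t +
    momentWindow (shiftRatio b h r) (h * shiftRatio b h r ^ 2) h (fun s => K - wdiff r φ₁ φ₂ s) t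

/-- With β = b e^{-rh}, α = β/(1 - β) and γ = hα² one has hα + γ = hβ/(1 - β)² and γ = β · hβ/(1 -
β)². Hence the boundary terms of the window combine into a multiple of the weighted difference of v,
the delay part of `chiSlope`, while its integral is that of the flux. The constant K drops out. -/
lemma hasDerivAt_gap (P : FrontPair b c h r L C φ₁ φ₁' v₁ v₁' φ₂ φ₂' v₂ v₂') (S K t : ℝ) :
    HasDerivAt (gap b h r S K φ₁ v₁ φ₂ v₂)
      (-(Front.flux b c h φ₁ v₁ v₁' r t - Front.flux b c h φ₂ v₂ v₂' r t) -
        chiSlope b c h r * wdiff r v₁ v₂ t) t := by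
  have hcont := P.continuous_wdiff
  have ha := P.one_sub_pos
  have h1 := ((hasDerivAt_wdiff (r := r) (P.fst.hasDerivAt_v t) (P.snd.hasDerivAt_v t)).const_sub
    S).add (hasDerivAt_momentWindow (α := shiftRatio b h r) (γ := h * shiftRatio b h r ^ 2) (h := h)
      (k := fun s => K - wdiff r φ₁ φ₂ s) (by fun_prop) t)
  refine h1.congr_deriv ?_
  have hc1 := P.fst.continuous
  have hc2 := P.snd.continuous
  have i1 : ∫ s in (t - h)..t, (K - wdiff r φ₁ φ₂ s) =
      h * K - ∫ s in (t - h)..t, wdiff r φ₁ φ₂ s := by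
    rw [intervalIntegral.integral_sub (by simp) (hcont.intervalIntegrable _ _)]
    simp
  have i2 : ∫ s in (t - h)..t, wdiff r φ₁ φ₂ s =
      (∫ s in (t - h)..t, exp (-r * s) * φ₁ s) - ∫ s in (t - h)..t, exp (-r * s) * φ₂ s := by
    rw [← intervalIntegral.integral_sub
      ((by fun_prop : Continuous fun s => exp (-r * s) * φ₁ s).intervalIntegrable _ _)
      ((by fun_prop : Continuous fun s => exp (-r * s) * φ₂ s).intervalIntegrable _ _)]
    congr 1
    funext s
    rw [wdiff, mul_sub]
  have i3 : wdiff r v₁ v₂ t = exp (-r * t) * (v₁ t - v₂ t) := rfl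
  have i4 : h * shiftRatio b h r + h * shiftRatio b h r ^ 2 =
      h * (b * exp (-(r * h))) / (1 - b * exp (-(r * h))) ^ 2 := by
    unfold shiftRatio
    field_simp
    ring
  have i5 : h * shiftRatio b h r ^ 2 =
      h * (b * exp (-(r * h))) / (1 - b * exp (-(r * h))) ^ 2 * (b * exp (-(r * h))) := by
    unfold shiftRatio
    field_simp
  rw [i1, i2]
  unfold Front.flux chiSlope
  rw [show b * exp (-(r * h)) / (1 - b * exp (-(r * h))) = shiftRatio b h r from rfl]
  linear_combination (-wdiff r φ₁ φ₂ t) * i4 + wdiff r φ₁ φ₂ (t - h) * i5 +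
    (c - 2 * r) * i3 + h * (b * exp (-(r * h))) / (1 - b * exp (-(r * h))) ^ 2 * P.wdiff_v t

lemma flux_sub_le (P : FrontPair b c h r L C φ₁ φ₁' v₁ v₁' φ₂ φ₂' v₂ v₂') (t : ℝ) :
    Front.flux b c h φ₁ v₁ v₁' r t - Front.flux b c h φ₂ v₂ v₂' r t ≤ C * exp (r / 2 * t) := by
  linarith [P.flux_fst_le t, P.le_flux_snd t]

lemma abs_wdiff_v_le (P : FrontPair b c h r L C φ₁ φ₁' v₁ v₁' φ₂ φ₂' v₂ v₂') (t : ℝ) :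
    |wdiff r v₁ v₂ t| ≤ exp (-r * t) := by
  rw [wdiff, abs_mul, abs_of_pos (exp_pos _)]
  refine mul_le_of_le_one_right (exp_pos _).le (abs_sub_le_iff.2 ⟨?_, ?_⟩)
  · linarith [P.fst.v_le_one t, P.snd.v_pos t]
  · linarith [P.snd.v_le_one t, P.fst.v_pos t]

/-- One-sided bound of the weighted difference in the critical case. -/
lemma exists_wdiff_le (P : FrontPair b c h r L C φ₁ φ₁' v₁ v₁' φ₂ φ₂' v₂ v₂')
    (hm : chiSlope b c h r = 0) : ∃ M, ∀ t ≤ 0, -wdiff r φ₁ φ₂ t ≤ M := by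
  have hcont := P.continuous_wdiff
  have ha := P.one_sub_pos
  have hr := P.r_pos
  have hh := P.fst.h_nonneg
  set β := b * exp (-(r * h)) with hβ
  have hβ0 : 0 ≤ β := P.shift_nonneg
  set X := gap b h r 0 0 φ₁ v₁ φ₂ v₂ with hX
  -- In the critical case the slope term disappears and X' is minus the flux difference, hence at
  -- least -C e^{rt/2}; this bounds X above on t ≤ 0.
  have hmono : Monotone fun t => X t + 2 * C / r * exp (r / 2 * t) := by
    refine monotone_of_hasDerivAt_nonneg' (fun t => (P.hasDerivAt_gap 0 0 t).add
      ((hasDerivAt_exp_mul (r / 2) t).const_mul _)) fun t => ?_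
    have h1 := P.flux_sub_le t
    have h2 : 2 * C / r * (r / 2 * exp (r / 2 * t)) = C * exp (r / 2 * t) := by field_simp
    rw [hm, h2]
    linarith
  have hXle : ∀ t ≤ 0, X t ≤ X 0 + 2 * C / r := fun t ht => by
    have h1 := hmono ht
    have hC := P.C_pos
    have h2 : 0 ≤ 2 * C / r * exp (r / 2 * t) := by positivity
    simp only [mul_zero, exp_zero, mul_one] at h1
    linarith
  set Q := -L / (1 - b) * h with hQ
  have hL0 : 0 ≤ -L / (1 - b) :=
    div_nonneg (by linarith [P.le_flux_fst 0, P.fst.flux_nonpos hr P.chi_eq.le 0])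
      P.fst.one_sub_b_pos.le
  have hQ0 : 0 ≤ Q := mul_nonneg hL0 hh
  have hinc : ∀ s t, t - h ≤ s → s ≤ t → wdiff r φ₁ φ₂ s ≤ wdiff r φ₁ φ₂ t + Q := by
    intro s t h1 h2
    have h3 := P.fst.exp_mul_le_of_le_flux hr P.chi_eq P.slope_nonneg P.le_flux_fst h2
    have h4 : exp (-r * t) * φ₂ t ≤ exp (-r * s) * φ₂ s := P.snd.antitone_exp_mul hr P.chi_eq h2
    have h5 : -L / (1 - b) * (t - s) ≤ Q := mul_le_mul_of_nonneg_left (by linarith) hL0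
    unfold wdiff
    linarith
  have hdec : ∀ t, wdiff r φ₁ φ₂ t ≤ wdiff r φ₁ φ₂ (t - h) + Q := by
    intro t
    have h2 : t - h ≤ t := by linarith
    have h3 := P.snd.exp_mul_le_of_le_flux hr P.chi_eq P.slope_nonneg P.le_flux_snd h2
    have h4 : exp (-r * t) * φ₁ t ≤ exp (-r * (t - h)) * φ₁ (t - h) :=
      P.fst.antitone_exp_mul hr P.chi_eq h2
    rw [sub_sub_cancel, ← hQ] at h3
    unfold wdiff
    linarith
  -- Q bounds the oscillation over a delay window. If the weighted difference of φ is below -Q at t,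
  -- it is negative on the whole window; the moment term then has a sign and the bound on X applies.
  refine ⟨max Q ((X 0 + 2 * C / r + β * Q) / (1 - β)), fun t ht => ?_⟩
  rcases le_or_gt (-wdiff r φ₁ φ₂ t) Q with h1 | h1
  · exact h1.trans (le_max_left _ _)
  · refine le_trans ?_ (le_max_right _ _)
    have h2 : 0 ≤ momentWindow (shiftRatio b h r) (h * shiftRatio b h r ^ 2) h
        (fun s => 0 - wdiff r φ₁ φ₂ s) t :=
      momentWindow_nonneg (by fun_prop) P.ratio_nonneg (by positivity) hh fun s h3 h4 => by
        linarith [hinc s t h3 h4]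
    have h3 := hXle t ht
    rw [hX, gap, P.wdiff_v] at h3
    rw [le_div_iff₀ ha]
    have h4 := mul_le_mul_of_nonneg_left (hdec t) hβ0
    rw [← hX, ← hβ] at h3
    linarith

/-- For positive slope, `Front.flux_le` bounds each e^{-rt} v separately. In the critical case only
the difference is controlled, on t ≤ 0 and by symmetry from both sides. -/
lemma exists_abs_wdiff_le (P : FrontPair b c h r L C φ₁ φ₁' v₁ v₁' φ₂ φ₂' v₂ v₂') :
    ∃ M, ∀ t, |wdiff r v₁ v₂ t| ≤ M := by
  have hr := P.r_pos
  rcases P.slope_nonneg.eq_or_lt with hm | hm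
  · obtain ⟨M₁, hM₁⟩ := P.exists_wdiff_le hm.symm
    obtain ⟨M₂, hM₂⟩ := P.symm.exists_wdiff_le hm.symm
    set M := max M₁ M₂ with hM
    have hη : ∀ t ≤ 0, |wdiff r φ₁ φ₂ t| ≤ M := fun t ht => by
      have h2 := hM₂ t ht
      rw [wdiff_swap, neg_neg] at h2
      exact abs_le'.2 ⟨h2.trans (le_max_right _ _), (hM₁ t ht).trans (le_max_left _ _)⟩
    refine ⟨max (2 * M) 1, fun t => ?_⟩
    rcases le_total t 0 with ht | ht
    · refine le_trans ?_ (le_max_left _ _)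
      have h1 := hη t ht
      have h2 := hη (t - h) (by linarith [P.fst.h_nonneg])
      have hβ0 := P.shift_nonneg
      have ha := P.one_sub_pos
      rw [P.wdiff_v]
      refine (abs_sub _ _).trans ?_
      rw [abs_mul, abs_of_nonneg hβ0]
      have h3 : b * exp (-(r * h)) * |wdiff r φ₁ φ₂ (t - h)| ≤ 1 * M :=
        mul_le_mul (by linarith) h2 (abs_nonneg _) zero_le_one
      linarith
    · refine le_trans ((P.abs_wdiff_v_le t).trans (exp_le_one_iff.2 ?_)) (le_max_right _ _)
      have := mul_nonneg hr.le ht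
      linarith
  · have key : ∀ {φ φ' v v' : ℝ → ℝ}, Front b c h φ φ' v v' →
        (∀ t, L ≤ Front.flux b c h φ v v' r t) → ∀ t, exp (-r * t) * v t ≤ -L / chiSlope b c h r :=
      fun F hL t => by
        have h1 := F.flux_le hr P.chi_eq t
        have h2 := mul_nonneg (exp_pos (-r * t)).le (sub_nonneg.2 (F.v'_le_root hr P.chi_eq t))
        rw [le_div_iff₀ hm]
        linarith [hL t]
    refine ⟨-L / chiSlope b c h r, fun t => ?_⟩
    have h1 := key P.fst P.le_flux_fst t
    have h2 := key P.snd P.le_flux_snd t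
    have h3 := mul_pos (exp_pos (-r * t)) (P.fst.v_pos t)
    have h4 := mul_pos (exp_pos (-r * t)) (P.snd.v_pos t)
    rw [wdiff, mul_sub]
    exact abs_sub_le_iff.2 ⟨by linarith, by linarith⟩

end FrontPair

lemma exists_exp_mul_le {δ κ : ℝ} (hδ : 0 < δ) (hκ : 0 < κ) : ∃ T ≤ 0, ∀ t ≤ T, exp (δ * t) ≤ κ := by
  obtain ⟨T, hT⟩ := eventually_atBot.1 ((tendsto_exp_mul_atBot hδ).eventually (gt_mem_nhds hκ))
  exact ⟨min T 0, min_le_right _ _, fun t ht => (hT t (ht.trans (min_le_left _ _))).le⟩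

/-! ### The extremal gap and its Harnack inequality -/

namespace FrontPair
variable {b c h r L C : ℝ} {φ₁ φ₁' v₁ v₁' φ₂ φ₂' v₂ v₂' : ℝ → ℝ}

section gap
variable {S : ℝ}

lemma neg_le_wdiff (P : FrontPair b c h r L C φ₁ φ₁' v₁ v₁' φ₂ φ₂' v₂ v₂') (hS : 0 < S)
    (hv : ∀ t, |wdiff r v₁ v₂ t| ≤ S) (t : ℝ) :
    -(S / (1 - b * exp (-(r * h)))) ≤ wdiff r φ₁ φ₂ t := by
  have := P.symm.wdiff_le hS.le (fun t => by
    rw [wdiff_swap]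
    exact (neg_le_abs _).trans (hv t)) t
  rw [wdiff_swap] at this
  linarith

lemma wdiff_le_of_abs (P : FrontPair b c h r L C φ₁ φ₁' v₁ v₁' φ₂ φ₂' v₂ v₂') (hS : 0 < S)
    (hv : ∀ t, |wdiff r v₁ v₂ t| ≤ S) (t : ℝ) :
    wdiff r φ₁ φ₂ t ≤ S / (1 - b * exp (-(r * h))) :=
  P.wdiff_le hS.le (fun t => (le_abs_self _).trans (hv t)) t

/-- The functional used to measure the distance to the extremal value `S`. -/
abbrev extremalGap (b h r S : ℝ) (φ₁ v₁ φ₂ v₂ : ℝ → ℝ) : ℝ → ℝ :=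
  gap b h r S (S / (1 - b * exp (-(r * h)))) φ₁ v₁ φ₂ v₂

lemma le_extremalGap (P : FrontPair b c h r L C φ₁ φ₁' v₁ v₁' φ₂ φ₂' v₂ v₂') (hS : 0 < S)
    (hv : ∀ t, |wdiff r v₁ v₂ t| ≤ S) (t : ℝ) :
    S - wdiff r v₁ v₂ t ≤ extremalGap b h r S φ₁ v₁ φ₂ v₂ t := by
  have hh := P.fst.h_nonneg
  have hcont := P.continuous_wdiff
  refine le_add_of_nonneg_right (momentWindow_nonneg (by fun_prop) P.ratio_nonneg (by positivity)
    hh fun s _ _ => ?_)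
  linarith [P.wdiff_le_of_abs hS hv s]

/-- Exponential perturbations of the extremal difference are nondecreasing near minus infinity. -/
lemma exists_monotoneOn (P : FrontPair b c h r L C φ₁ φ₁' v₁ v₁' φ₂ φ₂' v₂ v₂') (hS : 0 < S)
    (hv : ∀ t, |wdiff r v₁ v₂ t| ≤ S) : ∃ K ρ, 0 < K ∧ r < ρ ∧
      MonotoneOn (fun t => S * exp (r * t) - (v₁ t - v₂ t) + K * exp (ρ * t)) (Iic 0) := by
  have hr := P.r_pos
  have hrc := P.root_lt
  have ha := P.one_sub_pos
  have hC := P.C_pos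
  -- The condition ρ > r makes the correction negligible against e^{rt} at -∞, ρ < 3r/2 lets it
  -- absorb the quadratic term, and ρ < c gives ρ² - cρ its negative sign.
  obtain ⟨ρ, hρr, hρ⟩ := exists_between (show r < min (3 / 2 * r) c from
    lt_min (by linarith) hrc)
  have hρ1 : ρ < 3 / 2 * r := hρ.trans_le (min_le_left _ _)
  have hρc : ρ < c := hρ.trans_le (min_le_right _ _)
  have hρ0 : 0 < ρ := hr.trans hρr
  have hd : 0 < ρ * (c - ρ) := mul_pos hρ0 (by linarith)
  set K₀ := C ^ 2 / (ρ * (c - ρ)) with hK₀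
  have hK₀0 : 0 < K₀ := by positivity
  have hanti : AntitoneOn (fun t => exp (-c * t) * (S * (r * exp (r * t)) - (v₁' t - v₂' t) +
      K₀ * (ρ * exp (ρ * t)))) (Iic 0) := by
    refine antitoneOn_of_hasDerivAt_nonpos (convex_Iic 0) (fun t _ => hasDerivAt_exp_mul_mul (-c)
      (((((hasDerivAt_exp_mul r t).const_mul r).const_mul S).sub
        ((P.fst.hasDerivAt_v' t).sub (P.snd.hasDerivAt_v' t))).add
        (((hasDerivAt_exp_mul ρ t).const_mul ρ).const_mul K₀))) fun t ht => ?_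
    refine mul_nonpos_of_nonneg_of_nonpos (exp_pos _).le ?_
    have h1 := P.sub_le hS.le (fun t => wdiff_le_iff.1 ((le_abs_self _).trans (hv t))) t
    have h2 : φ₂ t * φ₂ (t - h) ≤ C ^ 2 * exp (ρ * t) := by
      have e1 := P.exp_snd t
      have e2 : exp (3 / 4 * r * t) * exp (3 / 4 * r * t) ≤ exp (ρ * t) := by
        have ht' : t ≤ 0 := ht
        rw [← exp_add, exp_le_exp]
        nlinarith
      calc φ₂ t * φ₂ (t - h) ≤ (C * exp (3 / 4 * r * t)) * (C * exp (3 / 4 * r * t)) :=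
            mul_le_mul e1 ((P.snd.shift_le t).trans e1) (P.snd.nonneg _) (by positivity)
        _ = C ^ 2 * (exp (3 / 4 * r * t) * exp (3 / 4 * r * t)) := by ring
        _ ≤ _ := mul_le_mul_of_nonneg_left e2 (by positivity)
    have h3 := mul_nonneg (P.fst.nonneg t) (P.fst.nonneg (t - h))
    have h4 : K₀ * (ρ * (c - ρ)) = C ^ 2 := div_mul_cancel₀ _ hd.ne'
    have h5 : S * (r * (r * exp (r * t))) - c * (S * (r * exp (r * t))) =
        -(S * (exp (r * t) / (1 - b * exp (-(r * h))))) := by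
      linear_combination S * exp (r * t) * P.root_eq
    have h6 : K₀ * (ρ * (ρ * exp (ρ * t))) - c * (K₀ * (ρ * exp (ρ * t))) =
        -(C ^ 2 * exp (ρ * t)) := by
      rw [← h4]
      ring
    linarith
  set M := |S * (r * exp (r * 0)) - (v₁' 0 - v₂' 0) + K₀ * (ρ * exp (ρ * 0))| with hM
  -- K₀ absorbs the quadratic term; M/ρ compensates the possibly negative derivative at 0, which
  -- propagates to the left as -M e^{ct} ≥ -M e^{ρt}.
  refine ⟨K₀ + M / ρ, ρ, by positivity, hρr, ?_⟩
  refine monotoneOn_of_hasDerivAt_nonneg (convex_Iic 0) (fun t _ =>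
    (((hasDerivAt_exp_mul r t).const_mul S).sub ((P.fst.hasDerivAt_v t).sub
      (P.snd.hasDerivAt_v t))).add ((hasDerivAt_exp_mul ρ t).const_mul _)) fun t ht => ?_
  have ht' : t ≤ 0 := ht
  have h1 := hanti ht (mem_Iic.2 le_rfl) ht'
  dsimp only at h1
  rw [mul_zero (-c), exp_zero, one_mul] at h1
  have h2 : -M ≤ exp (-c * t) * (S * (r * exp (r * t)) - (v₁' t - v₂' t) +
      K₀ * (ρ * exp (ρ * t))) := (neg_abs_le _).trans h1
  have h3 : exp (c * t) * exp (-c * t) = 1 := by rw [← exp_add]; simp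
  have h4 := mul_le_mul_of_nonneg_left h2 (exp_pos (c * t)).le
  rw [← mul_assoc, h3, one_mul] at h4
  have h5 : exp (c * t) * M ≤ M * exp (ρ * t) := by
    rw [mul_comm]
    exact mul_le_mul_of_nonneg_left (exp_le_exp.2 (by nlinarith)) (abs_nonneg _)
  have h6 : (K₀ + M / ρ) * (ρ * exp (ρ * t)) = K₀ * (ρ * exp (ρ * t)) + M * exp (ρ * t) := by
    field_simp
  rw [h6]
  linarith

/-- Harnack type inequality for the extremal gap. -/
lemma exists_extremalGap_le (P : FrontPair b c h r L C φ₁ φ₁' v₁ v₁' φ₂ φ₂' v₂ v₂') (hS : 0 < S)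
    (hv : ∀ t, |wdiff r v₁ v₂ t| ≤ S) : ∃ A δ, 0 < A ∧ 0 < δ ∧ ∀ t ≤ 0,
      extremalGap b h r S φ₁ v₁ φ₂ v₂ t ≤ A * (S - wdiff r v₁ v₂ t + exp (δ * t)) := by
  obtain ⟨K, ρ, hK, hρ, hmono⟩ := P.exists_monotoneOn hS hv
  have hr := P.r_pos
  have ha := P.one_sub_pos
  have hb := P.fst.one_sub_b_pos
  have hh := P.fst.h_nonneg
  have hb0 := P.fst.b_nonneg
  have hcont := P.continuous_wdiff
  have ha' := P.fst.one_sub_pos (hr.trans hρ).le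
  set K' := K / (1 - b * exp (-(ρ * h))) with hK'
  have hK'0 : 0 < K' := by positivity
  set Φ : ℝ → ℝ := fun t => exp (r * t) / (1 - b * exp (-(r * h))) with hΦ
  -- The resolvent image of the function shown to be nondecreasing in `exists_monotoneOn`: the
  -- extremal difference at the level of φ.
  set Z : ℝ → ℝ := fun t => S * Φ t - (φ₁ t - φ₂ t) + K' * exp (ρ * t) with hZ
  have hZsub : ∀ t, Z t - b * Z (t - h) =
      S * exp (r * t) - (v₁ t - v₂ t) + K * exp (ρ * t) := fun t => by
    have e1 : Φ t - b * Φ (t - h) = exp (r * t) := by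
      simp only [hΦ]
      rw [exp_mul_sub]
      field_simp
    have e2 : K' * exp (ρ * t) - b * (K' * exp (ρ * (t - h))) = K * exp (ρ * t) := by
      rw [hK', exp_mul_sub]
      field_simp
    rw [P.fst.v_eq, P.snd.v_eq]
    simp only [hZ]
    linear_combination S * e1 + e2
  have hZ0 : ∀ t, 0 ≤ Z t := fun t => by
    have h1 := P.sub_le hS.le (fun t => wdiff_le_iff.1 ((le_abs_self _).trans (hv t))) t
    have h2 : 0 ≤ K' * exp (ρ * t) := by positivity
    simp only [hZ, hΦ]
    linarith
  have hZle : ∀ t ≤ 0, Z t ≤ S * Φ 0 + 1 + K' := fun t ht => by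
    have h1 : exp (r * t) ≤ exp (r * 0) := exp_le_exp.2 (by nlinarith)
    have h2 : exp (ρ * t) ≤ 1 := exp_le_one_iff.2 (by nlinarith)
    have h3 : S * Φ t ≤ S * Φ 0 := mul_le_mul_of_nonneg_left
      (div_le_div_of_nonneg_right h1 ha.le) hS.le
    have h4 := mul_le_of_le_one_right hK'0.le h2
    have h5 := P.fst.nonneg t
    have h6 := P.snd.le_one t
    simp only [hZ]
    linarith
  -- Monotonicity survives the resolvent. Consequently values of Z on the window are at most Z(t),
  -- and (1 - b)Z(t) is at most the corresponding quantity for v.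
  have hZmono : ∀ d, 0 ≤ d → ∀ t ≤ 0, Z (t - d) ≤ Z t := fun d hd t ht => by
    have := nonneg_of_shift_on hb0 P.fst.b_lt_one (h := h) (C := S * Φ 0 + 1 + K') (s := Iic 0)
      (fun t ht => by
        have : t ≤ 0 := ht
        exact mem_Iic.2 (by linarith)) (D := fun t => Z t - Z (t - d))
      (fun t ht => by
        have h1 : t ≤ 0 := ht
        linarith [hZ0 t, hZle (t - d) (by linarith)])
      (fun t ht => by
        have h1 : t ≤ 0 := ht
        have h2 := hmono (mem_Iic.2 (show t - d ≤ 0 by linarith)) ht (by linarith)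
        dsimp only at h2
        rw [← hZsub, ← hZsub] at h2
        rw [show t - h - d = t - d - h by ring]
        linarith) t ht
    linarith
  set α := shiftRatio b h r with hα
  have hα0 : 0 ≤ α := P.ratio_nonneg
  set B := exp (r * h) / (1 - b) with hB
  have hB0 : 0 < B := by positivity
  set m := h * (α * h + h * α ^ 2) with hm
  have hm0 : 0 ≤ m := by positivity
  refine ⟨1 + m * B * (1 + K), ρ - r, by positivity, by linarith, fun t ht => ?_⟩
  set G := S - wdiff r v₁ v₂ t with hG
  have hG0 : 0 ≤ G := sub_nonneg.2 ((le_abs_self _).trans (hv t))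
  have hZt : Z t ≤ exp (r * t) * ((G + K * exp ((ρ - r) * t)) / (1 - b)) := by
    have h1 := mul_le_mul_of_nonneg_left (hZmono h hh t ht) hb0
    have h2 : exp (r * t) * exp ((ρ - r) * t) = exp (ρ * t) := by rw [← exp_add]; ring_nf
    have h3 : exp (r * t) * (G + K * exp ((ρ - r) * t)) = Z t - b * Z (t - h) := by
      rw [hZsub, ← exp_mul_wdiff r v₁ v₂ t, ← h2, hG]
      ring
    rw [← mul_div_assoc, h3, le_div_iff₀ hb]
    linarith
  have hE : ∀ s, t - h ≤ s → s ≤ t → S / (1 - b * exp (-(r * h))) - wdiff r φ₁ φ₂ s ≤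
      B * (G + K * exp ((ρ - r) * t)) := fun s h1 h2 => by
    have h3 := hZmono (t - s) (by linarith) t ht
    rw [sub_sub_cancel] at h3
    have h4 : exp (r * s) * (S / (1 - b * exp (-(r * h))) - wdiff r φ₁ φ₂ s) ≤ Z s := by
      have : 0 ≤ K' * exp (ρ * s) := by positivity
      rw [mul_sub, exp_mul_wdiff]
      simp only [hZ, hΦ]
      rw [mul_div_left_comm]
      linarith
    have h5 : exp (r * t) ≤ exp (r * s) * exp (r * h) := by
      rw [← exp_add, exp_le_exp]
      nlinarith
    have h6 : 0 ≤ (G + K * exp ((ρ - r) * t)) / (1 - b) := by positivity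
    refine le_of_mul_le_mul_left ?_ (exp_pos (r * s))
    calc _ ≤ exp (r * t) * ((G + K * exp ((ρ - r) * t)) / (1 - b)) := (h4.trans h3).trans hZt
      _ ≤ exp (r * s) * exp (r * h) * ((G + K * exp ((ρ - r) * t)) / (1 - b)) :=
        mul_le_mul_of_nonneg_right h5 h6
      _ = _ := by rw [hB]; ring
  have h1 := momentWindow_le (α := α) (γ := h * α ^ 2) (h := h) (t := t)
    (k := fun s => S / (1 - b * exp (-(r * h))) - wdiff r φ₁ φ₂ s) (by fun_prop) hα0
    (by positivity) hh (fun s _ _ => sub_nonneg.2 (P.wdiff_le_of_abs hS hv s)) hE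
  have he : 0 ≤ exp ((ρ - r) * t) := (exp_pos _).le
  have hmB : 0 ≤ m * B := mul_nonneg hm0 hB0.le
  calc extremalGap b h r S φ₁ v₁ φ₂ v₂ t ≤ G + m * B * (G + K * exp ((ρ - r) * t)) := by
        refine (add_le_add_right h1 G).trans_eq ?_
        rw [hm]
        ring
    _ ≤ (1 + m * B * (1 + K)) * (G + exp ((ρ - r) * t)) := by
        have e1 := mul_nonneg hmB hG0
        have e2 := mul_nonneg hmB he
        have e3 := mul_nonneg (mul_nonneg hmB hK.le) hG0
        linarith

end gap
end FrontPair

/-! ### Excluding an extremal value approached at minus infinity -/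

namespace FrontPair
variable {b c h r L C : ℝ} {φ₁ φ₁' v₁ v₁' φ₂ φ₂' v₂ v₂' : ℝ → ℝ}

section gap
variable {S : ℝ}

/-- The extremal value can only be approached at minus infinity. -/
lemma exists_le_of_forall_exists (P : FrontPair b c h r L C φ₁ φ₁' v₁ v₁' φ₂ φ₂' v₂ v₂')
    (hS : 0 < S) (hv : ∀ t, |wdiff r v₁ v₂ t| ≤ S)
    (hsup : ∀ ε, 0 < ε → ∃ t, S - ε < wdiff r v₁ v₂ t) (T ε : ℝ) (hε : 0 < ε) :
    ∃ t ≤ T, S - ε < wdiff r v₁ v₂ t := by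
  obtain ⟨T', hT'⟩ := eventually_atTop.1
    ((tendsto_exp_neg_mul_atTop P.r_pos).eventually (gt_mem_nhds (half_pos hS)))
  obtain ⟨x, hx, hxmax⟩ := isCompact_Icc.exists_isMaxOn (nonempty_Icc.2 (le_max_left T T'))
    P.continuous_wdiff_v.continuousOn
  have hxS := P.wdiff_lt hS hv x
  -- The tolerance excludes the compact middle range, whose maximum is below S, and the far right,
  -- where the weighted difference is below S/2.
  obtain ⟨t, ht⟩ := hsup (min ε (min (S - wdiff r v₁ v₂ x) (S / 2)))
    (lt_min hε (lt_min (by linarith) (by linarith)))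
  have h1 := min_le_left ε (min (S - wdiff r v₁ v₂ x) (S / 2))
  have h2 := (min_le_right ε (min (S - wdiff r v₁ v₂ x) (S / 2))).trans (min_le_left _ _)
  have h3 := (min_le_right ε (min (S - wdiff r v₁ v₂ x) (S / 2))).trans (min_le_right _ _)
  refine ⟨t, ?_, by linarith⟩
  by_contra hlt
  push Not at hlt
  rcases le_total t (max T T') with h4 | h4
  · have h5 : wdiff r v₁ v₂ t ≤ wdiff r v₁ v₂ x := hxmax ⟨hlt.le, h4⟩
    linarith
  · have h5 := hT' t ((le_max_right _ _).trans h4)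
    have h6 := (le_abs_self _).trans (P.abs_wdiff_v_le t)
    linarith

/-- If the extremal value is approached, the extremal gap is small somewhere near minus infinity. -/
lemma exists_extremalGap_lt (P : FrontPair b c h r L C φ₁ φ₁' v₁ v₁' φ₂ φ₂' v₂ v₂')
    (hS : 0 < S) (hv : ∀ t, |wdiff r v₁ v₂ t| ≤ S)
    (hsup : ∀ ε, 0 < ε → ∃ t, S - ε < wdiff r v₁ v₂ t) (T κ : ℝ) (hκ : 0 < κ) :
    ∃ t ≤ T, extremalGap b h r S φ₁ v₁ φ₂ v₂ t ≤ κ := by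
  obtain ⟨A, δ, hA, hδ, hle⟩ := P.exists_extremalGap_le hS hv
  have h1 : 0 < κ / (2 * A) := by positivity
  obtain ⟨T₀, hT₀, hT₀'⟩ := exists_exp_mul_le hδ h1
  obtain ⟨t, ht, htS⟩ := P.exists_le_of_forall_exists hS hv hsup (min T T₀) _ h1
  have h2 := ht.trans (min_le_right _ _)
  refine ⟨t, ht.trans (min_le_left _ _), (hle t (h2.trans hT₀)).trans ?_⟩
  have h3 := hT₀' t h2
  calc _ ≤ A * (κ / (2 * A) + κ / (2 * A)) := mul_le_mul_of_nonneg_left (by linarith) hA.le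
    _ = κ := by field_simp; ring

/-- The supercritical case. -/
lemma false_of_slope_pos (P : FrontPair b c h r L C φ₁ φ₁' v₁ v₁' φ₂ φ₂' v₂ v₂')
    (hm : 0 < chiSlope b c h r) (hS : 0 < S) (hv : ∀ t, |wdiff r v₁ v₂ t| ≤ S)
    (hsup : ∀ ε, 0 < ε → ∃ t, S - ε < wdiff r v₁ v₂ t) : False := by
  have hr := P.r_pos
  have hC := P.C_pos
  set m := chiSlope b c h r with hmdef
  set X := extremalGap b h r S φ₁ v₁ φ₂ v₂ with hX
  have hge := P.le_extremalGap hS hv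
  obtain ⟨T₀, -, hT₀⟩ := exists_exp_mul_le (show 0 < r / 2 by positivity)
    (show 0 < m * S / 2 / C by positivity)
  -- Far to the left the flux difference costs at most mS/2, and w ≥ S - X gives X' ≤ m(X - S/2).
  have hanti : AntitoneOn (fun t => exp (-m * t) * (X t - S / 2)) (Iic T₀) := by
    refine antitoneOn_of_hasDerivAt_nonpos (convex_Iic T₀) (fun t _ =>
      hasDerivAt_exp_mul_mul (-m) ((P.hasDerivAt_gap S _ t).sub_const (S / 2))) fun t ht => ?_
    refine mul_nonpos_of_nonneg_of_nonpos (exp_pos _).le ?_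
    have h1 := P.symm.flux_sub_le t
    have h2 := hT₀ t ht
    rw [le_div_iff₀ hC] at h2
    have h3 := mul_le_mul_of_nonneg_left (hge t) hm.le
    rw [← hX] at h3
    rw [← hmdef]
    linarith
  -- From X ≤ S/4, a time 1/m multiplies X - S/2 ≤ -S/4 by at least e > 2, so X would become
  -- negative.
  obtain ⟨t, ht, hXt⟩ := P.exists_extremalGap_lt hS hv hsup (T₀ - 1 / m) (S / 4) (by positivity)
  have hm1 : 0 < 1 / m := by positivity
  have h1 := hanti (mem_Iic.2 (show t ≤ T₀ by linarith))
    (mem_Iic.2 (show t + 1 / m ≤ T₀ by linarith)) (by linarith)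
  dsimp only at h1
  have h2 : exp (-m * (t + 1 / m)) * exp 1 = exp (-m * t) := by
    rw [← exp_add]
    congr 1
    field_simp
    ring
  rw [← h2, mul_assoc] at h1
  have h3 := le_of_mul_le_mul_left h1 (exp_pos _)
  have h4 : 0 ≤ X (t + 1 / m) :=
    (sub_nonneg.2 ((le_abs_self _).trans (hv _))).trans (hge _)
  have h5 : (2 : ℝ) < exp 1 := by
    have := add_one_lt_exp (one_ne_zero (α := ℝ))
    linarith
  rw [← hX] at hXt
  nlinarith

/-- Lower bound for the difference of fluxes in terms of the extremal gap. -/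
lemma exists_le_flux_sub (P : FrontPair b c h r L C φ₁ φ₁' v₁ v₁' φ₂ φ₂' v₂ v₂') (hS : 0 < S)
    (hv : ∀ t, |wdiff r v₁ v₂ t| ≤ S) : ∃ A, 0 < A ∧ ∀ K T, 0 ≤ K →
      (∀ t ≤ T, extremalGap b h r S φ₁ v₁ φ₂ v₂ t ≤ K) → ∀ t ≤ T,
      -(A * K * exp (3 / 4 * r * t)) ≤
        Front.flux b c h φ₁ v₁ v₁' r t - Front.flux b c h φ₂ v₂ v₂' r t := by
  have hr := P.r_pos
  have hC := P.C_pos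
  have ha := P.one_sub_pos
  have hh := P.fst.h_nonneg
  have hβ0 := P.shift_nonneg
  have hr0 : 0 < 3 / 4 * r := by positivity
  set a := 1 - b * exp (-(r * h)) with hadef
  have hβa : b * exp (-(r * h)) = 1 - a := by rw [hadef]; ring
  refine ⟨2 * C / a / (3 / 4 * r), by positivity, fun K T hK hX t ht => ?_⟩
  -- The resolvent gives the stronger lower bound (S - K)/a. Its part S/a is dropped, which leaves
  -- an estimate linear in K, as the contraction argument requires.
  have hη : ∀ t ≤ T, -(K / a) ≤ wdiff r φ₁ φ₂ t := fun t ht => by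
    have := nonneg_of_shift_on hβ0 (by linarith : b * exp (-(r * h)) < 1) (h := h)
      (C := 2 * (S / a)) (s := Iic T) (fun t ht => by
        have : t ≤ T := ht
        exact mem_Iic.2 (by linarith)) (D := fun t => K / a - (S / a - wdiff r φ₁ φ₂ t))
      (fun t _ => ?_) (fun t ht => ?_) t ht
    · have h1 : 0 < S / a := by positivity
      linarith
    · have h1 := P.neg_le_wdiff hS hv t
      have h2 : 0 ≤ K / a := by positivity
      rw [← hadef] at h1
      linarith
    · have h1 := (P.le_extremalGap hS hv t).trans (hX t ht)
      rw [P.wdiff_v, hβa] at h1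
      have h2 : a * (K / a) = K := by field_simp
      have h3 : a * (S / a) = S := by field_simp
      rw [hβa]
      linarith
  have hmono : MonotoneOn (fun t => (Front.flux b c h φ₁ v₁ v₁' r t -
      Front.flux b c h φ₂ v₂ v₂' r t) + 2 * C / a / (3 / 4 * r) * K * exp (3 / 4 * r * t))
      (Iic T) := by
    refine monotoneOn_of_hasDerivAt_nonneg (convex_Iic T) (fun t _ =>
      ((P.fst.hasDerivAt_flux_root hr P.chi_eq t).sub
        (P.snd.hasDerivAt_flux_root hr P.chi_eq t)).add
        ((hasDerivAt_exp_mul (3 / 4 * r) t).const_mul _)) fun t ht => ?_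
    have ht' : t ≤ T := ht
    have e0 : exp (-(r * h)) * exp (-r * (t - h)) = exp (-r * t) := by rw [← exp_add]; ring_nf
    have e1 : exp (-r * t) * (φ₁ t * φ₁ (t - h)) - exp (-r * t) * (φ₂ t * φ₂ (t - h)) =
        φ₁ (t - h) * wdiff r φ₁ φ₂ t + φ₂ t * (exp (-(r * h)) * wdiff r φ₁ φ₂ (t - h)) := by
      unfold wdiff
      linear_combination (-φ₂ t * (φ₁ (t - h) - φ₂ (t - h))) * e0
    have e2 : 2 * C / a / (3 / 4 * r) * K * (3 / 4 * r * exp (3 / 4 * r * t)) =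
        2 * (C * exp (3 / 4 * r * t) * (K / a)) := by field_simp
    have hKa : 0 ≤ K / a := by positivity
    have e3 : 0 ≤ φ₁ (t - h) * (wdiff r φ₁ φ₂ t + K / a) :=
      mul_nonneg (P.fst.nonneg _) (by linarith [hη t ht'])
    have e4 : 0 ≤ φ₂ t * (exp (-(r * h)) * (wdiff r φ₁ φ₂ (t - h) + K / a)) :=
      mul_nonneg (P.snd.nonneg _)
        (mul_nonneg (exp_pos _).le (by linarith [hη (t - h) (by linarith)]))
    have e5 : φ₁ (t - h) * (K / a) ≤ C * exp (3 / 4 * r * t) * (K / a) :=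
      mul_le_mul_of_nonneg_right ((P.fst.shift_le t).trans (P.exp_fst t)) hKa
    have e6 : φ₂ t * (exp (-(r * h)) * (K / a)) ≤ C * exp (3 / 4 * r * t) * (K / a) := by
      refine mul_le_mul (P.exp_snd t) (mul_le_of_le_one_left hKa (exp_le_one_iff.2 ?_))
        (mul_nonneg (exp_pos _).le hKa) (by positivity)
      have := mul_nonneg hr.le hh
      linarith
    rw [e1, e2]
    linarith
  have hlim : Tendsto (fun s => -(C * exp (r / 2 * s))) atBot (𝓝 (-(C * 0))) :=
    ((tendsto_exp_mul_atBot (by positivity)).const_mul C).neg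
  rw [mul_zero, neg_zero] at hlim
  -- Integration starts at -∞, where the common limit makes the flux difference vanish.
  have := le_of_tendsto hlim ((eventually_le_atBot t).mono fun s hs => by
    have h1 := hmono (mem_Iic.2 (hs.trans ht)) (mem_Iic.2 ht) hs
    dsimp only at h1
    have h2 := P.symm.flux_sub_le s
    have h3 : 0 ≤ 2 * C / a / (3 / 4 * r) * K * exp (3 / 4 * r * s) := by positivity
    exact (by linarith : -(C * exp (r / 2 * s)) ≤ (Front.flux b c h φ₁ v₁ v₁' r t -
      Front.flux b c h φ₂ v₂ v₂' r t) + 2 * C / a / (3 / 4 * r) * K * exp (3 / 4 * r * t)))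
  linarith

/-- The critical case. -/
lemma false_of_slope_eq_zero (P : FrontPair b c h r L C φ₁ φ₁' v₁ v₁' φ₂ φ₂' v₂ v₂')
    (hm : chiSlope b c h r = 0) (hS : 0 < S) (hv : ∀ t, |wdiff r v₁ v₂ t| ≤ S)
    (hsup : ∀ ε, 0 < ε → ∃ t, S - ε < wdiff r v₁ v₂ t) : False := by
  have hr := P.r_pos
  have hC := P.C_pos
  set X := extremalGap b h r S φ₁ v₁ φ₂ v₂ with hX
  have hge := P.le_extremalGap hS hv
  have hd : ∀ t, HasDerivAt X (-(Front.flux b c h φ₁ v₁ v₁' r t -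
      Front.flux b c h φ₂ v₂ v₂' r t)) t := fun t => by
    have := P.hasDerivAt_gap S (S / (1 - b * exp (-(r * h)))) t
    rwa [hm, zero_mul, sub_zero] at this
  -- Now X' ≤ C e^{rt/2}, and X is arbitrarily small at points arbitrarily far to the left;
  -- integrating from there gives decay at every t.
  have hXle : ∀ t, X t ≤ 2 * C / r * exp (r / 2 * t) := fun t => by
    have hanti : Antitone fun t => X t - 2 * C / r * exp (r / 2 * t) := by
      refine antitone_of_hasDerivAt_nonpos' (fun t => (hd t).sub
        ((hasDerivAt_exp_mul (r / 2) t).const_mul _)) fun t => ?_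
      have h1 := P.symm.flux_sub_le t
      have h2 : 2 * C / r * (r / 2 * exp (r / 2 * t)) = C * exp (r / 2 * t) := by field_simp
      rw [h2]
      linarith
    refine le_of_forall_pos_le_add fun κ hκ => ?_
    obtain ⟨s, hs, hsκ⟩ := P.exists_extremalGap_lt hS hv hsup t κ hκ
    have h1 := hanti hs
    dsimp only at h1
    have h2 : 0 ≤ 2 * C / r * exp (r / 2 * s) := by positivity
    rw [← hX] at hsκ
    linarith
  obtain ⟨A, hA, hflux⟩ := P.exists_le_flux_sub hS hv
  obtain ⟨T, hT0, hT⟩ := exists_exp_mul_le (show 0 < 3 / 4 * r by positivity)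
    (show 0 < 1 / 2 / (A / (3 / 4 * r)) by positivity)
  -- A bound K on X bounds X' by AK e^{3rt/4}. Integrated from -∞, where X vanishes, this returns at
  -- most K/2 by the choice of T.
  have hstep : ∀ K, 0 ≤ K → (∀ t ≤ T, X t ≤ K) → ∀ t ≤ T, X t ≤ K / 2 := fun K hK hXK t ht => by
    have hanti : AntitoneOn (fun t => X t - A * K / (3 / 4 * r) * exp (3 / 4 * r * t)) (Iic T) := by
      refine antitoneOn_of_hasDerivAt_nonpos (convex_Iic T) (fun t _ => (hd t).sub
        ((hasDerivAt_exp_mul (3 / 4 * r) t).const_mul _)) fun t ht => ?_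
      have h1 := hflux K T hK hXK t ht
      have h2 : A * K / (3 / 4 * r) * (3 / 4 * r * exp (3 / 4 * r * t)) =
          A * K * exp (3 / 4 * r * t) := by field_simp
      rw [h2]
      linarith
    have hlim : Tendsto (fun s => 2 * C / r * exp (r / 2 * s)) atBot (𝓝 (2 * C / r * 0)) :=
      (tendsto_exp_mul_atBot (by positivity)).const_mul _
    rw [mul_zero] at hlim
    have h1 := ge_of_tendsto hlim ((eventually_le_atBot t).mono fun s hs => by
      have h1 := hanti (mem_Iic.2 (hs.trans ht)) (mem_Iic.2 ht) hs
      dsimp only at h1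
      have h2 := hXle s
      have h3 : 0 ≤ A * K / (3 / 4 * r) * exp (3 / 4 * r * s) := by positivity
      exact (by linarith : X t - A * K / (3 / 4 * r) * exp (3 / 4 * r * t) ≤
        2 * C / r * exp (r / 2 * s)))
    have h2 := hT t ht
    rw [le_div_iff₀ (by positivity)] at h2
    have h3 := mul_le_mul_of_nonneg_left h2 hK
    have h4 : K * (exp (3 / 4 * r * t) * (A / (3 / 4 * r))) =
        A * K / (3 / 4 * r) * exp (3 / 4 * r * t) := by ring
    linarith
  have hbdd : BddAbove (X '' Iic T) := by
    refine ⟨2 * C / r, ?_⟩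
    rintro _ ⟨t, ht, rfl⟩
    have ht' : t ≤ T := ht
    refine (hXle t).trans (mul_le_of_le_one_right (by positivity) (exp_le_one_iff.2 ?_))
    nlinarith
  have hle : ∀ t ≤ T, X t ≤ sSup (X '' Iic T) := fun t ht => le_csSup hbdd ⟨t, ht, rfl⟩
  -- The strong maximum principle makes X positive at T, so the supremum over the half-line is
  -- positive and cannot be at most half of itself.
  have hpos : 0 < X T := (sub_pos.2 (P.wdiff_lt hS hv T)).trans_le (hge T)
  have h1 := hle T le_rfl
  have h2 : sSup (X '' Iic T) ≤ sSup (X '' Iic T) / 2 := by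
    refine csSup_le ⟨_, T, mem_Iic.2 le_rfl, rfl⟩ ?_
    rintro _ ⟨t, ht, rfl⟩
    exact hstep _ (by linarith) hle t ht
  linarith

/-- The weighted difference stays away from its extremal value. -/
lemma exists_wdiff_le_sub (P : FrontPair b c h r L C φ₁ φ₁' v₁ v₁' φ₂ φ₂' v₂ v₂') (hS : 0 < S)
    (hv : ∀ t, |wdiff r v₁ v₂ t| ≤ S) : ∃ ε, 0 < ε ∧ ∀ t, wdiff r v₁ v₂ t ≤ S - ε := by
  by_contra! hcon
  rcases P.slope_nonneg.eq_or_lt with hm | hm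
  · exact P.false_of_slope_eq_zero hm.symm hS hv hcon
  · exact P.false_of_slope_pos hm hS hv hcon

end gap

/-- Applied to the pair and to its swap, the strict separation from S lowers the supremum of |w|, so
that supremum is 0; then v₁ = v₂, and the shift is injective on bounded functions. -/
theorem eq (P : FrontPair b c h r L C φ₁ φ₁' v₁ v₁' φ₂ φ₂' v₂ v₂') : φ₁ = φ₂ := by
  obtain ⟨M, hM⟩ := P.exists_abs_wdiff_le
  have hbdd : BddAbove (range fun t => |wdiff r v₁ v₂ t|) := by
    refine ⟨M, ?_⟩
    rintro _ ⟨t, rfl⟩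
    exact hM t
  set S := ⨆ t, |wdiff r v₁ v₂ t| with hSdef
  have hv : ∀ t, |wdiff r v₁ v₂ t| ≤ S := fun t => le_ciSup hbdd t
  have hS0 : S ≤ 0 := by
    by_contra! hS
    obtain ⟨ε₁, hε₁, h1⟩ := P.exists_wdiff_le_sub hS hv
    obtain ⟨ε₂, hε₂, h2⟩ := P.symm.exists_wdiff_le_sub hS fun t => by
      rw [wdiff_swap, abs_neg]
      exact hv t
    have h3 : S ≤ S - min ε₁ ε₂ := ciSup_le fun t => by
      have e1 := h1 t
      have e2 := h2 t
      rw [wdiff_swap] at e2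
      exact abs_le'.2 ⟨by linarith [min_le_left ε₁ ε₂], by linarith [min_le_right ε₁ ε₂]⟩
    linarith [lt_min hε₁ hε₂]
  refine eq_of_shift P.fst.b_nonneg P.fst.b_lt_one (h := h) (C := 1)
    (fun t => abs_le.2 ⟨by linarith [P.fst.nonneg t], P.fst.le_one t⟩)
    (fun t => abs_le.2 ⟨by linarith [P.snd.nonneg t], P.snd.le_one t⟩) fun t => ?_
  rw [← P.fst.v_eq, ← P.snd.v_eq, ← sub_eq_zero, ← exp_mul_wdiff r v₁ v₂ t,
    abs_nonpos_iff.1 ((hv t).trans hS0), mul_zero]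

end FrontPair

/-- Two fronts of the same equation are translates of each other. -/
theorem Front.exists_translate {b c h z : ℝ} {φ₁ φ₁' v₁ v₁' φ₂ φ₂' v₂ v₂' : ℝ → ℝ}
    (F₁ : Front b c h φ₁ φ₁' v₁ v₁') (F₂ : Front b c h φ₂ φ₂' v₂ v₂') (hz : 0 < z)
    (hχ : chi b c h 1 z = 0) : ∃ s, ∀ t, φ₂ t = φ₁ (t + s) := by
  obtain ⟨r, hr, hχr, hm⟩ := exists_min_root F₁.b_nonneg F₁.b_lt_one F₁.h_nonneg hz hχ
  obtain ⟨L₁, C₁, hL₁, -, -, hL₁le, hleL₁⟩ := F₁.exists_flux_limit hr hχr hm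
  obtain ⟨L₂, C₂, hL₂, hC₂, hexp₂, hL₂le, hleL₂⟩ := F₂.exists_flux_limit hr hχr hm
  -- Chosen so that e^{rs} L₁ = L₂; both limits are negative, so the quotient is positive.
  set s := log (L₂ / L₁) / r with hs
  have hers : exp (r * s) * L₁ = L₂ := by
    rw [hs, mul_div_cancel₀ _ hr.ne', exp_log (div_pos_of_neg_of_neg hL₂ hL₁),
      div_mul_cancel₀ _ hL₁.ne]
  obtain ⟨L, C, hL, hC, hexp, hLle, hleL⟩ := (F₁.comp_add s).exists_flux_limit hr hχr hm
  have hLL : L = L₂ := by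
    have key : ∀ {J : ℝ → ℝ} {l C : ℝ}, (∀ t, l ≤ J t) → (∀ t, J t ≤ l + C * exp (r / 2 * t)) →
        Tendsto J atBot (𝓝 l) := fun {J l C} h1 h2 => by
      refine tendsto_of_tendsto_of_tendsto_of_le_of_le tendsto_const_nhds ?_ h1 h2
      simpa using ((tendsto_exp_mul_atBot (show 0 < r / 2 by positivity)).const_mul C).const_add l
    have h1 := key hLle hleL
    have h2 := ((key hL₁le hleL₁).comp
      (tendsto_atBot_add_const_right _ s tendsto_id)).const_mul (exp (r * s))
    rw [hers] at h2
    refine tendsto_nhds_unique h1 (h2.congr fun t => ?_)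
    rw [flux_comp_add]
    rfl
  subst hLL
  have P : FrontPair b c h r L (C + C₂) φ₂ φ₂' v₂ v₂' (fun t => φ₁ (t + s))
      (fun t => φ₁' (t + s)) (fun t => v₁ (t + s)) (fun t => v₁' (t + s)) := by
    refine ⟨F₂, F₁.comp_add s, hr, hχr, hm, by positivity, fun t => ?_, fun t => ?_, hL₂le, hLle,
      fun t => ?_, fun t => ?_⟩
    · refine (hexp₂ t).trans (mul_le_mul_of_nonneg_right (by linarith) (exp_pos _).le)
    · refine (hexp t).trans (mul_le_mul_of_nonneg_right (by linarith) (exp_pos _).le)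
    · refine (hleL₂ t).trans (add_le_add_right
        (mul_le_mul_of_nonneg_right (by linarith) (exp_pos _).le) _)
    · refine (hleL t).trans (add_le_add_right
        (mul_le_mul_of_nonneg_right (by linarith) (exp_pos _).le) _)
  exact ⟨s, fun t => congrFun P.eq t⟩

/-! ### From the parameter domain to the theorem -/

lemma frontDomain_speed_pos {b τ c : ℝ} (hτc : (τ, c) ∈ frontDomain b) : 0 < c := by
  obtain ⟨-, hc, ⟨z, -, ha, hχ⟩, -⟩ := hτc
  refine lt_of_le_of_ne hc fun h0 => ?_
  dsimp only at ha hχ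
  have h1 := one_div_pos.2 ha
  unfold chiZero at hχ
  rw [← h0] at hχ h1
  nlinarith [sq_nonneg z]

/-- The exponent θ is minus the negative zero of χ₁, and `key` then holds with equality. -/
lemma stepParams_of_chiOne {b τ c z : ℝ} (hb0 : 0 ≤ b) (hb1 : b < 1) (hc : 0 < c) (hτ : 0 ≤ τ)
    (hz : z < 0) (ha : 0 < 1 - b * exp (-(z * c * τ))) (hχ : chiOne b τ c z = 0) :
    StepParams b c (c * τ) (-z) 1 := by
  have e : -z * (c * τ) = -(z * c * τ) := by ring
  refine ⟨hb0, hb1, hc, mul_nonneg hc.le hτ, by linarith, one_pos, le_rfl, by rwa [e], ?_⟩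
  unfold chiOne at hχ
  rw [e, one_mul, ← div_le_iff₀ ha]
  linarith

/-- Existence and uniqueness up to translation of monotone fronts. -/
theorem exists_front_forall_translate (b : ℝ) (hb0 : 0 ≤ b) (hb1 : b < 1) (τ c : ℝ)
    (hτc : (τ, c) ∈ frontDomain b) :
    ∃ u : ℝ → ℝ → ℝ,
      IsMonotoneTravelingFront b τ c u ∧
      ∀ w : ℝ → ℝ → ℝ, IsMonotoneTravelingFront b τ c w →
        ∃ s : ℝ, ∀ t x : ℝ, w t x = u t (x + s) := by
  have hc : 0 < c := frontDomain_speed_pos hτc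
  obtain ⟨hτ, -, ⟨z, hz, -, hχ⟩, ⟨z₁, hz₁, ha₁, hχ₁⟩⟩ := hτc
  have hh : 0 ≤ c * τ := mul_nonneg hc.le hτ
  have H := stepParams_of_chiOne hb0 hb1 hc hτ hz₁ ha₁ hχ₁
  have hχ' : chi b c (c * τ) 1 z = 0 := by
    unfold chi
    rw [← mul_assoc]
    exact hχ
  obtain ⟨φ, hφ⟩ := exists_integralFront H hz hχ'
  refine ⟨fun t x => φ (x + c * t),
    (isMonotoneTravelingFront_iff b τ c _).2 ⟨φ, hφ.isProfile H, fun _ _ => rfl⟩, fun w hw => ?_⟩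
  obtain ⟨ψ, hψ, hwψ⟩ := (isMonotoneTravelingFront_iff b τ c w).1 hw
  obtain ⟨_, _, _, F₁⟩ := (hφ.isProfile H).exists_front hb0 hb1 hc hh
  obtain ⟨_, _, _, F₂⟩ := hψ.exists_front hb0 hb1 hc hh
  obtain ⟨s, hs⟩ := F₁.exists_translate F₂ hz hχ'
  exact ⟨s, fun t x => by rw [hwψ, hs, add_right_comm]⟩

end NeutralKPP
end

theorem theorem1p7 (b : ℝ) (hb0 : 0 ≤ b) (hb1 : b < 1) (τ c : ℝ) (hτc : (τ, c) ∈ frontDomain b) :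
    ∃ u : ℝ → ℝ → ℝ,
      IsMonotoneTravelingFront b τ c u ∧
      ∀ w : ℝ → ℝ → ℝ, IsMonotoneTravelingFront b τ c w →
        ∃ s : ℝ, ∀ t x : ℝ, w t x = u t (x + s) :=
  NeutralKPP.exists_front_forall_translate b hb0 hb1 τ c hτc
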